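/- Setting. Let $G'$ be a finite straight-line graph without crossings in the plane whose vertices are either reachable or unreachable, whose edges join vertices of the same kind, and whose reachable part is connected. A border region $B$ is a bounded face of $G'$ that is incident to reachable and to unreachable vertices (several unreachable components may be incident to $B$). Fix a triangulation $T$ of $B$ on the vertices of $G'$ incident to $B$, and an edge $e$ of $T$ joining a reachable vertex to an unreachable one. The important triangles $t_1,\dots,t_n$ form the shortest sequence in the dual graph of $T$ that starts and ends at $e$, runs once around the reachable boundary, keeping it on the left, and passes all edges of $T$ between reachable and unreachable vertices in the order in which they occur along the reachable boundary; that is, they arise from the sequence of edges of $T$ crossed by a walk along the reachable boundary by cancelling all immediate returns. A triangle may occur several times. Let $b_i$ ($0<i<n$) be the edge shared by $t_i$ and $t_{i+1}$, and $b_0=b_n=e$; its endpoints, as seen by the walk, are $\ell(b_i)$ and $r(b_i)$. Windows are computed one after the other. The first one starts from $a=e$ with initial edge $e$, each further one from the previous window $a$ and its initial edge. A point of $t_m$ is visible from $a$ if a straight segment leads to it from $a$ in the interior of the (possibly self-overlapping) polygon formed by the initial part between $a$ and its initial edge (empty for $a=e$) and the important triangles from the initial edge up to $t_m$. Let $t_h$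 be the last visible triangle. The window $w(a)$ is the edge of the visibility polygon that meets the interior of $t_h$ and separates in it the visible part from $b_h$; its relative interior lies in $B$ and its endpoints on the boundary of $B$. Its endpoints $r(w(a)),\ell(w(a))$ are named so that $r(w(a)),\ell(w(a)),\ell(b_h),r(b_h)$ is their clockwise order. The next initial edge is $b=b_h$, and the initial part $P_0$ consists of the triangles of $T$ met by $w(a)$, glued in the order in which $w(a)$ meets them and cut off along $w(a)$ on the side of $b$. Let $P_i$ be the (possibly self-overlapping) polygon formed by $P_0$ and $t_{h+1},\dots,t_{h+i}$, and let $\pi_i^{r}$ ($\pi_i^{\ell}$) be the shortest path in $P_i$ from $r(w(a))$ to $r(b_{h+i})$ (from $\ell(w(a))$ to $\ell(b_{h+i})$). The hourglass $H_0$ is the region enclosed by $w(a)$, $b$, $\pi_0^{r}$ and $\pi_0^{\ell}$. A segment is visibility-intersecting if it meets the interior of $H_0$. Lemma. Let $w(a)$ be the previous window and $b=b_h$ the next initial edge. Let $i\ge 1$ with $h+i\le n$ be such that $\pi_{i-1}^{r}$ contains no visibility-intersecting segment, the edge $b_{h+i}$ is (partially) visible from $w(a)$, and $t_{h+i}$ has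 a new right endpoint, i.e. $\ell(b_{h+i})=\ell(b_{h+i-1})$. Then the next segment $s$ appended to $\pi_{i-1}^{r}$, i.e. the edge of $t_{h+i}$ from $r(b_{h+i-1})$ to $r(b_{h+i})$, is visibility-intersecting if and only if $s$ intersects the open line segment $w(a)$. -/

import Mathlib

namespace BorderRegion

/-! ## The plane -/

/-- The Euclidean plane. -/
abbrev Plane : Type := EuclideanSpace ℝ (Fin 2)

/-- A line segment given by its pair `(left endpoint, right endpoint)`. -/
abbrev Seg : Type := Plane × Plane

/-- Twice the signed area of the triangle `u v w`: positive if and only if `w` lies strictly to the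
left of the directed line from `u` to `v`. -/
def cross (u v w : Plane) : ℝ :=
  (v 0 - u 0) * (w 1 - u 1) - (v 1 - u 1) * (w 0 - u 0)

/-! ## Border regions and their triangulations -/

/-- The union `G'` of the reachable and the unreachable part of a planarized network: a finite
straight-line graph without crossings in the plane. Each edge joins two reachable vertices (a passable
edge) or two unreachable ones (an unreachable edge). The reachable part is connected. -/
structure Network where
  /-- all vertices -/
  V : Finset Plane
  /-- the reachable vertices -/
  reach : Finset Plane
  /-- the passable and the unreachable edges -/
  G : SimpleGraph Plane
  reach_subset : reach ⊆ V
  mem_of_adj : ∀ ⦃u v : Plane⦄, G.Adj u v → u ∈ V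
  reach_iff_of_adj : ∀ ⦃u v : Plane⦄, G.Adj u v → (u ∈ reach ↔ v ∈ reach)
  notMem_openSegment : ∀ ⦃u v x : Plane⦄, G.Adj u v → x ∈ V → x ∉ openSegment ℝ u v
  noncrossing : ∀ ⦃u v x y : Plane⦄, G.Adj u v → G.Adj x y → s(u, v) ≠ s(x, y) →
    Disjoint (openSegment ℝ u v) (openSegment ℝ x y)
  reach_connected : ∀ ⦃u v : Plane⦄, u ∈ reach → v ∈ reach → G.Reachable u v

/-- The point set covered by the vertices and the edges of the network. -/
def Network.drawing (N : Network) : Set Plane :=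
  {z | z ∈ N.V ∨ ∃ u v : Plane, N.G.Adj u v ∧ z ∈ segment ℝ u v}

/-- A border region: a bounded face of the network that is incident to reachable and to unreachable
vertices. Any number of unreachable components may be incident to it. -/
def Network.IsBorderRegion (N : Network) (B : Set Plane) : Prop :=
  (∃ x, x ∉ N.drawing ∧ B = connectedComponentIn N.drawingᶜ x) ∧
  Bornology.IsBounded B ∧
  (∃ u ∈ N.reach, u ∈ frontier B) ∧
  (∃ u ∈ N.V, u ∉ N.reach ∧ u ∈ frontier B)

open scoped Classical in
/-- `T` is a triangulation of the face `B`: a simplicial complex that covers the closure of `B`, whose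
vertices are the network vertices incident to `B`, and which contains the network edges incident
to `B`. -/
structure IsTriangulation (N : Network) (B : Set Plane) (T : Geometry.SimplicialComplex ℝ Plane) :
    Prop where
  space_eq : T.space = closure B
  vertex_iff : ∀ v : Plane, {v} ∈ T.faces ↔ v ∈ N.V ∧ v ∈ closure B
  edge_mem : ∀ u v : Plane, N.G.Adj u v → segment ℝ u v ⊆ closure B → {u, v} ∈ T.faces

/-- The (closed) triangles of `T`. -/
def triangles (T : Geometry.SimplicialComplex ℝ Plane) : Set (Set Plane) :=
  {K | ∃ f ∈ T.faces, f.card = 3 ∧ K = convexHull ℝ (f : Set Plane)}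

/-! ## Important triangles

A curve that runs through the triangulation is described by the list of triangulation edges that it
crosses; each of them is recorded as a pair (left endpoint, right endpoint), as seen by the curve. -/

open scoped Classical in
/-- One step of the traversal of the reachable boundary, always keeping the boundary to the left. The
current position is the edge `d`, `w` is the apex of the triangle ahead of `d`, and `d'` is the first
edge met that is not part of the network, turning about the current boundary vertex and following the
network edges. -/
def TraversalStep (N : Network) (T : Geometry.SimplicialComplex ℝ Plane) (d d' : Seg) : Prop :=
  ∃ w : Plane, {d.1, d.2, w} ∈ T.faces ∧ 0 < cross d.1 d.2 w ∧
    ((¬ N.G.Adj d.1 w ∧ d' = (d.1, w)) ∨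
     (N.G.Adj d.1 w ∧ ¬ N.G.Adj w d.2 ∧ d' = (w, d.2)) ∨
     (N.G.Adj d.1 w ∧ N.G.Adj w d.2 ∧ d' = (d.2, d.1)))

/-- Cancelling a detour: an edge that is crossed and at once crossed back is removed. -/
inductive Cancel : List Seg → List Seg → Prop
  | mk (A C : List Seg) (d : Seg) : Cancel (A ++ d :: d.swap :: C) (A ++ C)

open scoped Classical in
/-- `b 0, b 1, …, b n` are the edges crossed by the sequence `t 1, …, t n` of important triangles:
`b 0 = b n` is an edge joining a reachable vertex (on the left) to an unreachable one (on the right),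
and the sequence is the shortest one in the dual graph that runs once around the reachable boundary
and passes all edges between reachable and unreachable vertices in the order in which they are met
there. It arises from the traversal of the reachable boundary by cancelling all detours. The triangle
`t i` lies between `b (i-1)` and `b i`. -/
structure IsImportantSequence (N : Network) (T : Geometry.SimplicialComplex ℝ Plane)
    (b : ℕ → Seg) (n : ℕ) : Prop where
  left_reach : (b 0).1 ∈ N.reach
  right_mem : (b 0).2 ∈ N.V
  right_unreach : (b 0).2 ∉ N.reach
  edge_mem : {(b 0).1, (b 0).2} ∈ T.faces
  reduces : ∃ (d : ℕ → Seg) (M : ℕ), 1 ≤ M ∧ d 0 = b 0 ∧ d M = b 0 ∧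
    (∀ k, 0 < k → k < M → d k ≠ b 0) ∧
    (∀ k, k < M → TraversalStep N T (d k) (d (k + 1))) ∧
    Relation.ReflTransGen Cancel ((List.range (M + 1)).map d) ((List.range (n + 1)).map b)
  reduced : ∀ k, k < n → b (k + 1) ≠ (b k).swap

/-- The important triangle between two consecutive crossed edges. -/
def tri (d d' : Seg) : Set Plane := convexHull ℝ {d.1, d.2, d'.1, d'.2}

/-- The important triangles `t (j+1), …, t m`. -/
def trianglesBetween (b : ℕ → Seg) (j m : ℕ) : List (Set Plane) :=
  (List.range' j (m - j)).map fun k => tri (b k) (b (k + 1))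

/-! ## Shortest paths and visibility in a chain of convex pieces

A (possibly self-overlapping) polygon is given by the list `K` of its convex pieces, each glued to the
next one along their intersection. -/

/-- The polygonal path `y 0, …, y m` leads from `p` to `q` through the `m` pieces in order. -/
def IsPathThrough (K : List (Set Plane)) (p q : Plane) (y : ℕ → Plane) : Prop :=
  y 0 = p ∧ y K.length = q ∧ ∀ (j : ℕ) (hj : j < K.length), y j ∈ K[j] ∧ y (j + 1) ∈ K[j]

/-- The Euclidean length of the polygonal path `y 0, …, y m`. -/
noncomputable def pathLength (m : ℕ) (y : ℕ → Plane) : ℝ :=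
  ∑ j ∈ Finset.range m, dist (y j) (y (j + 1))

/-- `y` is a shortest path from `p` to `q` in the polygon with pieces `K`. -/
def IsShortestPath (K : List (Set Plane)) (p q : Plane) (y : ℕ → Plane) : Prop :=
  IsPathThrough K p q y ∧
    ∀ y' : ℕ → Plane, IsPathThrough K p q y' → pathLength K.length y ≤ pathLength K.length y'

/-- The union of the segments of the polygonal path `y 0, …, y m`. -/
def trace (m : ℕ) (y : ℕ → Plane) : Set Plane :=
  {z | ∃ j, j < m ∧ z ∈ segment ℝ (y j) (y (j + 1))}

/-- The straight segment from `p` to `q` runs in the interior of the polygon with pieces `K`, passing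
the pieces in order; only `p` and `q` may lie on the boundary. -/
def SeesThrough (K : List (Set Plane)) (p q : Plane) : Prop :=
  ∃ θ : ℕ → ℝ, Monotone θ ∧ θ 0 = 0 ∧ θ K.length = 1 ∧
    (∀ (j : ℕ) (hj : j < K.length),
      openSegment ℝ (AffineMap.lineMap p q (θ j)) (AffineMap.lineMap p q (θ (j + 1))) ⊆
        interior K[j]) ∧
    (∀ (j : ℕ) (hj : j + 1 < K.length),
      AffineMap.lineMap p q (θ (j + 1)) ∈ interior (K[j] ∪ K[j + 1]))

/-! ## Windows -/

/-- The data from which a window is computed: a segment `seg` (the first edge or a window), the index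
`idx` of its initial edge, and the convex pieces of the initial part of the polygon, which lies between
`seg` and the initial edge: `right` lists the pieces met from the right endpoint of `seg` up to the
piece at the initial edge, `left` those met from the left endpoint. -/
structure Stage where
  seg : Seg
  idx : ℕ
  right : List (Set Plane)
  left : List (Set Plane)

/-- The chains of pieces along which a segment can lead from `seg` to the initial edge. (The initial
part is empty for the first edge, which is its own initial edge.) -/
def Stage.exits (σ : Stage) : Set (List (Set Plane)) :=
  {K | (K <:+ σ.right ∨ K <:+ σ.left) ∧ (K = [] → σ.right = [] ∧ σ.left = [])}

/-- The point `z` of the important triangle `t m` is visible from the segment of the stage. -/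
def Visible (b : ℕ → Seg) (σ : Stage) (m : ℕ) (z : Plane) : Prop :=
  σ.idx < m ∧ ∃ p ∈ segment ℝ σ.seg.1 σ.seg.2, ∃ K ∈ σ.exits,
    SeesThrough (K ++ trianglesBetween b σ.idx m) p z

/-- `w` is the window of the stage `σ`, and `t h` is the important triangle with the highest index that
is visible. The window is the edge of the visibility polygon that separates, inside `t h`, the visible
part from the edge `b h`. As such it extends in both directions until it meets the boundary of `B`, and
it consists, inside `t h`, of limits of visible points. The edge `b h` lies to the left of the line
directed from the left to the right endpoint of `w`. -/
structure IsWindow (B : Set Plane) (b : ℕ → Seg) (n : ℕ) (σ : Stage) (w : Seg) (h : ℕ) : Prop where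
  le_length : h ≤ n
  visible : ∃ z, Visible b σ h z
  highest : ∀ m, h < m → m ≤ n → ∀ z, ¬ Visible b σ m z
  open_subset : openSegment ℝ w.1 w.2 ⊆ B
  left_mem : w.1 ∈ frontier B
  right_mem : w.2 ∈ frontier B
  meets : (openSegment ℝ w.1 w.2 ∩ interior (tri (b (h - 1)) (b h))).Nonempty
  edge_left : 0 ≤ cross w.1 w.2 (b h).1
  edge_right : 0 ≤ cross w.1 w.2 (b h).2
  visible_side : ∀ z, Visible b σ h z → cross w.1 w.2 z ≤ 0
  limit : segment ℝ w.1 w.2 ∩ tri (b (h - 1)) (b h) ⊆ closure {z | Visible b σ h z}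

/-- `L` lists the triangles of `T` whose interior is met by the segment `w`, in the order in which they
are met from the right to the left endpoint. -/
def ListsCrossed (T : Geometry.SimplicialComplex ℝ Plane) (w : Seg) (L : List (Set Plane)) : Prop :=
  (∀ K, K ∈ L ↔ K ∈ triangles T ∧ (openSegment ℝ w.1 w.2 ∩ interior K).Nonempty) ∧
  L.Pairwise fun K K' =>
    ∀ x ∈ openSegment ℝ w.1 w.2 ∩ interior K, ∀ y ∈ openSegment ℝ w.1 w.2 ∩ interior K',
      dist w.2 x < dist w.2 y

/-- The part of `K` on the side of the window `w` on which the initial edge lies. -/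
def clip (w : Seg) (K : Set Plane) : Set Plane := K ∩ {z | 0 ≤ cross w.1 w.2 z}

/-- `σ'` is the stage that follows `σ`: its segment is the window of `σ`, its initial edge is the edge
`b h` behind the last visible triangle `t h`, and its initial part consists of the triangles met by the
window, cut off at the window. -/
def NextStage (B : Set Plane) (T : Geometry.SimplicialComplex ℝ Plane) (b : ℕ → Seg) (n : ℕ)
    (σ σ' : Stage) : Prop :=
  IsWindow B b n σ σ'.seg σ'.idx ∧
  ∃ UR UL : List (Set Plane),
    ListsCrossed T σ'.seg (UR ++ tri (b (σ'.idx - 1)) (b σ'.idx) :: UL) ∧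
    σ'.right = (UR ++ [tri (b (σ'.idx - 1)) (b σ'.idx)]).map (clip σ'.seg) ∧
    σ'.left = (UL.reverse ++ [tri (b (σ'.idx - 1)) (b σ'.idx)]).map (clip σ'.seg)

/-- The stages of the computation of a minimum-link path: the first one starts at the edge `b 0`, each
further one at the window of the previous stage. -/
inductive IsStage (B : Set Plane) (T : Geometry.SimplicialComplex ℝ Plane) (b : ℕ → Seg) (n : ℕ) :
    Stage → Prop
  | first : IsStage B T b n ⟨b 0, 0, [], []⟩
  | next {σ σ' : Stage} : IsStage B T b n σ → NextStage B T b n σ σ' → IsStage B T b n σ'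

/-- `y` is the right shortest path of the stage up to the edge `b m`. -/
def IsRightPath (b : ℕ → Seg) (σ : Stage) (m : ℕ) (y : ℕ → Plane) : Prop :=
  IsShortestPath (σ.right ++ trianglesBetween b σ.idx m) σ.seg.2 (b m).2 y

/-- `y` is the left shortest path of the stage up to the edge `b m`. -/
def IsLeftPath (b : ℕ → Seg) (σ : Stage) (m : ℕ) (y : ℕ → Plane) : Prop :=
  IsShortestPath (σ.left ++ trianglesBetween b σ.idx m) σ.seg.1 (b m).1 y

/-- The point set of the right shortest path `y` up to `b m`. -/
def rightTrace (b : ℕ → Seg) (σ : Stage) (m : ℕ) (y : ℕ → Plane) : Set Plane :=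
  trace (σ.right ++ trianglesBetween b σ.idx m).length y

/-- The point set of the left shortest path `y` up to `b m`. -/
def leftTrace (b : ℕ → Seg) (σ : Stage) (m : ℕ) (y : ℕ → Plane) : Set Plane :=
  trace (σ.left ++ trianglesBetween b σ.idx m).length y

/-! ## The hourglass -/

/-- The points enclosed by a bounded closed curve: the bounded components of its complement. -/
def enclosed (C : Set Plane) : Set Plane :=
  {z | z ∉ C ∧ Bornology.IsBounded (connectedComponentIn Cᶜ z)}

/-- The interior of the hourglass that is bounded by the segment of the stage, its initial edge, the
initial right shortest path `yr` and the initial left shortest path `yl`. -/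
def hourglassInterior (b : ℕ → Seg) (σ : Stage) (yr yl : ℕ → Plane) : Set Plane :=
  enclosed (segment ℝ σ.seg.1 σ.seg.2 ∪ segment ℝ (b σ.idx).1 (b σ.idx).2 ∪
    rightTrace b σ σ.idx yr ∪ leftTrace b σ σ.idx yl)

end BorderRegion

open BorderRegion

/-! The hourglass is bounded by a closed curve: the window (the base), the two initial shortest
paths and the initial edge. The segment `s` is an edge of `T`, and the argument shows for every such
edge that it meets the region enclosed by the curve if and only if it crosses the open base.
Enclosure is tested by logarithms instead of the Jordan curve theorem: a point q off a compact set C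
lies in an unbounded component of the complement exactly if z - q has a continuous logarithm on C
(`HasLog.of_not_isBounded`, `HasLog.not_isBounded`).

Let q be a point of an edge that avoids the open base, q not on the curve. The triangles crossed by
the base form a chain. Each of them is convex and q is not in its interior, so it carries a
logarithm away from q. The part of a shared edge above the base stays connected when q is removed,
as q can only be its upper end. Hence the logarithms can be glued along the chain
(`HasLog.iUnion_chain`), provided that a point of the curve met in two triangles belongs to all
triangles between them (`TautPair.mem_between`). Here the shortest paths matter: their height above
the base never decreases (`TautPath.H_step`), and planarity restricts the vertices that distant
triangles can share (`IsSpoke.lt_of_between`). So q is not enclosed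
(`TautPair.not_disjoint_of_mem_enclosed`).

Conversely, let an edge cross the base at q. It has an end above the base, and the rest of the curve
avoids q. The winding number of the curve jumps across the base (`not_hasLog_of_crossing`) and is
zero below it, because the whole curve lies on one side. So the points of the edge just above q are
enclosed (`TautPair.exists_mem_enclosed`). -/

open BorderRegion

/-! ### Continuous logarithms and bounded components of a complement. -/

namespace BorderRegion

/-- The isometric identification of the plane with the complex numbers. -/
noncomputable def toC : Plane ≃ₗᵢ[ℝ] ℂ := Complex.orthonormalBasisOneI.repr.symm

/-- On `A` there is a continuous branch of the logarithm of `z - q`. -/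
def HasLog (q : Plane) (A : Set Plane) : Prop :=
  ∃ f : Plane → ℂ, ContinuousOn f A ∧ ∀ z ∈ A, Complex.exp (f z) = toC (z - q)

theorem toC_sub_ne_zero {z q : Plane} (h : z ≠ q) : toC (z - q) ≠ 0 := by
  simpa [sub_eq_zero] using h

theorem mem_slitPlane_of_norm_sub_one_lt {z : ℂ} (h : ‖z - 1‖ < 1) : z ∈ Complex.slitPlane := by
  simpa using Complex.mem_slitPlane_of_norm_lt_one h

/-- The quotient differs from 1 by `(q - q') / (z - q)`, whose norm is less than 1. So its principal
logarithm is continuous in `z`. -/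
theorem toC_div_mem_slitPlane {z q q' : Plane} (h : dist q q' < dist z q) :
    toC (z - q') / toC (z - q) ∈ Complex.slitPlane := by
  have hne : z ≠ q := by
    rintro rfl
    exact absurd h (by simp [dist_nonneg])
  have h0 := toC_sub_ne_zero hne
  apply mem_slitPlane_of_norm_sub_one_lt
  have e : toC (z - q') / toC (z - q) - 1 = toC (q - q') / toC (z - q) := by
    field_simp
    rw [← map_sub]
    congr 1
    abel
  rw [e, norm_div, toC.norm_map, toC.norm_map, ← dist_eq_norm, ← dist_eq_norm]
  rw [div_lt_one (lt_of_le_of_lt dist_nonneg h)]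
  exact h

theorem continuous_toC_sub (q : Plane) : Continuous fun z : Plane => toC (z - q) :=
  toC.continuous.comp (continuous_id.sub continuous_const)

/-- The principal logarithm of `(z - q') / (z - q)` is added to the given branch. -/
theorem HasLog.move {q q' : Plane} {A : Set Plane} (hA : HasLog q A)
    (h : ∀ z ∈ A, dist q q' < dist z q) : HasLog q' A := by
  obtain ⟨f, hf, hexp⟩ := hA
  have hne : ∀ z ∈ A, toC (z - q) ≠ 0 := fun z hz => by
    rw [← hexp z hz]; exact Complex.exp_ne_zero _
  have hs : ∀ z ∈ A, toC (z - q') / toC (z - q) ∈ Complex.slitPlane := fun z hz =>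
    toC_div_mem_slitPlane (h z hz)
  refine ⟨fun z => f z + Complex.log (toC (z - q') / toC (z - q)), ?_, fun z hz => ?_⟩
  · refine hf.add (ContinuousOn.clog ?_ hs)
    exact (continuous_toC_sub q').continuousOn.div (continuous_toC_sub q).continuousOn hne
  · rw [Complex.exp_add, hexp z hz, Complex.exp_log (Complex.slitPlane_ne_zero (hs z hz)),
      mul_div_cancel₀ _ (hne z hz)]

/-- Seen from a point farther from the origin than all of `A`, the quotient of `z - q` by `0 - q`
stays within distance 1 of 1. -/
theorem HasLog.of_norm_lt {q : Plane} {A : Set Plane} (h : ∀ z ∈ A, ‖z‖ < ‖q‖) :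
    HasLog q A := by
  rcases A.eq_empty_or_nonempty with rfl | ⟨a, ha⟩
  · exact ⟨fun _ => 0, continuousOn_empty _, fun z hz => hz.elim⟩
  have hq : toC (0 - q) ≠ 0 := by
    apply toC_sub_ne_zero
    rintro rfl
    have := h a ha
    simp at this
    exact absurd this (not_lt.2 (norm_nonneg a))
  have hs : ∀ z ∈ A, toC (z - q) / toC (0 - q) ∈ Complex.slitPlane := by
    intro z hz
    apply mem_slitPlane_of_norm_sub_one_lt
    have e : toC (z - q) / toC (0 - q) - 1 = toC z / toC (0 - q) := by
      field_simp
      rw [← map_sub]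
      congr 1
      abel
    rw [e, norm_div, toC.norm_map, toC.norm_map, zero_sub, norm_neg,
      div_lt_one (lt_of_le_of_lt (norm_nonneg z) (h z hz))]
    exact h z hz
  refine ⟨fun z => Complex.log (toC (0 - q)) + Complex.log (toC (z - q) / toC (0 - q)), ?_, ?_⟩
  · refine continuousOn_const.add (ContinuousOn.clog ?_ hs)
    exact (continuous_toC_sub q).continuousOn.div_const _
  · intro z hz
    rw [Complex.exp_add, Complex.exp_log hq, Complex.exp_log (Complex.slitPlane_ne_zero (hs z hz)),
      mul_div_cancel₀ _ hq]

/-- A point in an unbounded component of the complement of a compact set admits a branch of the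
logarithm. -/
theorem HasLog.of_not_isBounded {q : Plane} {C : Set Plane} (hC : IsCompact C) (hq : q ∉ C)
    (hb : ¬ Bornology.IsBounded (connectedComponentIn Cᶜ q)) : HasLog q C := by
  obtain ⟨R, hR⟩ := hC.isBounded.exists_norm_le
  set W := connectedComponentIn Cᶜ q with hW
  have hWsub : W ⊆ Cᶜ := connectedComponentIn_subset _ _
  have hqW : q ∈ W := mem_connectedComponentIn hq
  -- An unbounded component leaves the ball around `C`. A logarithm exists at `q₁` and is carried to
  -- `q` within the component.
  obtain ⟨q₁, hq₁, hR₁⟩ : ∃ q₁ ∈ W, R < ‖q₁‖ := by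
    by_contra! hcon
    exact hb (isBounded_iff_forall_norm_le.2 ⟨R, hcon⟩)
  have hpos : ∀ p ∈ W, ∃ δ > 0, ∀ z ∈ C, δ ≤ dist z p := by
    intro p hp
    have : Cᶜ ∈ nhds p := hC.isClosed.isOpen_compl.mem_nhds (hWsub hp)
    obtain ⟨δ, hδ, hball⟩ := Metric.mem_nhds_iff.1 this
    refine ⟨δ, hδ, fun z hz => ?_⟩
    by_contra! hlt
    exact hball (Metric.mem_ball.2 hlt) hz
  have hloc : ∀ p ∈ W, ∃ δ > 0, ∀ p', dist p p' < δ → (HasLog p' C ↔ HasLog p C) := by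
    intro p hp
    obtain ⟨δ, hδ, hd⟩ := hpos p hp
    -- Half the distance permits the move from `p` to `p'` and back, since `p'` is still more than
    -- `δ / 2` away from `C`.
    refine ⟨δ / 2, by positivity, fun p' hp' => ⟨fun h => h.move fun z hz => ?_,
      fun h => h.move fun z hz => ?_⟩⟩
    · have h1 := hd z hz
      have h2 := dist_triangle z p' p
      rw [dist_comm p' p] at *
      linarith
    · have h1 := hd z hz
      linarith
  have hpre : IsPreconnected W := isPreconnected_connectedComponentIn
  by_contra hnot
  -- Both sets are open by their form and cover `W` by `hloc`; a common point is absurd.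
  have := hpre {p | ∃ δ > 0, ∀ p', dist p p' < δ → HasLog p' C}
    {p | ∃ δ > 0, ∀ p', dist p p' < δ → ¬ HasLog p' C} ?_ ?_ ?_ ⟨q₁, hq₁, ?_⟩ ⟨q, hqW, ?_⟩
  · obtain ⟨p, -, ⟨δ, hδ, h1⟩, ⟨δ', hδ', h2⟩⟩ := this
    exact h2 p (by simpa using hδ') (h1 p (by simpa using hδ))
  · rw [Metric.isOpen_iff]
    rintro p ⟨δ, hδ, hp⟩
    refine ⟨δ / 2, by positivity, fun p' hp' => ⟨δ / 2, by positivity, fun p'' hp'' => hp _ ?_⟩⟩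
    have := dist_triangle p p' p''
    rw [Metric.mem_ball, dist_comm] at hp'
    linarith
  · rw [Metric.isOpen_iff]
    rintro p ⟨δ, hδ, hp⟩
    refine ⟨δ / 2, by positivity, fun p' hp' => ⟨δ / 2, by positivity, fun p'' hp'' => hp _ ?_⟩⟩
    have := dist_triangle p p' p''
    rw [Metric.mem_ball, dist_comm] at hp'
    linarith
  · intro p hp
    obtain ⟨δ, hδ, h⟩ := hloc p hp
    by_cases hh : HasLog p C
    · exact Or.inl ⟨δ, hδ, fun p' hp' => (h p' hp').2 hh⟩
    · exact Or.inr ⟨δ, hδ, fun p' hp' => fun h' => hh ((h p' hp').1 h')⟩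
  · obtain ⟨δ, hδ, h⟩ := hloc q₁ hq₁
    exact ⟨δ, hδ, fun p' hp' => (h p' hp').2
      (HasLog.of_norm_lt fun z hz => (hR z hz).trans_lt hR₁)⟩
  · obtain ⟨δ, hδ, h⟩ := hloc q hqW
    exact ⟨δ, hδ, fun p' hp' => fun h' => hnot ((h p' hp').1 h')⟩

/-- A continuous nowhere vanishing function on the plane has a continuous logarithm. -/
theorem exists_continuous_exp_eq {G : Plane → ℂ} (hG : Continuous G) (h0 : ∀ z, G z ≠ 0) :
    ∃ g : Plane → ℂ, Continuous g ∧ ∀ z, Complex.exp (g z) = G z := by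
  have hU : IsSimplyConnected (Set.univ : Set Plane) := by
    have : ContractibleSpace (Set.univ : Set Plane) :=
      (convex_univ (𝕜 := ℝ)).contractibleSpace Set.univ_nonempty
    exact SimplyConnectedSpace.ofContractible _
  obtain ⟨f, hf, he⟩ := Complex.exists_continuousOn_eqOn_exp_comp hU isOpen_univ
    hG.continuousOn (by rintro ⟨z, -, hz⟩; exact h0 z hz)
  exact ⟨f, continuousOn_univ.1 hf, fun z => he (Set.mem_univ z)⟩

/-- There is no continuous logarithm of `z - q` on a circle about `q`. -/
theorem not_hasLog_circle {q : Plane} {R : ℝ} (hR : 0 < R) {g : Plane → ℂ} (hg : Continuous g) :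
    ¬ ∀ z, dist z q = R → Complex.exp (g z) = toC (z - q) := by
  intro h
  set c : ℝ → Plane := fun θ => q + toC.symm (R * Complex.exp (θ * Complex.I)) with hc
  have hcc : Continuous c := by
    refine continuous_const.add (toC.symm.continuous.comp ?_)
    fun_prop
  have hcd : ∀ θ, dist (c θ) q = R := by
    intro θ
    simp [hc, Complex.norm_exp_ofReal_mul_I, abs_of_pos hR]
  -- Along the circle `g - iθ` is a continuous logarithm of the constant `R`, hence constant,
  -- although `θ` grows by 2π on the way back to the starting point.
  have key : ∀ θ, Complex.exp (g (c θ) - θ * Complex.I) = R := by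
    intro θ
    rw [Complex.exp_sub, h _ (hcd θ)]
    simp only [hc, add_sub_cancel_left, LinearIsometryEquiv.apply_symm_apply]
    rw [mul_div_cancel_right₀ _ (Complex.exp_ne_zero _)]
  have hconst : ∃ k : ℝ → ℤ, ∀ θ, g (c θ) - θ * Complex.I =
      g (c 0) + k θ * (2 * Real.pi * Complex.I) := by
    have : ∀ θ, ∃ k : ℤ, g (c θ) - θ * Complex.I = g (c 0) + k * (2 * Real.pi * Complex.I) := by
      intro θ
      apply Complex.exp_eq_exp_iff_exists_int.1
      rw [key θ, ← key 0]
      simp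
    choose k hk using this
    exact ⟨k, hk⟩
  obtain ⟨k, hk⟩ := hconst
  have hpi : (2 * Real.pi * Complex.I : ℂ) ≠ 0 := Complex.two_pi_I_ne_zero
  have hkc : Continuous fun θ => (k θ : ℝ) := by
    have e : ∀ θ, (k θ : ℝ) = ((g (c θ) - θ * Complex.I - g (c 0)) / (2 * Real.pi * Complex.I)).re := by
      intro θ
      rw [hk θ, add_sub_cancel_left, mul_div_cancel_right₀ _ hpi]
      simp
    simp_rw [e]
    refine Complex.continuous_re.comp (Continuous.div_const ?_ _)
    have := hg.comp hcc
    fun_prop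
  have hkc' : Continuous k := Int.isClosedEmbedding_coe_real.isEmbedding.continuous_iff.2 hkc
  have hk0 : k (2 * Real.pi) = k 0 := PreconnectedSpace.constant inferInstance hkc'
  have h1 := hk (2 * Real.pi)
  have h2 := hk 0
  have hcp : c (2 * Real.pi) = c 0 := by
    simp [hc, Complex.exp_two_pi_mul_I]
  rw [hcp, hk0] at h1
  rw [← h2] at h1
  simp at h1

/-- A point in a bounded component of the complement of a compact set admits no branch of the
logarithm. -/
theorem HasLog.not_isBounded {q : Plane} {C : Set Plane} (hC : IsCompact C) (hq : q ∉ C)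
    (hlog : HasLog q C) : ¬ Bornology.IsBounded (connectedComponentIn Cᶜ q) := by
  intro hb
  obtain ⟨f, hf, hexp⟩ := hlog
  set W := connectedComponentIn Cᶜ q with hW
  have hWsub : W ⊆ Cᶜ := connectedComponentIn_subset _ _
  have hqW : q ∈ W := mem_connectedComponentIn hq
  have hWo : IsOpen W := hC.isClosed.isOpen_compl.connectedComponentIn
  -- The component of a frontier point off `C` would be open, meet `W` and hence equal it.
  have hfr : frontier W ⊆ C := by
    intro z hz
    by_contra hzC
    have hzW : z ∉ W := fun h => by
      rw [frontier, hWo.interior_eq] at hz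
      exact hz.2 h
    have hzcl : z ∈ closure W := hz.1
    have hzo : IsOpen (connectedComponentIn Cᶜ z) := hC.isClosed.isOpen_compl.connectedComponentIn
    obtain ⟨p, hp1, hp2⟩ := mem_closure_iff.1 hzcl _ hzo (mem_connectedComponentIn hzC)
    have e1 := connectedComponentIn_eq hp1
    have e2 := connectedComponentIn_eq hp2
    apply hzW
    rw [hW, e2, ← e1]
    exact mem_connectedComponentIn hzC
  -- Tietze extension of the logarithm to the plane. Replacing `z - q` by `exp F` inside `W` removes
  -- its only zero, and the two formulas agree on the frontier.
  obtain ⟨F, hF⟩ := ContinuousMap.exists_restrict_eq hC.isClosed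
    (⟨C.domRestrict f, continuousOn_iff_continuous_domRestrict.1 hf⟩ : C(C, ℂ))
  have hFC : ∀ z ∈ C, F z = f z := fun z hz => by
    have := congrArg (fun g => g ⟨z, hz⟩) hF
    exact this
  classical
  set G : Plane → ℂ := fun z => if z ∈ W then Complex.exp (F z) else toC (z - q) with hG
  have hGc : Continuous G := by
    refine continuous_if ?_ ?_ ?_
    · intro z hz
      rw [hFC z (hfr hz), hexp z (hfr hz)]
    · exact (Complex.continuous_exp.comp F.continuous).continuousOn
    · exact (continuous_toC_sub q).continuousOn
  have hG0 : ∀ z, G z ≠ 0 := by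
    intro z
    by_cases hz : z ∈ W
    · simp only [hG, hz, if_true]; exact Complex.exp_ne_zero _
    · simp only [hG, hz, if_false]
      apply toC_sub_ne_zero
      rintro rfl
      exact hz hqW
  obtain ⟨g, hg, hge⟩ := exists_continuous_exp_eq hGc hG0
  -- On a circle around the bounded set `W`, the logarithm of `G` is one of `z - q`.
  obtain ⟨R, hR0, hR⟩ := hb.subset_ball_lt 0 q
  refine not_hasLog_circle (q := q) hR0 hg fun z hz => ?_
  rw [hge z]
  have : z ∉ W := fun h => by
    have := hR h
    rw [Metric.mem_ball, hz] at this
    exact lt_irrefl _ this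
  simp only [hG, this, if_false]

end BorderRegion

/-! ### Comparing and gluing logarithms. -/

namespace BorderRegion

/-- Two continuous logarithms of the same function on a preconnected set differ by a constant. -/
theorem sub_eq_sub_of_exp_eq {S : Set Plane} (hS : IsPreconnected S) {f g : Plane → ℂ}
    (hf : ContinuousOn f S) (hg : ContinuousOn g S)
    (h : ∀ z ∈ S, Complex.exp (f z) = Complex.exp (g z)) {a b : Plane} (ha : a ∈ S) (hb : b ∈ S) :
    f a - g a = f b - g b := by
  have : ∀ z : S, ∃ k : ℤ, f z = g z + k * (2 * Real.pi * Complex.I) := fun z =>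
    Complex.exp_eq_exp_iff_exists_int.1 (h z z.2)
  choose k hk using this
  have hpi : (2 * Real.pi * Complex.I : ℂ) ≠ 0 := Complex.two_pi_I_ne_zero
  have hkc : Continuous fun z : S => (k z : ℝ) := by
    have e : ∀ z : S, (k z : ℝ) = ((f z - g z) / (2 * Real.pi * Complex.I)).re := by
      intro z
      rw [hk z, add_sub_cancel_left, mul_div_cancel_right₀ _ hpi]
      simp
    simp_rw [e]
    refine Complex.continuous_re.comp (Continuous.div_const ?_ _)
    exact (continuousOn_iff_continuous_domRestrict.1 hf).sub
      (continuousOn_iff_continuous_domRestrict.1 hg)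
  have hkc' : Continuous k := Int.isClosedEmbedding_coe_real.isEmbedding.continuous_iff.2 hkc
  have : PreconnectedSpace S := Subtype.preconnectedSpace hS
  have hk0 : k ⟨a, ha⟩ = k ⟨b, hb⟩ := PreconnectedSpace.constant inferInstance hkc'
  have h1 := hk ⟨a, ha⟩
  have h2 := hk ⟨b, hb⟩
  simp only at h1 h2
  rw [h1, h2, hk0]
  ring

/-- The two logarithms `log (s - ζ) - log (s - ζ')` and `log ((s - ζ) / (s - ζ'))` at a real point `s`,
where `ζ` lies above and `ζ'` below the real axis, agree to the right of `ζ` and `ζ'`. -/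
theorem log_sub_log_eq_of_re_pos {a b : ℂ} (ha : a.im < 0) (hb : 0 < b.im) (ha' : 0 < a.re)
    (hb' : 0 < b.re) : Complex.log a - Complex.log b = Complex.log (a / b) := by
  have ha0 : a ≠ 0 := by rintro rfl; simp at ha
  have hb0 : b ≠ 0 := by rintro rfl; simp at hb
  have h1 := Complex.abs_arg_lt_pi_div_two_iff.2 (Or.inl ha')
  have h2 := Complex.abs_arg_lt_pi_div_two_iff.2 (Or.inl hb')
  rw [abs_lt] at h1 h2
  have h3 := Complex.arg_neg_iff.2 ha
  have h4 : 0 ≤ b.arg := Complex.arg_nonneg_iff.2 hb.le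
  have e : Complex.exp (Complex.log a - Complex.log b) = a / b := by
    rw [Complex.exp_sub, Complex.exp_log ha0, Complex.exp_log hb0]
  rw [← e, Complex.log_exp]
  · simp only [Complex.sub_im, Complex.log_im]; linarith [h1.1, h2.2]
  · simp only [Complex.sub_im, Complex.log_im]; linarith [h1.1, h2.2, Real.pi_pos]

/-- To the left of both points the two logarithms differ by a full turn. -/
theorem log_sub_log_eq_of_re_neg {a b : ℂ} (ha : a.im < 0) (hb : 0 < b.im) (ha' : a.re < 0)
    (hb' : b.re < 0) :
    Complex.log a - Complex.log b = Complex.log (a / b) - 2 * Real.pi * Complex.I := by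
  -- Negation moves both numbers to the right half-plane and exchanges their sides of the real axis,
  -- so `a` and `b` change places.
  have key := log_sub_log_eq_of_re_pos (a := -b) (b := -a) (by simpa using hb) (by simpa using ha)
    (by simpa using hb') (by simpa using ha')
  have ha0 : a ≠ 0 := by rintro rfl; simp at ha
  have hb0 : b ≠ 0 := by rintro rfl; simp at hb
  have e1 : Complex.log (-a) = Complex.log a + Real.pi * Complex.I := by
    rw [Complex.log, Complex.log, Complex.arg_neg_eq_arg_add_pi_of_im_neg ha]
    simp; ring
  have e2 : Complex.log (-b) = Complex.log b - Real.pi * Complex.I := by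
    rw [Complex.log, Complex.log, Complex.arg_neg_eq_arg_sub_pi_of_im_pos hb]
    simp; ring
  have e3 : Complex.log (a / b) = Complex.log (-a) - Complex.log (-b) + 0 := by
    have : a / b = (-b / -a)⁻¹ := by rw [neg_div_neg_eq, inv_div]
    rw [this, Complex.log_inv, ← key]
    · ring
    -- The inversion formula excludes the argument π; here the argument is a difference of two
    -- angles strictly between -π/2 and π/2.
    · intro h
      have hn := congrArg Complex.im key
      rw [Complex.log_im (-b / -a), h] at hn
      simp only [Complex.sub_im, Complex.log_im] at hn
      have h1 := Complex.abs_arg_lt_pi_div_two_iff.2 (Or.inl (by simpa using ha' : 0 < (-a).re))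
      have h2 := Complex.abs_arg_lt_pi_div_two_iff.2 (Or.inl (by simpa using hb' : 0 < (-b).re))
      rw [abs_lt] at h1 h2
      linarith [h1.1, h1.2, h2.1, h2.2]
  rw [e3, e1, e2]
  ring

/-- A closed curve that consists of a piece `W` of the real axis, between the points `z` above and
`z'` below, and of a rest `U` far from `z` and `z'`, winds differently around the two points. -/
theorem not_hasLog_of_crossing {ζ : Plane → ℂ} {κ : ℂ} (hκ : κ ≠ 0)
    (hζ : ∀ z z', ζ z - ζ z' = κ * toC (z - z')) {W U : Set Plane} (hW : IsPreconnected W)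
    (hU : IsPreconnected U) {a b z z' : Plane} (haW : a ∈ W) (haU : a ∈ U) (hbW : b ∈ W)
    (hbU : b ∈ U) (him : ∀ c ∈ W, (ζ c).im = 0) (hz : 0 < (ζ z).im) (hz' : (ζ z').im < 0)
    (haz : (ζ a).re < (ζ z).re) (haz' : (ζ a).re < (ζ z').re) (hbz : (ζ z).re < (ζ b).re)
    (hbz' : (ζ z').re < (ζ b).re) (hfar : ∀ c ∈ U, dist z' z < dist c z')
    (h1 : HasLog z (W ∪ U)) (h2 : HasLog z' (W ∪ U)) : False := by
  obtain ⟨f, hf, hfe⟩ := h1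
  obtain ⟨f', hf', hfe'⟩ := h2
  have hζc : Continuous ζ := by
    have : ζ = fun c => κ * toC (c - z) + ζ z := by
      funext c; rw [← hζ]; ring
    rw [this]
    exact (continuous_const.mul (continuous_toC_sub z)).add continuous_const
  have hratio : ∀ c, toC (c - z) / toC (c - z') = (ζ c - ζ z) / (ζ c - ζ z') := by
    intro c
    rw [hζ, hζ, mul_div_mul_left _ _ hκ]
  have hD : ContinuousOn (fun c => f c - f' c) (W ∪ U) := hf.sub hf'
  have hDe : ∀ c ∈ W ∪ U, Complex.exp (f c - f' c) = (ζ c - ζ z) / (ζ c - ζ z') := by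
    intro c hc
    rw [Complex.exp_sub, hfe c hc, hfe' c hc, hratio]
  have him1 : ∀ c ∈ W, (ζ c - ζ z).im < 0 := fun c hc => by
    rw [Complex.sub_im, him c hc]; linarith
  have him2 : ∀ c ∈ W, 0 < (ζ c - ζ z').im := fun c hc => by
    rw [Complex.sub_im, him c hc]; linarith
  have hs1 : ∀ c ∈ W, ζ c - ζ z ∈ Complex.slitPlane := fun c hc => Or.inr (him1 c hc).ne
  have hs2 : ∀ c ∈ W, ζ c - ζ z' ∈ Complex.slitPlane := fun c hc => Or.inr (him2 c hc).ne'
  -- On `W`, which stays on one side of each point, `f - f'` agrees up to a constant with this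
  -- difference of principal logarithms.
  have hFc : ContinuousOn (fun c => Complex.log (ζ c - ζ z) - Complex.log (ζ c - ζ z')) W :=
    (ContinuousOn.clog (hζc.sub continuous_const).continuousOn hs1).sub
      (ContinuousOn.clog (hζc.sub continuous_const).continuousOn hs2)
  have hFe : ∀ c ∈ W, Complex.exp (Complex.log (ζ c - ζ z) - Complex.log (ζ c - ζ z')) =
      (ζ c - ζ z) / (ζ c - ζ z') := by
    intro c hc
    rw [Complex.exp_sub, Complex.exp_log (Complex.slitPlane_ne_zero (hs1 c hc)),
      Complex.exp_log (Complex.slitPlane_ne_zero (hs2 c hc))]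
  -- On `U`, which is far from both points, `f - f'` agrees up to a constant with the principal
  -- logarithm of the quotient.
  have hs3 : ∀ c ∈ U, (ζ c - ζ z) / (ζ c - ζ z') ∈ Complex.slitPlane := by
    intro c hc
    rw [← hratio]
    exact toC_div_mem_slitPlane (hfar c hc)
  have hne : ∀ c ∈ U, ζ c - ζ z' ≠ 0 := by
    intro c hc h0
    have := hs3 c hc
    rw [h0, div_zero] at this
    exact Complex.zero_notMem_slitPlane this
  have hGc : ContinuousOn (fun c => Complex.log ((ζ c - ζ z) / (ζ c - ζ z'))) U :=
    ContinuousOn.clog ((hζc.sub continuous_const).continuousOn.div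
      (hζc.sub continuous_const).continuousOn hne) hs3
  have e1 := sub_eq_sub_of_exp_eq hW (hD.mono Set.subset_union_left) hFc
    (fun c hc => by rw [hDe c (Or.inl hc), hFe c hc]) haW hbW
  have e2 := sub_eq_sub_of_exp_eq hU (hD.mono Set.subset_union_right) hGc
    (fun c hc => by
      rw [hDe c (Or.inr hc), Complex.exp_log (Complex.slitPlane_ne_zero (hs3 c hc))]) haU hbU
  -- The two comparison functions coincide at `b` but differ by a full turn at `a`.
  rw [log_sub_log_eq_of_re_neg (him1 a haW) (him2 a haW) (by simpa using haz) (by simpa using haz'),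
    log_sub_log_eq_of_re_pos (him1 b hbW) (him2 b hbW) (by simpa using hbz) (by simpa using hbz'),
    ← e2] at e1
  apply Complex.two_pi_I_ne_zero
  linear_combination e1

/-- A convex set with interior points carries a branch of the logarithm of `z - q` if `q` is not in
its interior. -/
theorem hasLog_of_notMem_interior {K : Set Plane} (hK : Convex ℝ K) (hne : (interior K).Nonempty)
    {q : Plane} (hq : q ∉ interior K) : HasLog q (K \ {q}) := by
  -- A line through `q` keeps `K` in a closed half-plane. Multiplication by `-ν` turns this into the
  -- right half-plane, which without the origin lies in the slit plane.
  obtain ⟨φ, hφ⟩ := geometric_hahn_banach_open_point hK.interior isOpen_interior hq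
  have hle : ∀ z ∈ K, φ z ≤ φ q := by
    have hcl : closure (interior K) ⊆ {z | φ z ≤ φ q} :=
      closure_minimal (fun z hz => (hφ z hz).le) (isClosed_le φ.continuous continuous_const)
    rw [hK.closure_interior_eq_closure_of_nonempty_interior hne] at hcl
    exact fun z hz => hcl (subset_closure hz)
  set ν : ℂ := ⟨φ (toC.symm 1), -φ (toC.symm Complex.I)⟩ with hν
  have hre : ∀ z, φ z = (ν * toC z).re := by
    intro z
    have e : z = (toC z).re • toC.symm 1 + (toC z).im • toC.symm Complex.I := by
      apply toC.injective
      rw [map_add, map_smul, map_smul, LinearIsometryEquiv.apply_symm_apply,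
        LinearIsometryEquiv.apply_symm_apply]
      conv_lhs => rw [← Complex.re_add_im (toC z)]
      simp
    conv_lhs => rw [e, map_add, map_smul, map_smul]
    simp [hν, Complex.mul_re]
    ring
  have hν0 : ν ≠ 0 := by
    intro h0
    obtain ⟨z, hz⟩ := hne
    have := hφ z hz
    rw [hre, hre, h0] at this
    simp at this
  have hs : ∀ z ∈ K \ {q}, -ν * toC (z - q) ∈ Complex.slitPlane := by
    rintro z ⟨hz, hzq⟩
    have h1 : 0 ≤ (-ν * toC (z - q)).re := by
      have := hre (z - q)
      rw [map_sub] at this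
      have h2 := hle z hz
      rw [neg_mul, Complex.neg_re, ← this]
      linarith
    have h2 : -ν * toC (z - q) ≠ 0 :=
      mul_ne_zero (neg_ne_zero.2 hν0) (toC_sub_ne_zero hzq)
    rw [Complex.mem_slitPlane_iff]
    by_contra! hcon
    exact h2 (Complex.ext (le_antisymm hcon.1 h1) hcon.2)
  refine ⟨fun z => Complex.log (-ν * toC (z - q)) - Complex.log (-ν), ?_, fun z hz => ?_⟩
  · exact (ContinuousOn.clog (continuous_const.mul (continuous_toC_sub q)).continuousOn hs).sub
      continuousOn_const
  · rw [Complex.exp_sub, Complex.exp_log (Complex.slitPlane_ne_zero (hs z hz)),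
      Complex.exp_log (neg_ne_zero.2 hν0), mul_div_cancel_left₀ _ (neg_ne_zero.2 hν0)]

/-- Branches of the logarithm on the members of a chain of sets with connected successive
intersections can be glued on closed subsets that overlap only along the chain. -/
theorem HasLog.iUnion_chain {q : Plane} {M : ℕ} {K C : ℕ → Set Plane}
    (hlog : ∀ i ≤ M, HasLog q (K i \ {q})) (hC : ∀ i ≤ M, IsClosed (C i))
    (hCK : ∀ i ≤ M, C i ⊆ K i \ {q})
    (hE : ∀ i < M, IsPreconnected ((K i ∩ K (i + 1)) \ {q}))
    (hcons : ∀ i j, i < j → j ≤ M → ∀ c ∈ C i, c ∈ C j → ∀ k, i ≤ k → k ≤ j → c ∈ K k) :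
    HasLog q (⋃ i : Fin (M + 1), C i) := by
  classical
  have : ∃ g : ℕ → Plane → ℂ, ∀ i ≤ M, ContinuousOn (g i) (K i \ {q}) ∧
      ∀ z ∈ K i \ {q}, Complex.exp (g i z) = toC (z - q) := by
    choose! g hg using hlog
    exact ⟨g, hg⟩
  obtain ⟨g, hg⟩ := this
  -- On a connected overlap two branches differ by a constant period of `exp`. For an empty overlap
  -- any period will do.
  have hd : ∀ i < M, ∃ d : ℂ, Complex.exp d = 1 ∧
      ∀ c ∈ (K i ∩ K (i + 1)) \ {q}, g i c = g (i + 1) c + d := by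
    intro i hi
    rcases ((K i ∩ K (i + 1)) \ {q}).eq_empty_or_nonempty with h0 | ⟨e, he⟩
    · exact ⟨0, Complex.exp_zero, fun c hc => by rw [h0] at hc; exact hc.elim⟩
    have hs1 : (K i ∩ K (i + 1)) \ {q} ⊆ K i \ {q} := fun c hc => ⟨hc.1.1, hc.2⟩
    have hs2 : (K i ∩ K (i + 1)) \ {q} ⊆ K (i + 1) \ {q} := fun c hc => ⟨hc.1.2, hc.2⟩
    have heq : ∀ z ∈ (K i ∩ K (i + 1)) \ {q},
        Complex.exp (g i z) = Complex.exp (g (i + 1) z) := fun z hz => by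
      rw [(hg i hi.le).2 z (hs1 hz), (hg (i + 1) hi).2 z (hs2 hz)]
    refine ⟨g i e - g (i + 1) e, ?_, fun c hc => ?_⟩
    · rw [Complex.exp_sub, heq e he, div_self (Complex.exp_ne_zero _)]
    · have := sub_eq_sub_of_exp_eq (hE i hi) ((hg i hi.le).1.mono hs1)
        ((hg (i + 1) hi).1.mono hs2) heq hc he
      rw [← this]
      ring
  choose! d hd1 hd2 using hd
  -- Shifting each branch by the sum of all earlier constants makes successive branches agree.
  set L : ℕ → Plane → ℂ := fun i z => g i z + ∑ k ∈ Finset.range i, d k with hL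
  have hLstep : ∀ i < M, ∀ c ∈ K i, c ∈ K (i + 1) → c ≠ q → L i c = L (i + 1) c := by
    intro i hi c h1 h2 h3
    simp only [hL, Finset.sum_range_succ, hd2 i hi c ⟨⟨h1, h2⟩, h3⟩]
    ring
  have hLchain : ∀ i j, i ≤ j → j ≤ M → ∀ c, c ≠ q → (∀ k, i ≤ k → k ≤ j → c ∈ K k) →
      L i c = L j c := by
    intro i j hij
    induction j, hij using Nat.le_induction with
    | base => intros; rfl
    | succ j hij ih =>
      intro hj c hc hk
      rw [ih (by omega) c hc fun k h1 h2 => hk k h1 (by omega)]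
      exact hLstep j (by omega) c (hk j hij (by omega)) (hk (j + 1) (by omega) le_rfl) hc
  -- The agreement passes through the pieces between, all of which contain the common point by
  -- `hcons`.
  have hLC : ∀ i ≤ M, ∀ j ≤ M, ∀ c ∈ C i, c ∈ C j → L i c = L j c := by
    intro i hi j hj c hci hcj
    rcases lt_trichotomy i j with h | rfl | h
    · exact hLchain i j h.le hj c (hCK i hi hci).2 (hcons i j h hj c hci hcj)
    · rfl
    · exact (hLchain j i h.le hi c (hCK i hi hci).2 (hcons j i h hi c hcj hci)).symm
  have hexp : ∀ i ≤ M, ∀ c ∈ C i, Complex.exp (L i c) = toC (c - q) := by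
    intro i hi c hc
    have hone : ∀ j ≤ M, Complex.exp (∑ k ∈ Finset.range j, d k) = 1 := by
      intro j hj
      rw [Complex.exp_sum]
      exact Finset.prod_eq_one fun k hk => hd1 k (by rw [Finset.mem_range] at hk; omega)
    simp only [hL]
    rw [Complex.exp_add, hone i hi, mul_one, (hg i hi).2 c (hCK i hi hc)]
  set Λ : Plane → ℂ := fun c => if h : ∃ i : Fin (M + 1), c ∈ C i then L h.choose c else 0 with hΛ
  have hΛL : ∀ i : Fin (M + 1), ∀ c ∈ C i, Λ c = L i c := by
    intro i c hc
    have hex : ∃ i : Fin (M + 1), c ∈ C i := ⟨i, hc⟩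
    simp only [hΛ, hex, dif_pos]
    exact hLC _ (by omega) _ (by omega) c hex.choose_spec hc
  refine ⟨Λ, ?_, fun z hz => ?_⟩
  · refine (locallyFinite_of_finite _).continuousOn_iUnion (fun i => hC i (by omega)) fun i => ?_
    refine ContinuousOn.congr ?_ (hΛL i)
    exact ((hg i (by omega)).1.mono (hCK i (by omega))).add continuousOn_const
  · obtain ⟨i, hi⟩ := Set.mem_iUnion.1 hz
    rw [hΛL i z hi, hexp i (by omega) z hi]

end BorderRegion

/-! ### Frames, and the monotonicity of shortest paths in a strip. -/

namespace BorderRegion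

/-- Orthogonal coordinates of the plane: `X` along and `H` across a line, both scaled by `D`. -/
structure Frame where
  X : Plane →ᵃ[ℝ] ℝ
  H : Plane →ᵃ[ℝ] ℝ
  D : ℝ
  D_pos : 0 < D
  dist_sq : ∀ z z', (D * dist z z') ^ 2 = (X z - X z') ^ 2 + (H z - H z') ^ 2

namespace Frame

/-- The frame with the coordinate along the line reversed. -/
noncomputable def mirror (F : Frame) : Frame where
  X := -F.X
  H := F.H
  D := F.D
  D_pos := F.D_pos
  dist_sq z z' := by
    rw [F.dist_sq]
    simp
    ring

@[simp] theorem mirror_X (F : Frame) (z : Plane) : F.mirror.X z = -F.X z := rfl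

@[simp] theorem mirror_H (F : Frame) : F.mirror.H = F.H := rfl

variable (F : Frame)

theorem ext_coord {z z' : Plane} (hX : F.X z = F.X z') (hH : F.H z = F.H z') : z = z' := by
  have := F.dist_sq z z'
  rw [hX, hH] at this
  have h0 : F.D * dist z z' = 0 := by
    have : (F.D * dist z z') ^ 2 = 0 := by rw [this]; ring
    exact pow_eq_zero_iff (two_ne_zero) |>.1 this
  rcases mul_eq_zero.1 h0 with h | h
  · exact absurd h F.D_pos.ne'
  · exact dist_eq_zero.1 h

theorem X_sub_le (z z' : Plane) : F.X z - F.X z' ≤ F.D * dist z z' := by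
  have h1 := F.dist_sq z z'
  have h2 : 0 ≤ F.D * dist z z' := mul_nonneg F.D_pos.le dist_nonneg
  by_contra! h
  nlinarith [sq_nonneg (F.H z - F.H z')]

theorem X_sub_lt {z z' : Plane} (h : F.H z ≠ F.H z') : F.X z - F.X z' < F.D * dist z z' := by
  have h1 := F.dist_sq z z'
  have h2 : 0 ≤ F.D * dist z z' := mul_nonneg F.D_pos.le dist_nonneg
  have h3 : 0 < (F.H z - F.H z') ^ 2 := by
    have : F.H z - F.H z' ≠ 0 := sub_ne_zero.2 h
    positivity
  by_contra! h
  nlinarith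

theorem D_mul_dist {z z' : Plane} (h : F.H z = F.H z') (hX : F.X z' ≤ F.X z) :
    F.D * dist z z' = F.X z - F.X z' := by
  have h1 := F.dist_sq z z'
  rw [h, sub_self] at h1
  have h2 : 0 ≤ F.D * dist z z' := mul_nonneg F.D_pos.le dist_nonneg
  have h3 : 0 ≤ F.X z - F.X z' := sub_nonneg.2 hX
  nlinarith

theorem X_lineMap (z z' : Plane) (t : ℝ) :
    F.X (AffineMap.lineMap z z' t) = (1 - t) * F.X z + t * F.X z' := by
  rw [AffineMap.apply_lineMap, AffineMap.lineMap_apply_module, smul_eq_mul, smul_eq_mul]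

theorem H_lineMap (z z' : Plane) (t : ℝ) :
    F.H (AffineMap.lineMap z z' t) = (1 - t) * F.H z + t * F.H z' := by
  rw [AffineMap.apply_lineMap, AffineMap.lineMap_apply_module, smul_eq_mul, smul_eq_mul]

/-- A segment that ends on both sides of a height contains a point at this height. -/
theorem exists_mem_segment {z z' : Plane} {t : ℝ} (h1 : F.H z ≤ t) (h2 : t ≤ F.H z') :
    ∃ g ∈ segment ℝ z z', F.H g = t := by
  rcases eq_or_lt_of_le (h1.trans h2) with h | h
  · exact ⟨z, left_mem_segment ℝ z z', le_antisymm h1 (h ▸ h2)⟩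
  refine ⟨AffineMap.lineMap z z' ((t - F.H z) / (F.H z' - F.H z)), ?_, ?_⟩
  · rw [segment_eq_image_lineMap]
    refine ⟨_, ⟨?_, ?_⟩, rfl⟩
    · exact div_nonneg (by linarith) (by linarith)
    · rw [div_le_one (by linarith)]; linarith
  · rw [F.H_lineMap]
    have : F.H z' - F.H z ≠ 0 := by linarith
    field_simp
    ring

end Frame

/-- Comparison of the lengths of two paths through a potential. -/
theorem pathLength_lt {N : ℕ} {y y' : ℕ → Plane} {φ : ℕ → ℝ} (h0 : φ 0 = 0) (hN : φ N = 0)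
    (hle : ∀ i < N, dist (y' i) (y' (i + 1)) ≤ dist (y i) (y (i + 1)) + (φ (i + 1) - φ i))
    (hlt : ∃ i < N, dist (y' i) (y' (i + 1)) < dist (y i) (y (i + 1)) + (φ (i + 1) - φ i)) :
    pathLength N y' < pathLength N y := by
  have h1 : pathLength N y' <
      ∑ i ∈ Finset.range N, (dist (y i) (y (i + 1)) + (φ (i + 1) - φ i)) := by
    refine Finset.sum_lt_sum (fun i hi => hle i (Finset.mem_range.1 hi)) ?_
    obtain ⟨i, hi, h⟩ := hlt
    exact ⟨i, Finset.mem_range.2 hi, h⟩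
  rw [Finset.sum_add_distrib, Finset.sum_range_sub, h0, hN, sub_zero, add_zero] at h1
  exact h1

/-- The polygonal path `y 0, …, y N` runs through the sets `K 0, …, K (N - 1)`. -/
def RunsThrough (K : ℕ → Set Plane) (N : ℕ) (p q : Plane) (y : ℕ → Plane) : Prop :=
  y 0 = p ∧ y N = q ∧ ∀ j < N, y j ∈ K j ∧ y (j + 1) ∈ K j

/-- A chain of convex pieces above a base line, each of them west of the previous one, separated by
portals that rise from the base line. -/
structure Strip (F : Frame) (K : ℕ → Set Plane) (N : ℕ) (p : Plane) : Prop where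
  convex : ∀ j < N, Convex ℝ (K j)
  nonneg : ∀ j < N, ∀ z ∈ K j, 0 ≤ F.H z
  base : F.H p = 0
  portal_low : ∀ j, j + 1 < N → ∃ z ∈ K j ∩ K (j + 1), F.H z = 0
  portal_high : ∀ j, j + 1 < N → ∃ z ∈ K j ∩ K (j + 1), 0 < F.H z
  west : ∀ j, j + 1 < N → ∀ z ∈ K j ∩ K (j + 1), ∀ z' ∈ K (j + 1), F.H z' = F.H z → F.X z' ≤ F.X z
  east : ∀ j, j + 1 < N → ∀ z ∈ K j ∩ K (j + 1), ∀ z' ∈ K j, F.H z' = F.H z → F.X z ≤ F.X z'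
  -- Successive portals have no common foot on the base line.
  sep : ∀ j, j + 2 < N → ∀ z ∈ K j, z ∈ K (j + 1) → z ∈ K (j + 2) → 0 < F.H z

/-- A shortest path through a strip, from its base point. -/
structure TautPath (F : Frame) (K : ℕ → Set Plane) (N : ℕ) (p q : Plane) (y : ℕ → Plane) : Prop where
  strip : Strip F K N p
  runs : RunsThrough K N p q y
  shortest : ∀ y', RunsThrough K N p q y' → pathLength N y ≤ pathLength N y'
  end_eq : F.H q = 0 → q = p

namespace TautPath

variable {F : Frame} {K : ℕ → Set Plane} {N : ℕ} {p q : Plane} {y : ℕ → Plane}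

theorem mem_portal (h : TautPath F K N p q y) {j : ℕ} (hj : j + 1 < N) :
    y (j + 1) ∈ K j ∩ K (j + 1) :=
  ⟨(h.runs.2.2 j (by omega)).2, (h.runs.2.2 (j + 1) hj).1⟩

theorem H_nonneg (h : TautPath F K N p q y) {j : ℕ} (hj : j ≤ N) : 0 ≤ F.H (y j) := by
  rcases Nat.eq_zero_or_pos j with rfl | hj0
  · rw [h.runs.1, h.strip.base]
  · obtain ⟨k, rfl⟩ : ∃ k, j = k + 1 := ⟨j - 1, by omega⟩
    exact h.strip.nonneg k (by omega) _ (h.runs.2.2 k (by omega)).2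

/-- Points of a portal exist at all heights below a given one. -/
theorem exists_portal_point (h : TautPath F K N p q y) {j : ℕ} (hj : j + 1 < N) {t : ℝ} (h0 : 0 ≤ t)
    (ht : t ≤ F.H (y (j + 1))) : ∃ z ∈ K j ∩ K (j + 1), F.H z = t := by
  obtain ⟨z, hz, hz0⟩ := h.strip.portal_low j hj
  obtain ⟨g, hg, hgt⟩ := F.exists_mem_segment (z := z) (z' := y (j + 1)) (hz0 ▸ h0) ht
  exact ⟨g, ((h.strip.convex j (by omega)).inter (h.strip.convex (j + 1) hj)).segment_subset hz
    (h.mem_portal hj) hg, hgt⟩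

/-- The heights along a shortest path do not decrease. -/
theorem H_step (h : TautPath F K N p q y) {j : ℕ} (hj : j < N) : F.H (y j) ≤ F.H (y (j + 1)) := by
  -- If the path descended to the height `t`, lowering its earlier vertices above `t` to points of
  -- their portals at that height would shorten it.
  by_contra! hlt
  set t := F.H (y (j + 1)) with ht
  have ht0 : 0 ≤ t := h.H_nonneg hj
  have hD := F.D_pos
  have hpt : ∀ i, ∃ z, (i ≤ j ∧ t < F.H (y i) → 1 ≤ i ∧ z ∈ K (i - 1) ∩ K i ∧ F.H z = t) ∧
      (¬ (i ≤ j ∧ t < F.H (y i)) → z = y i) := by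
    intro i
    by_cases hi : i ≤ j ∧ t < F.H (y i)
    · have hi1 : 1 ≤ i := by
        by_contra! h0
        obtain rfl : i = 0 := by omega
        rw [h.runs.1, h.strip.base] at hi
        linarith [hi.2]
      obtain ⟨k, rfl⟩ : ∃ k, i = k + 1 := ⟨i - 1, by omega⟩
      obtain ⟨z, hz, hzt⟩ := h.exists_portal_point (j := k) (by omega) ht0 hi.2.le
      exact ⟨z, fun _ => ⟨hi1, hz, hzt⟩, fun hn => absurd hi hn⟩
    · exact ⟨y i, fun hn => absurd hn hi, fun _ => rfl⟩
  choose y' hy1 hy2 using hpt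
  have hmemK : ∀ i < N, y' i ∈ K i ∧ y' (i + 1) ∈ K i := by
    intro i hi
    constructor
    · by_cases hc : i ≤ j ∧ t < F.H (y i)
      · exact (hy1 i hc).2.1.2
      · rw [hy2 i hc]; exact (h.runs.2.2 i hi).1
    · by_cases hc : i + 1 ≤ j ∧ t < F.H (y (i + 1))
      · exact (hy1 (i + 1) hc).2.1.1
      · rw [hy2 (i + 1) hc]; exact (h.runs.2.2 i hi).2
  have hruns : RunsThrough K N p q y' := by
    refine ⟨?_, ?_, hmemK⟩
    · rw [hy2 0, h.runs.1]
      rintro ⟨-, h0⟩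
      rw [h.runs.1, h.strip.base] at h0
      linarith
    · rw [hy2 N, h.runs.2.1]
      rintro ⟨h0, -⟩
      omega
  have hwest : ∀ i < N, 1 ≤ i → ∀ z ∈ K (i - 1) ∩ K i, ∀ z' ∈ K i, F.H z' = F.H z →
      F.X z' ≤ F.X z := by
    intro i hi hi1
    obtain ⟨k, rfl⟩ : ∃ k, i = k + 1 := ⟨i - 1, by omega⟩
    exact h.strip.west k hi
  -- A step that passes the height `t` is split at a point of that height.
  have hcross : ∀ i < N, ∀ s, (F.H (y i) ≤ s ∧ s ≤ F.H (y (i + 1)) ∨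
      F.H (y (i + 1)) ≤ s ∧ s ≤ F.H (y i)) → ∃ g ∈ K i, F.H g = s ∧
      dist (y i) g + dist g (y (i + 1)) = dist (y i) (y (i + 1)) := by
    intro i hi s hs
    have hseg : segment ℝ (y i) (y (i + 1)) ⊆ K i :=
      (h.strip.convex i hi).segment_subset (h.runs.2.2 i hi).1 (h.runs.2.2 i hi).2
    rcases hs with hs | hs
    · obtain ⟨g, hg, hgs⟩ := F.exists_mem_segment hs.1 hs.2
      exact ⟨g, hseg hg, hgs, dist_add_dist_of_mem_segment hg⟩
    · obtain ⟨g, hg, hgs⟩ := F.exists_mem_segment hs.1 hs.2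
      rw [segment_symm] at hg
      exact ⟨g, hseg hg, hgs, dist_add_dist_of_mem_segment hg⟩
  -- The potential is `X (y i) - X (y' i)`. A level new step runs west, so its length is its loss in
  -- `X`, while no old step is shorter than its own loss in `X`.
  have hstep : ∀ i < N, F.D * dist (y' i) (y' (i + 1)) ≤ F.D * dist (y i) (y (i + 1)) +
      ((F.X (y (i + 1)) - F.X (y' (i + 1))) - (F.X (y i) - F.X (y' i))) := by
    intro i hi
    by_cases ha : i ≤ j ∧ t < F.H (y i)
    · obtain ⟨hi1, ha1, ha2⟩ := hy1 i ha
      by_cases hb : i + 1 ≤ j ∧ t < F.H (y (i + 1))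
      · obtain ⟨-, hb1, hb2⟩ := hy1 (i + 1) hb
        have hX := hwest i hi hi1 _ ha1 _ (hmemK i hi).2 (hb2.trans ha2.symm)
        rw [F.D_mul_dist (ha2.trans hb2.symm) hX]
        have := F.X_sub_le (y i) (y (i + 1))
        linarith
      · rw [hy2 _ hb]
        have hb' : F.H (y (i + 1)) ≤ t := by
          by_contra! hh
          rcases Nat.lt_or_ge j (i + 1) with h1 | h1
          · obtain rfl : i = j := by omega
            exact absurd hh (lt_irrefl _)
          · exact hb ⟨h1, hh⟩
        obtain ⟨g, hgK, hgt, hgd⟩ := hcross i hi t (Or.inr ⟨hb', ha.2.le⟩)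
        have hX := hwest i hi hi1 _ ha1 _ hgK (hgt.trans ha2.symm)
        have e1 := F.D_mul_dist (ha2.trans hgt.symm) hX
        have e2 := dist_triangle (y' i) g (y (i + 1))
        have e3 := F.X_sub_le (y i) g
        rw [← hgd, mul_add]
        have e4 := mul_le_mul_of_nonneg_left e2 hD.le
        rw [mul_add] at e4
        linarith
    · rw [hy2 i ha]
      by_cases hb : i + 1 ≤ j ∧ t < F.H (y (i + 1))
      · obtain ⟨-, hb1, hb2⟩ := hy1 (i + 1) hb
        have ha' : F.H (y i) ≤ t := by
          by_contra! hh
          exact ha ⟨by omega, hh⟩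
        obtain ⟨g, hgK, hgt, hgd⟩ := hcross i hi t (Or.inl ⟨ha', hb.2.le⟩)
        have hX := h.strip.east i (by omega) _ hb1 _ hgK (hgt.trans hb2.symm)
        have e1 := F.D_mul_dist (hgt.trans hb2.symm) hX
        have e2 := dist_triangle (y i) g (y' (i + 1))
        have e3 := F.X_sub_le g (y (i + 1))
        rw [← hgd, mul_add]
        have e4 := mul_le_mul_of_nonneg_left e2 hD.le
        rw [mul_add] at e4
        linarith
      · rw [hy2 _ hb]
        linarith
  -- The descending step is not level and hence strictly longer than its loss in `X`.
  have hlast : F.D * dist (y' j) (y' (j + 1)) < F.D * dist (y j) (y (j + 1)) +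
      ((F.X (y (j + 1)) - F.X (y' (j + 1))) - (F.X (y j) - F.X (y' j))) := by
    obtain ⟨hi1, ha1, ha2⟩ := hy1 j ⟨le_rfl, hlt⟩
    rw [hy2 (j + 1) (by omega)]
    have hX := hwest j hj hi1 _ ha1 _ (h.runs.2.2 j hj).2 ha2.symm
    rw [F.D_mul_dist ha2 hX]
    have := F.X_sub_lt (z := y j) (z' := y (j + 1)) (by rw [← ht]; exact hlt.ne')
    linarith
  refine absurd (h.shortest y' hruns) (not_le.2 (pathLength_lt
    (φ := fun i => (F.X (y i) - F.X (y' i)) / F.D) ?_ ?_ ?_ ⟨j, hj, ?_⟩))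
  · simp only [hruns.1, h.runs.1, sub_self, zero_div]
  · simp only [hruns.2.1, h.runs.2.1, sub_self, zero_div]
  · intro i hi
    have := hstep i hi
    rw [← sub_div, ← mul_le_mul_iff_right₀ hD, mul_add, mul_div_cancel₀ _ hD.ne']
    exact this
  · rw [← sub_div, ← mul_lt_mul_iff_right₀ hD, mul_add, mul_div_cancel₀ _ hD.ne']
    exact hlast

theorem H_mono (h : TautPath F K N p q y) {i j : ℕ} (hij : i ≤ j) (hj : j ≤ N) :
    F.H (y i) ≤ F.H (y j) := by
  induction j, hij using Nat.le_induction with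
  | base => exact le_rfl
  | succ j hij ih => exact (ih (by omega)).trans (h.H_step (by omega))

/-- A shortest path leads west where it is level. -/
theorem X_step (h : TautPath F K N p q y) {j : ℕ} (hj : j < N)
    (hH : F.H (y (j + 1)) = F.H (y j)) : F.X (y (j + 1)) ≤ F.X (y j) := by
  -- The first step is compared with the portal ahead, later ones with the portal behind. A single
  -- piece has no portal; there `end_eq` applies.
  rcases Nat.eq_zero_or_pos j with rfl | hj0
  · rcases Nat.lt_or_ge 1 N with h1 | h1
    · exact h.strip.east 0 h1 _ (h.mem_portal h1) _ (h.runs.2.2 0 hj).1 hH.symm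
    · obtain rfl : N = 1 := by omega
      rw [zero_add, h.runs.2.1, h.runs.1, h.strip.base] at hH
      rw [zero_add, h.runs.2.1, h.runs.1, h.end_eq hH]
  · obtain ⟨k, rfl⟩ : ∃ k, j = k + 1 := ⟨j - 1, by omega⟩
    exact h.strip.west k hj _ (h.mem_portal hj) _ (h.runs.2.2 (k + 1) hj).2 hH

theorem X_anti (h : TautPath F K N p q y) {i j : ℕ} (hij : i ≤ j) (hj : j ≤ N)
    (hH : F.H (y j) = F.H (y i)) : F.X (y j) ≤ F.X (y i) := by
  induction j, hij using Nat.le_induction with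
  | base => exact le_rfl
  | succ j hij ih =>
    have h1 := h.H_mono hij (by omega : j ≤ N)
    have h2 := h.H_step (by omega : j < N)
    exact (h.X_step (by omega) (by linarith)).trans (ih (by omega) (by linarith))

end TautPath

end BorderRegion

/-! ### Contacts of a shortest path with the base line and with itself. -/

namespace BorderRegion

namespace TautPath

variable {F : Frame} {K : ℕ → Set Plane} {N : ℕ} {p q : Plane} {y : ℕ → Plane}

/-- Replacing one inner vertex of a shortest path does not shorten it. -/
theorem le_of_replace (h : TautPath F K N p q y) {j : ℕ} (hj : j + 1 < N) {z : Plane}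
    (hz : z ∈ K j ∩ K (j + 1)) :
    dist (y j) (y (j + 1)) + dist (y (j + 1)) (y (j + 2)) ≤ dist (y j) z + dist z (y (j + 2)) := by
  by_contra! hlt
  set y' : ℕ → Plane := fun i => if i = j + 1 then z else y i with hy'
  have e0 : y' (j + 1) = z := by simp [hy']
  have e1 : ∀ i, i ≠ j + 1 → y' i = y i := fun i hi => by simp [hy', hi]
  have hruns : RunsThrough K N p q y' := by
    refine ⟨?_, ?_, fun i hi => ⟨?_, ?_⟩⟩
    · rw [e1 0 (by omega), h.runs.1]
    · rw [e1 N (by omega), h.runs.2.1]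
    · by_cases hij : i = j + 1
      · rw [hij, e0]; exact hz.2
      · rw [e1 i hij]; exact (h.runs.2.2 i hi).1
    · by_cases hij : i = j
      · rw [hij, e0]; exact hz.1
      · rw [e1 (i + 1) (by omega)]; exact (h.runs.2.2 i hi).2
  refine absurd (h.shortest y' hruns) (not_le.2 (pathLength_lt
    (φ := fun i => if i = j + 1 then dist (y j) z - dist (y j) (y (j + 1)) else 0)
    (by simp) (by rw [if_neg (by omega)]) ?_ ⟨j + 1, hj, ?_⟩))
  · intro i hi
    rcases lt_trichotomy i j with h1 | rfl | h1
    · rw [e1 i (by omega), e1 (i + 1) (by omega), if_neg (by omega), if_neg (by omega)]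
      simp
    · rw [e1 i (by omega), e0, if_pos rfl, if_neg (by omega)]
      linarith
    · rcases Nat.lt_or_ge (j + 1) i with h2 | h2
      · rw [e1 i (by omega), e1 (i + 1) (by omega), if_neg (by omega), if_neg (by omega)]
        simp
      · obtain rfl : i = j + 1 := by omega
        rw [e0, e1 (j + 1 + 1) (by omega), if_neg (by omega), if_pos rfl]
        linarith
  · rw [e0, e1 (j + 1 + 1) (by omega), if_neg (by omega), if_pos rfl]
    linarith

/-- A shortest path does not follow the base line and rise from it at a portal. -/
theorem not_rise (h : TautPath F K N p q y) {j : ℕ} (hj : j + 1 < N) (h0 : F.H (y j) = 0)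
    (h1 : F.H (y (j + 1)) = 0) (h2 : 0 < F.H (y (j + 2))) (hX : F.X (y (j + 1)) < F.X (y j)) :
    False := by
  -- The path turns at the foot `P` of a portal that rises between the arms to `a` and to `c`.
  -- Moving `P` up along the portal cuts the corner.
  obtain ⟨u, hu, hu0⟩ := h.strip.portal_high j hj
  set a := y j
  set P := y (j + 1) with hP
  set c := y (j + 2) with hc
  have hPp : P ∈ K j ∩ K (j + 1) := h.mem_portal hj
  have hcK : c ∈ K (j + 1) := (h.runs.2.2 (j + 1) hj).2
  have hconv := (h.strip.convex j (by omega)).inter (h.strip.convex (j + 1) hj)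
  -- Compared at the lower of the heights of `u` and `c`, the arm to `c` is not east of the portal;
  -- cross-multiplied to avoid division.
  have hslope : (F.X c - F.X P) * F.H u ≤ (F.X u - F.X P) * F.H c := by
    rcases le_total (F.H u) (F.H c) with hle | hle
    · have hz : AffineMap.lineMap P c (F.H u / F.H c) ∈ K (j + 1) := by
        apply (h.strip.convex (j + 1) hj).segment_subset hPp.2 hcK
        rw [segment_eq_image_lineMap]
        exact ⟨_, ⟨by positivity, by rw [div_le_one h2]; exact hle⟩, rfl⟩
      have := h.strip.west j hj u hu _ hz (by
        rw [F.H_lineMap, h1]; field_simp; ring)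
      rw [F.X_lineMap] at this
      have e : (F.X c - F.X P) * F.H u =
          ((1 - F.H u / F.H c) * F.X P + F.H u / F.H c * F.X c - F.X P) * F.H c := by
        field_simp
        ring
      rw [e]
      exact mul_le_mul_of_nonneg_right (by linarith) h2.le
    · have hz : AffineMap.lineMap P u (F.H c / F.H u) ∈ K j ∩ K (j + 1) := by
        apply hconv.segment_subset hPp hu
        rw [segment_eq_image_lineMap]
        exact ⟨_, ⟨by positivity, by rw [div_le_one hu0]; exact hle⟩, rfl⟩
      have := h.strip.west j hj _ hz c hcK (by
        rw [F.H_lineMap, h1]; field_simp; ring)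
      rw [F.X_lineMap] at this
      have e : (F.X u - F.X P) * F.H c =
          ((1 - F.H c / F.H u) * F.X P + F.H c / F.H u * F.X u - F.X P) * F.H u := by
        field_simp
        ring
      rw [e]
      exact mul_le_mul_of_nonneg_right (by linarith) hu0.le
  set A := F.X a - F.X P with hA
  have hA0 : 0 < A := by linarith
  -- `z` is the point where the line from `P` through `u` meets the segment `a c`; its parameters on
  -- the two are `t` and `A * F.H u / den`.
  set den := (F.X u - F.X P) * F.H c - (F.X c - F.X P) * F.H u + A * F.H u with hden
  have hAu : 0 < A * F.H u := by positivity
  have hden0 : 0 < den := by linarith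
  set t := A * F.H c / den with ht
  have ht0 : 0 < t := by positivity
  set z := AffineMap.lineMap (k := ℝ) P u t with hz
  have hzeq : z = AffineMap.lineMap a c (A * F.H u / den) := by
    apply F.ext_coord
    · rw [hz, F.X_lineMap, F.X_lineMap, ht]
      have : F.X a = A + F.X P := by rw [hA]; ring
      rw [this]
      field_simp
      rw [hden]
      ring
    · rw [hz, F.H_lineMap, F.H_lineMap, h0, h1, ht]
      field_simp
      ring
  have hzseg : z ∈ segment ℝ a c := by
    rw [hzeq, segment_eq_image_lineMap]
    exact ⟨_, ⟨by positivity, by rw [div_le_one hden0]; linarith⟩, rfl⟩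
  have hzd := dist_add_dist_of_mem_segment hzseg
  have hstrict : dist a c < dist a P + dist P c := by
    refine lt_of_le_of_ne (dist_triangle _ _ _) fun heq => ?_
    obtain ⟨μ, hμ, hμe⟩ := dist_add_dist_eq_iff.1 heq.symm
    have e1 := F.H_lineMap a c μ
    rw [hμe, h0, h1] at e1
    have hμ0 : μ = 0 := by
      have : μ * F.H c = 0 := by linarith
      exact (mul_eq_zero.1 this).resolve_right h2.ne'
    rw [hμ0, AffineMap.lineMap_apply_zero] at hμe
    rw [hμe] at hX
    exact lt_irrefl _ hX
  -- `z` may lie beyond `u`, so only the fraction `s` of the way is taken, which stays in the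
  -- portal. By convexity of the distance this gains at least the same fraction of the excess
  -- length.
  set s := min 1 (1 / t) with hs
  have hs0 : 0 < s := lt_min one_pos (by positivity)
  have hs1 : s ≤ 1 := min_le_left _ _
  set z' := AffineMap.lineMap (k := ℝ) P z s with hz'
  have hz'p : z' ∈ K j ∩ K (j + 1) := by
    have e : z' = AffineMap.lineMap P u (s * t) := by
      apply F.ext_coord
      · rw [hz', hz, F.X_lineMap, F.X_lineMap, F.X_lineMap]; ring
      · rw [hz', hz, F.H_lineMap, F.H_lineMap, F.H_lineMap]; ring
    rw [e]
    apply hconv.segment_subset hPp hu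
    rw [segment_eq_image_lineMap]
    refine ⟨_, ⟨by positivity, ?_⟩, rfl⟩
    calc s * t ≤ 1 / t * t := mul_le_mul_of_nonneg_right (min_le_right _ _) ht0.le
      _ = 1 := by field_simp
  have hconvd : ∀ o : Plane, dist o z' ≤ (1 - s) * dist o P + s * dist o z := by
    intro o
    have := (convexOn_univ_dist o).2 (Set.mem_univ P) (Set.mem_univ z)
      (by linarith : 0 ≤ 1 - s) hs0.le (by ring)
    simp only [smul_eq_mul] at this
    rw [dist_comm o z', hz', AffineMap.lineMap_apply_module, dist_comm o P, dist_comm o z]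
    exact this
  have hle := h.le_of_replace hj hz'p
  have g1 := hconvd a
  have g2 := hconvd c
  rw [dist_comm c z', dist_comm c P, dist_comm c z] at g2
  have : s * (dist a P + dist P c) ≤ s * dist a c := by
    rw [← hzd]
    linarith
  exact absurd (le_of_mul_le_mul_left this hs0) (not_le.2 hstrict)

/-- A shortest path touches the base line only in its first point. -/
theorem eq_of_H_eq_zero (h : TautPath F K N p q y) {j : ℕ} (hj : j ≤ N) (hH : F.H (y j) = 0) :
    y j = p := by
  have hlev : ∀ i ≤ j, F.H (y i) = 0 := fun i hi =>
    le_antisymm (hH ▸ h.H_mono hi hj) (h.H_nonneg (by omega))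
  rcases eq_or_lt_of_le (h.H_nonneg le_rfl) with hN | hN
  · have hend : y N = p := by
      rw [h.runs.2.1]
      exact h.end_eq (by rw [← h.runs.2.1]; exact hN.symm)
    apply F.ext_coord
    · apply le_antisymm
      · have := h.X_anti (Nat.zero_le j) hj (by rw [hH, hlev 0 (Nat.zero_le _)])
        rwa [h.runs.1] at this
      · have := h.X_anti hj le_rfl (by rw [hH, ← hN])
        rwa [hend] at this
    · rw [hH, h.strip.base]
  -- The path ends above the base line, and `k` is its last vertex on that line.
  · have hex : ∃ k, j ≤ k ∧ k < N ∧ F.H (y k) = 0 ∧ 0 < F.H (y (k + 1)) := by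
      by_contra! hcon
      have : ∀ k, j ≤ k → k ≤ N → F.H (y k) = 0 := by
        intro k hjk
        induction k, hjk using Nat.le_induction with
        | base => exact fun _ => hH
        | succ k hjk ih =>
          intro hk
          exact le_antisymm (hcon k hjk (by omega) (ih (by omega))) (h.H_nonneg hk)
      exact hN.ne' (this N hj le_rfl)
    obtain ⟨k, hjk, hkN, hk0, hk1⟩ := hex
    by_contra hne
    have hlev' : ∀ i ≤ k, F.H (y i) = 0 := fun i hi =>
      le_antisymm (hk0 ▸ h.H_mono hi hkN.le) (h.H_nonneg (by omega))
    have hkp : y k ≠ p := by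
      intro hkp
      apply hne
      apply F.ext_coord
      · apply le_antisymm
        · have := h.X_anti (Nat.zero_le j) hj (by rw [hH, hlev 0 (Nat.zero_le _)])
          rwa [h.runs.1] at this
        · have := h.X_anti hjk hkN.le (by rw [hH, hk0])
          rwa [hkp] at this
      · rw [hH, h.strip.base]
    have hk : k ≠ 0 := by
      rintro rfl
      exact hkp h.runs.1
    obtain ⟨i, rfl⟩ : ∃ i, k = i + 1 := ⟨k - 1, by omega⟩
    have hi0 := hlev' i (by omega)
    -- By `not_rise` the step into `y k` has length zero. Then `y k` is the starting point or lies
    -- on two successive portals, contrary to `sep`.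
    refine h.not_rise hkN hi0 hk0 hk1 (lt_of_le_of_ne (h.X_step (by omega) (by rw [hk0, hi0])) ?_)
    intro hX
    have heq : y (i + 1) = y i := F.ext_coord hX (by rw [hk0, hi0])
    rcases Nat.eq_zero_or_pos i with rfl | hi
    · exact hkp (heq.trans h.runs.1)
    · obtain ⟨l, rfl⟩ : ∃ l, i = l + 1 := ⟨i - 1, by omega⟩
      have h1 := h.mem_portal (j := l) (by omega)
      have h2 := h.mem_portal hkN
      rw [heq] at h2
      have := h.strip.sep l (by omega) _ h1.1 h1.2 h2.2
      rw [hi0] at this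
      exact lt_irrefl _ this

theorem H_le_of_mem_segment (h : TautPath F K N p q y) {i : ℕ} (hi : i < N) {c : Plane}
    (hc : c ∈ segment ℝ (y i) (y (i + 1))) : F.H (y i) ≤ F.H c ∧ F.H c ≤ F.H (y (i + 1)) := by
  rw [segment_eq_image_lineMap] at hc
  obtain ⟨t, ⟨ht0, ht1⟩, rfl⟩ := hc
  rw [F.H_lineMap]
  have := h.H_step hi
  constructor <;> nlinarith

theorem H_le_end (h : TautPath F K N p q y) {i : ℕ} (hi : i < N) {c : Plane}
    (hc : c ∈ segment ℝ (y i) (y (i + 1))) : F.H c ≤ F.H q := by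
  rw [← h.runs.2.1]
  exact (h.H_le_of_mem_segment hi hc).2.trans (h.H_mono (by omega) le_rfl)

theorem X_le_of_mem_segment (h : TautPath F K N p q y) {i : ℕ} (hi : i < N) {c : Plane}
    (hc : c ∈ segment ℝ (y i) (y (i + 1))) :
    (F.H c = F.H (y (i + 1)) → F.X (y (i + 1)) ≤ F.X c) ∧
      (F.H c = F.H (y i) → F.X c ≤ F.X (y i)) := by
  have hstep := h.H_step hi
  rw [segment_eq_image_lineMap] at hc
  obtain ⟨t, ⟨ht0, ht1⟩, rfl⟩ := hc
  rw [F.H_lineMap, F.X_lineMap]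
  rcases eq_or_lt_of_le hstep with heq | hlt
  · have := h.X_step hi heq.symm
    exact ⟨fun _ => by nlinarith, fun _ => by nlinarith⟩
  · constructor
    · intro e
      have : (1 - t) * (F.H (y (i + 1)) - F.H (y i)) = 0 := by linarith
      rcases mul_eq_zero.1 this with h0 | h0
      · obtain rfl : t = 1 := by linarith
        simp
      · linarith
    · intro e
      have : t * (F.H (y (i + 1)) - F.H (y i)) = 0 := by linarith
      rcases mul_eq_zero.1 this with h0 | h0
      · rw [h0]; simp
      · linarith

/-- A shortest path stays in place between two visits of a point. -/
theorem eq_of_mem_segments (h : TautPath F K N p q y) {i j : ℕ} (hij : i < j) (hj : j < N)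
    {c : Plane} (hci : c ∈ segment ℝ (y i) (y (i + 1))) (hcj : c ∈ segment ℝ (y j) (y (j + 1)))
    {k : ℕ} (hik : i < k) (hkj : k ≤ j) : y k = c := by
  -- `y k` is squeezed between the two visits of `c`, first in height and then, on the level part of
  -- the path, in `X`.
  have h1 := (h.H_le_of_mem_segment (by omega) hci).2
  have h2 := (h.H_le_of_mem_segment hj hcj).1
  have m1 := h.H_mono (show i + 1 ≤ k by omega) (by omega)
  have m2 := h.H_mono hkj hj.le
  have x1 := (h.X_le_of_mem_segment (by omega) hci).1 (by linarith)
  have x2 := (h.X_le_of_mem_segment hj hcj).2 (by linarith)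
  have n1 := h.X_anti (show i + 1 ≤ k by omega) (by omega) (by linarith)
  have n2 := h.X_anti hkj hj.le (by linarith)
  exact F.ext_coord (by linarith) (by linarith)

/-- A shortest path stays in place after its first visit of its end. -/
theorem eq_of_end_mem_segment (h : TautPath F K N p q y) {i : ℕ} (hi : i < N)
    (hqi : q ∈ segment ℝ (y i) (y (i + 1))) {k : ℕ} (hik : i < k) (hk : k ≤ N) : y k = q := by
  have h1 := (h.H_le_of_mem_segment hi hqi).2
  have hN := h.runs.2.1
  have m1 := h.H_mono (show i + 1 ≤ k by omega) (by omega)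
  have m2 := h.H_mono hk le_rfl
  rw [hN] at m2
  have x1 := (h.X_le_of_mem_segment hi hqi).1 (by linarith)
  have n1 := h.X_anti (show i + 1 ≤ k by omega) (by omega) (by linarith)
  have n2 := h.X_anti hk le_rfl (by rw [hN]; linarith)
  rw [hN] at n2
  exact F.ext_coord (by linarith) (by linarith)

theorem eq_of_mem_segment_of_H_eq_zero (h : TautPath F K N p q y) {i : ℕ} (hi : i < N) {c : Plane}
    (hc : c ∈ segment ℝ (y i) (y (i + 1))) (hH : F.H c = 0) : c = p := by
  have h1 := (h.H_le_of_mem_segment hi hc).1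
  have h0 := h.H_nonneg (j := i) hi.le
  have hi0 : F.H (y i) = 0 := by linarith
  have hip := h.eq_of_H_eq_zero hi.le hi0
  rcases eq_or_lt_of_le (h.H_nonneg (j := i + 1) hi) with h2 | h2
  · have := h.eq_of_H_eq_zero (j := i + 1) hi h2.symm
    rw [hip, this, segment_same] at hc
    exact hc
  · rw [segment_eq_image_lineMap] at hc
    obtain ⟨t, ⟨ht0, ht1⟩, rfl⟩ := hc
    rw [F.H_lineMap, hi0] at hH
    have : t * F.H (y (i + 1)) = 0 := by linarith
    rw [(mul_eq_zero.1 this).resolve_right h2.ne', AffineMap.lineMap_apply_zero, hip]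

end TautPath

end BorderRegion

/-! ### Faces of a simplicial complex in the plane, and spokes. -/

namespace BorderRegion

open scoped Classical in
theorem exists_third {t : Finset Plane} (ht : t.card = 3) {a v : Plane} (ha : a ∈ t) (hv : v ∈ t)
    (hav : a ≠ v) : ∃ c, c ∈ t ∧ c ≠ a ∧ c ≠ v ∧ ∀ x ∈ t, x = a ∨ x = v ∨ x = c := by
  have h1 : ((t.erase a).erase v).card = 1 := by
    rw [Finset.card_erase_of_mem (Finset.mem_erase.2 ⟨hav.symm, hv⟩), Finset.card_erase_of_mem ha, ht]
  obtain ⟨c, hc⟩ := Finset.card_eq_one.1 h1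
  have hcm : c ∈ (t.erase a).erase v := by rw [hc]; exact Finset.mem_singleton_self c
  simp only [Finset.mem_erase] at hcm
  refine ⟨c, hcm.2.2, hcm.2.1, hcm.1, fun x hx => ?_⟩
  by_contra! hcon
  have : x ∈ (t.erase a).erase v := by simp [Finset.mem_erase, hcon, hx]
  rw [hc, Finset.mem_singleton] at this
  exact hcon.2.2 this

theorem le_of_mem_convexHull {φ : Plane →ᵃ[ℝ] ℝ} {s : Set Plane} {r : ℝ} (h : ∀ x ∈ s, φ x ≤ r)
    {z : Plane} (hz : z ∈ convexHull ℝ s) : φ z ≤ r :=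
  convexHull_min (t := φ ⁻¹' Set.Iic r) h ((convex_Iic r).affine_preimage φ) hz

theorem ge_of_mem_convexHull {φ : Plane →ᵃ[ℝ] ℝ} {s : Set Plane} {r : ℝ} (h : ∀ x ∈ s, r ≤ φ x)
    {z : Plane} (hz : z ∈ convexHull ℝ s) : r ≤ φ z :=
  convexHull_min (t := φ ⁻¹' Set.Ici r) h ((convex_Ici r).affine_preimage φ) hz

theorem convex_nonneg (φ : Plane →ᵃ[ℝ] ℝ) : Convex ℝ {z | 0 ≤ φ z} :=
  (convex_Ici (0 : ℝ)).affine_preimage φ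

/-- An affine function that is nonnegative on a set is positive in its interior. -/
theorem pos_of_mem_interior {φ : Plane →ᵃ[ℝ] ℝ} {S : Set Plane} (h : ∀ x ∈ S, 0 ≤ φ x) {c z : Plane}
    (hc : 0 < φ c) (hz : z ∈ interior S) : 0 < φ z := by
  -- A small step from `z` away from `c` stays in `S` and would make `φ` negative.
  by_contra! hle
  have hcont : Filter.Tendsto (fun ε : ℝ => AffineMap.lineMap z c (-ε)) (nhds 0) (nhds z) := by
    have : Continuous fun ε : ℝ => (AffineMap.lineMap z c (-ε) : Plane) :=
      AffineMap.lineMap_continuous.comp continuous_neg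
    simpa using this.tendsto 0
  have hev := hcont (mem_interior_iff_mem_nhds.1 hz)
  obtain ⟨δ, hδ, hball⟩ := Metric.mem_nhds_iff.1 hev
  have hmem : AffineMap.lineMap z c (-(δ / 2)) ∈ S := by
    apply hball
    rw [Metric.mem_ball, Real.dist_eq, sub_zero, abs_of_pos (by positivity)]
    linarith
  have := h _ hmem
  rw [AffineMap.apply_lineMap, AffineMap.lineMap_apply_module, smul_eq_mul, smul_eq_mul] at this
  nlinarith

section Faces

variable {T : Geometry.SimplicialComplex ℝ Plane}

theorem affineSpan_face {t : Finset Plane} (ht : t ∈ T.faces) (h3 : t.card = 3) :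
    affineSpan ℝ (Set.range ((↑) : t → Plane)) = ⊤ := by
  rw [(T.indep ht).affineSpan_eq_top_iff_card_eq_finrank_add_one]
  simp [h3]

/-- The barycentric coordinate of a vertex of a triangle. -/
theorem exists_coord {t : Finset Plane} (ht : t ∈ T.faces) (h3 : t.card = 3) {c : Plane}
    (hc : c ∈ t) : ∃ φ : Plane →ᵃ[ℝ] ℝ, φ c = 1 ∧ ∀ x ∈ t, x ≠ c → φ x = 0 := by
  obtain ⟨β, hβ⟩ : ∃ β : AffineBasis t ℝ Plane, ∀ x, β x = (x : Plane) :=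
    ⟨⟨(↑), T.indep ht, affineSpan_face ht h3⟩, fun _ => rfl⟩
  refine ⟨β.coord ⟨c, hc⟩, ?_, fun x hx hne => ?_⟩
  · have := β.coord_apply_eq ⟨c, hc⟩
    rwa [hβ] at this
  · have hne' : (⟨c, hc⟩ : t) ≠ ⟨x, hx⟩ := fun h => hne (congrArg Subtype.val h).symm
    have := β.coord_apply_ne hne'
    rwa [hβ] at this

theorem interior_face_nonempty {t : Finset Plane} (ht : t ∈ T.faces) (h3 : t.card = 3) :
    (interior (convexHull ℝ (t : Set Plane))).Nonempty := by
  rw [interior_convexHull_nonempty_iff_affineSpan_eq_top]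
  have := affineSpan_face ht h3
  simpa using this

/-- A point of a face in the interior of a triangle belongs to no other face than the triangle. -/
theorem subset_of_mem_interior {s t : Finset Plane} (hs : s ∈ T.faces) (ht : t ∈ T.faces)
    (h3 : t.card = 3) {z : Plane} (hz : z ∈ convexHull ℝ (s : Set Plane))
    (hzt : z ∈ interior (convexHull ℝ (t : Set Plane))) : t ⊆ s := by
  intro c hc
  by_contra hcs
  -- The barycentric coordinate of a vertex outside `s` is positive inside the triangle but vanishes
  -- on the common face.
  obtain ⟨φ, hφ1, hφ0⟩ := exists_coord ht h3 hc
  have hpos := pos_of_mem_interior (φ := φ) (S := convexHull ℝ (t : Set Plane)) (c := c)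
    (fun x hx => ge_of_mem_convexHull (fun y hy => by
      by_cases hyc : y = c
      · rw [hyc, hφ1]; norm_num
      · rw [hφ0 y hy hyc]) hx) (by rw [hφ1]; norm_num) hzt
  have hzi := T.inter_subset_convexHull hs ht ⟨hz, interior_subset hzt⟩
  have : φ z ≤ 0 := le_of_mem_convexHull (fun y hy => by
    rw [hφ0 y hy.2]
    rintro rfl
    exact hcs hy.1) hzi
  linarith

theorem notMem_interior_of_card_le {s t : Finset Plane} (hs : s ∈ T.faces) (ht : t ∈ T.faces)
    (h3 : t.card = 3) (h2 : s.card ≤ 2) {z : Plane} (hz : z ∈ convexHull ℝ (s : Set Plane)) :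
    z ∉ interior (convexHull ℝ (t : Set Plane)) := fun h => by
  have := Finset.card_le_card (subset_of_mem_interior hs ht h3 hz h)
  omega

open scoped Classical in
theorem pair_mem_faces {t : Finset Plane} (ht : t ∈ T.faces) {a v : Plane} (ha : a ∈ t) (hv : v ∈ t) :
    {a, v} ∈ T.faces :=
  T.down_closed ht (by intro x hx; simp at hx; rcases hx with rfl | rfl <;> assumption)
    ⟨a, by simp⟩

theorem singleton_mem_faces {t : Finset Plane} (ht : t ∈ T.faces) {a : Plane} (ha : a ∈ t) :
    {a} ∈ T.faces :=
  T.down_closed ht (by simpa using ha) ⟨a, by simp⟩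

theorem convexHull_coe_pair [DecidableEq Plane] (a v : Plane) :
    convexHull ℝ ((({a, v} : Finset Plane)) : Set Plane) = segment ℝ a v := by
  rw [Finset.coe_pair, convexHull_pair]

/-- The part of an edge of the triangulation above the line `H = 0`, from its foot `P` to its
upper end `v`. -/
def IsSpoke (T : Geometry.SimplicialComplex ℝ Plane) (F : Frame) (P v : Plane) : Prop :=
  F.H P = 0 ∧ 0 < F.H v ∧ ∃ x, F.H x < 0 ∧ P ∈ segment ℝ x v ∧
    (∃ e ∈ T.faces, (e : Set Plane) = {x, v}) ∧ ∀ s ∈ T.faces, ∀ z ∈ convexHull ℝ (s : Set Plane), z ∈ segment ℝ P v → v ∈ s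

-- A face without `v` can meet the edge only in its lower end `x`, which lies below the line and
-- thus not on the spoke.
open scoped Classical in
theorem IsSpoke.of_mem {F : Frame} {t : Finset Plane} (ht : t ∈ T.faces) {x v P : Plane} (hx : x ∈ t)
    (hv : v ∈ t) (hHx : F.H x < 0) (hHv : 0 < F.H v) (hP : P ∈ segment ℝ x v) (hHP : F.H P = 0) :
    IsSpoke T F P v := by
  refine ⟨hHP, hHv, x, hHx, hP, ⟨_, pair_mem_faces ht hx hv, by simp⟩,
    fun s hs z hz hzP => ?_⟩
  have hzx : z ∈ convexHull ℝ ((({x, v} : Finset Plane)) : Set Plane) := by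
    rw [convexHull_coe_pair]
    exact (convex_segment x v).segment_subset hP (right_mem_segment ℝ x v) hzP
  have hz0 : 0 ≤ F.H z := by
    have := (convex_nonneg F.H).segment_subset (show P ∈ _ from hHP.ge) (show v ∈ _ from hHv.le) hzP
    exact this
  have hzi := T.inter_subset_convexHull hs (pair_mem_faces ht hx hv) ⟨hz, hzx⟩
  by_contra hvs
  have : F.H z ≤ F.H x := le_of_mem_convexHull (fun y hy => by
    have h2 := hy.2
    simp only [Finset.coe_insert, Finset.coe_singleton, Set.mem_insert_iff,
      Set.mem_singleton_iff] at h2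
    rcases h2 with rfl | rfl
    · exact le_rfl
    · exact absurd hy.1 hvs) hzi
  linarith

end Faces

end BorderRegion

namespace BorderRegion

/-! ### Chains of triangles along a line and the points that they share. -/

variable {T : Geometry.SimplicialComplex ℝ Plane}

/-- Spokes with different upper ends are disjoint. -/
theorem IsSpoke.eq_of_mem {F : Frame} {P v P' v' z : Plane} (h : IsSpoke T F P v)
    (h' : IsSpoke T F P' v') (hz : z ∈ segment ℝ P v) (hz' : z ∈ segment ℝ P' v') : v = v' := by
  obtain ⟨hP, hv, x, hx, hPx, -, hall⟩ := h
  obtain ⟨hP', hv', x', hx', hPx', ⟨e, he, hee⟩, -⟩ := h'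
  have hze : z ∈ convexHull ℝ (e : Set Plane) := by
    rw [hee, convexHull_pair]
    exact (convex_segment x' v').segment_subset hPx' (right_mem_segment ℝ x' v') hz'
  have hve : v ∈ (e : Set Plane) := hall e he z hze hz
  rw [hee, Set.mem_insert_iff, Set.mem_singleton_iff] at hve
  rcases hve with rfl | h
  · linarith
  · exact h

/-- Two segments from the base line that have the same order at their feet and at a common height
above, in the opposite sense, meet. -/
theorem exists_common_point {F : Frame} {P v P' u : Plane} (hP : F.H P = 0) (hP' : F.H P' = 0)
    (hv : 0 < F.H v) (hvu : F.H v ≤ F.H u) (hfoot : F.X P' ≤ F.X P)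
    (htop : F.X v ≤ F.X (AffineMap.lineMap P' u (F.H v / F.H u) : Plane)) :
    ∃ z, z ∈ segment ℝ P v ∧ z ∈ segment ℝ P' u := by
  have hu : 0 < F.H u := by linarith
  set B := F.X (AffineMap.lineMap P' u (F.H v / F.H u) : Plane) with hB
  have hBe := F.X_lineMap P' u (F.H v / F.H u)
  rw [← hB] at hBe
  -- The horizontal distance of the two segments is affine in the height and does not keep its sign;
  -- `t` is a zero, as a fraction of the height of `v`.
  obtain ⟨t, ht0, ht1, ht⟩ : ∃ t : ℝ, 0 ≤ t ∧ t ≤ 1 ∧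
      (1 - t) * F.X P + t * F.X v = (1 - t) * F.X P' + t * B := by
    rcases eq_or_lt_of_le hfoot with he | hlt
    · exact ⟨0, le_rfl, zero_le_one, by rw [he]; ring⟩
    · have hden : 0 < (F.X P - F.X P') + (B - F.X v) := by linarith
      refine ⟨(F.X P - F.X P') / ((F.X P - F.X P') + (B - F.X v)), ?_, ?_, ?_⟩
      · exact div_nonneg (by linarith) hden.le
      · rw [div_le_one hden]; linarith
      · field_simp
        ring
  refine ⟨AffineMap.lineMap P v t, ?_, ?_⟩
  · rw [segment_eq_image_lineMap]
    exact ⟨t, ⟨ht0, ht1⟩, rfl⟩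
  · have e : (AffineMap.lineMap P v t : Plane) = AffineMap.lineMap P' u (t * (F.H v / F.H u)) := by
      apply F.ext_coord
      · rw [F.X_lineMap, F.X_lineMap, ht, hBe]
        ring
      · rw [F.H_lineMap, F.H_lineMap, hP, hP']
        field_simp
        ring
    rw [e, segment_eq_image_lineMap]
    refine ⟨_, ⟨by positivity, ?_⟩, rfl⟩
    have : F.H v / F.H u ≤ 1 := by rw [div_le_one hu]; exact hvu
    have h0 : 0 ≤ F.H v / F.H u := by positivity
    nlinarith

/-- A spoke between two spokes with the same upper end is lower than these. -/
theorem IsSpoke.lt_of_between {F : Frame} {P₁ P₂ P₃ v u : Plane} (h₁ : IsSpoke T F P₁ v)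
    (h₂ : IsSpoke T F P₂ u) (h₃ : IsSpoke T F P₃ v) (h21 : F.X P₂ ≤ F.X P₁)
    (h32 : F.X P₃ ≤ F.X P₂) : u = v ∨ F.H u < F.H v := by
  -- A middle spoke at least as high as `v` passes `v` on one side or through it, and so meets the
  -- outer spoke on that side. Spokes that meet have the same upper end.
  by_contra! hcon
  rcases le_total (F.X v) (F.X (AffineMap.lineMap P₂ u (F.H v / F.H u) : Plane)) with hle | hle
  · obtain ⟨z, hz1, hz2⟩ := exists_common_point h₁.1 h₂.1 h₁.2.1 hcon.2 h21 hle
    exact hcon.1 (h₂.eq_of_mem h₁ hz2 hz1)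
  · obtain ⟨z, hz1, hz2⟩ := exists_common_point (F := F.mirror) h₃.1 h₂.1 h₃.2.1 hcon.2
      (neg_le_neg h32) (neg_le_neg hle)
    exact hcon.1 (h₂.eq_of_mem h₃ hz2 hz1)

/-- The triangle with vertex set `s`. -/
abbrev hull (s : Finset Plane) : Set Plane := convexHull ℝ (s : Set Plane)

/-- The triangles `f 0, …, f M` of the triangulation are crossed by the segment from `p 0` to
`p (M + 1)` on the line `H = 0`, which passes from each one to the next at `p 1, …, p M`. -/
structure Chain (T : Geometry.SimplicialComplex ℝ Plane) (F : Frame) (f : ℕ → Finset Plane) (M : ℕ)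
    (p : ℕ → Plane) : Prop where
  face : ∀ i ≤ M, f i ∈ T.faces
  card : ∀ i ≤ M, (f i).card = 3
  level : ∀ i ≤ M + 1, F.H (p i) = 0
  anti : ∀ i ≤ M, F.X (p (i + 1)) < F.X (p i)
  east_mem : ∀ i ≤ M, p i ∈ hull (f i)
  west_mem : ∀ i ≤ M, p (i + 1) ∈ hull (f i)
  slice : ∀ i ≤ M, ∀ z ∈ hull (f i), F.H z = 0 → F.X (p (i + 1)) ≤ F.X z ∧ F.X z ≤ F.X (p i)
  not_vertex : ∀ i, 1 ≤ i → i ≤ M → {p i} ∉ T.faces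
  below : ∀ i ≤ M, ∃ x ∈ f i, F.H x < 0
  above : ∀ i ≤ M, ∃ x ∈ f i, 0 < F.H x

/-- The part of a triangle of the chain above the line `H = 0`. -/
def upper (F : Frame) (f : ℕ → Finset Plane) (i : ℕ) : Set Plane := hull (f i) ∩ {z | 0 ≤ F.H z}

namespace Chain

variable {F : Frame} {f : ℕ → Finset Plane} {M : ℕ} {p : ℕ → Plane}

/-- Run backwards, the chain has triangle `M - i` and dividing point `M + 1 - i` in place `i`. Each
statement about the west thereby yields its counterpart about the east. -/
theorem mirror (h : Chain T F f M p) :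
    Chain T F.mirror (fun i => f (M - i)) M (fun i => p (M + 1 - i)) where
  face i _ := h.face _ (by omega)
  card i _ := h.card _ (by omega)
  level i _ := h.level _ (by omega)
  anti i hi := by
    have := h.anti (M - i) (by omega)
    rw [show M - i + 1 = M + 1 - i by omega] at this
    rw [show M + 1 - (i + 1) = M - i by omega]
    simpa using this
  east_mem i hi := by
    rw [show M + 1 - i = M - i + 1 by omega]
    exact h.west_mem (M - i) (by omega)
  west_mem i hi := by
    rw [show M + 1 - (i + 1) = M - i by omega]
    exact h.east_mem (M - i) (by omega)
  slice i hi z hz hH := by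
    have := h.slice (M - i) (by omega) z hz hH
    rw [show M + 1 - (i + 1) = M - i by omega, show M + 1 - i = M - i + 1 by omega]
    simpa using this.symm
  not_vertex i h1 hi := h.not_vertex _ (by omega) (by omega)
  below i hi := h.below _ (by omega)
  above i hi := h.above _ (by omega)

theorem X_anti (h : Chain T F f M p) {i j : ℕ} (hij : i ≤ j) (hj : j ≤ M + 1) :
    F.X (p j) ≤ F.X (p i) := by
  induction j, hij using Nat.le_induction with
  | base => exact le_rfl
  | succ j hij ih => exact (h.anti j (by omega)).le.trans (ih (by omega))

theorem X_lt (h : Chain T F f M p) {i j : ℕ} (hij : i < j) (hj : j ≤ M + 1) :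
    F.X (p j) < F.X (p i) :=
  (h.X_anti (show i + 1 ≤ j by omega) hj).trans_lt (h.anti i (by omega))

/-- On the line `H = 0` only successive triangles meet. -/
theorem eq_of_level (h : Chain T F f M p) {i j : ℕ} (hij : i < j) (hj : j ≤ M) {z : Plane}
    (hi : z ∈ hull (f i)) (hz : z ∈ hull (f j)) (hH : F.H z = 0) : j = i + 1 ∧ z = p j := by
  have h1 := (h.slice i (by omega) z hi hH).1
  have h2 := (h.slice j hj z hz hH).2
  have h3 : j = i + 1 := by
    by_contra hne
    have := h.X_lt (show i + 1 < j by omega) (by omega)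
    linarith
  subst h3
  exact ⟨rfl, F.ext_coord (by linarith) (by rw [hH, h.level _ (by omega)])⟩

theorem face_ne (h : Chain T F f M p) {i j : ℕ} (hij : i < j) (hj : j ≤ M) : f i ≠ f j := by
  intro he
  have h1 := h.slice i (by omega) (p (j + 1)) (he ▸ h.west_mem j hj) (h.level _ (by omega))
  have h2 := h.X_lt (show i + 1 < j + 1 by omega) (by omega)
  linarith [h1.1]

/-- Successive triangles share an edge that crosses the line `H = 0`. -/
theorem exists_portal (h : Chain T F f M p) {i : ℕ} (hi : i < M) : ∃ a v, F.H a < 0 ∧ 0 < F.H v ∧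
    a ∈ f i ∧ v ∈ f i ∧ a ∈ f (i + 1) ∧ v ∈ f (i + 1) ∧
    hull (f i) ∩ hull (f (i + 1)) = segment ℝ a v ∧ p (i + 1) ∈ segment ℝ a v := by
  classical
  -- The common vertices span the common face. There are not three, as the triangles differ, not
  -- none, as `p (i + 1)` is common, and not one, as `p (i + 1)` is no vertex.
  set g := f i ∩ f (i + 1) with hg
  have hint : hull (f i) ∩ hull (f (i + 1)) = convexHull ℝ (g : Set Plane) := by
    rw [T.convexHull_inter_convexHull (h.face i (by omega)) (h.face (i + 1) (by omega)), hg,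
      Finset.coe_inter]
  have hpg : p (i + 1) ∈ convexHull ℝ (g : Set Plane) := by
    rw [← hint]
    exact ⟨h.west_mem i (by omega), h.east_mem (i + 1) (by omega)⟩
  have hg3 : g.card ≠ 3 := by
    intro h3
    have e1 : g = f i := Finset.eq_of_subset_of_card_le Finset.inter_subset_left
      (by rw [h3, h.card i (by omega)])
    have e2 : g = f (i + 1) := Finset.eq_of_subset_of_card_le Finset.inter_subset_right
      (by rw [h3, h.card (i + 1) (by omega)])
    exact h.face_ne (show i < i + 1 by omega) (by omega) (e1.symm.trans e2)
  have hgle : g.card ≤ 3 := by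
    rw [← h.card i (by omega)]
    exact Finset.card_le_card Finset.inter_subset_left
  have hg0 : g.card ≠ 0 := by
    intro h0
    rw [Finset.card_eq_zero.1 h0] at hpg
    simp at hpg
  have hg1 : g.card ≠ 1 := by
    intro h1
    obtain ⟨a, ha⟩ := Finset.card_eq_one.1 h1
    rw [ha] at hpg
    simp only [Finset.coe_singleton, convexHull_singleton, Set.mem_singleton_iff] at hpg
    have haf : a ∈ f i := Finset.inter_subset_left (by rw [← hg, ha]; simp)
    exact h.not_vertex (i + 1) (by omega) (by omega)
      (hpg ▸ singleton_mem_faces (h.face i (by omega)) haf)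
  obtain ⟨a, v, hav, hge⟩ := Finset.card_eq_two.1 (by omega : g.card = 2)
  have key : ∀ a v : Plane, g = {a, v} → F.H a ≤ F.H v → ∃ a v, F.H a < 0 ∧ 0 < F.H v ∧
      a ∈ f i ∧ v ∈ f i ∧ a ∈ f (i + 1) ∧ v ∈ f (i + 1) ∧
      hull (f i) ∩ hull (f (i + 1)) = segment ℝ a v ∧ p (i + 1) ∈ segment ℝ a v := by
    intro a v hge hle
    have ha : a ∈ f i ∩ f (i + 1) := by rw [← hg, hge]; simp
    have hv : v ∈ f i ∩ f (i + 1) := by rw [← hg, hge]; simp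
    rw [Finset.mem_inter] at ha hv
    -- A common vertex on the line would be `p (i + 1)`. So the ends of the shared edge lie strictly
    -- on different sides.
    have hnz : ∀ u, u ∈ f i → u ∈ f (i + 1) → F.H u ≠ 0 := by
      intro u hu1 hu2 hu0
      have := (h.eq_of_level (show i < i + 1 by omega) (by omega) (subset_convexHull ℝ _ hu1)
        (subset_convexHull ℝ _ hu2) hu0).2
      exact h.not_vertex (i + 1) (by omega) (by omega)
        (this ▸ singleton_mem_faces (h.face i (by omega)) hu1)
    rw [hge, convexHull_coe_pair] at hpg hint
    have hp0 := h.level (i + 1) (by omega)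
    obtain ⟨t, ⟨ht0, ht1⟩, hte⟩ := (segment_eq_image_lineMap ℝ a v).subset hpg
    rw [← hte, F.H_lineMap] at hp0
    have hHa : F.H a < 0 := by
      refine lt_of_le_of_ne ?_ (hnz a ha.1 ha.2)
      by_contra! hpos
      nlinarith
    have hHv : 0 < F.H v := by
      refine lt_of_le_of_ne ?_ (hnz v hv.1 hv.2).symm
      by_contra! hneg
      nlinarith
    exact ⟨a, v, hHa, hHv, ha.1, hv.1, ha.2, hv.2, hint, hpg⟩
  rcases le_total (F.H a) (F.H v) with hle | hle
  · exact key a v hge hle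
  · exact key v a (by rw [hge, Finset.pair_comm]) hle

/-- A triangle of the chain lies west of the portal through which it is entered. -/
theorem west (h : Chain T F f M p) {i : ℕ} (hi : i < M) {z z' : Plane} (hz : z ∈ hull (f i))
    (hz1 : z ∈ hull (f (i + 1))) (hz' : z' ∈ hull (f (i + 1))) (hH : F.H z' = F.H z) :
    F.X z' ≤ F.X z := by
  obtain ⟨a, v, ha, hv, -, -, ha1, hv1, hseg, hp⟩ := h.exists_portal hi
  -- `φ` is constant along the portal. The third vertex is on its western side, since otherwise the
  -- exit point `p (i + 2)` could not belong to the triangle.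
  set φ : Plane →ᵃ[ℝ] ℝ := (F.H v - F.H a) • F.X - (F.X v - F.X a) • F.H with hφ
  have hφz : ∀ u, φ u = (F.H v - F.H a) * F.X u - (F.X v - F.X a) * F.H u := fun u => by
    simp [hφ]
  have hφv : φ v = φ a := by rw [hφz, hφz]; ring
  have hconst : ∀ u ∈ segment ℝ a v, φ u = φ a := by
    intro u hu
    rw [← convexHull_pair] at hu
    refine le_antisymm (le_of_mem_convexHull ?_ hu) (ge_of_mem_convexHull ?_ hu)
    · rintro x (rfl | rfl)
      · exact le_rfl
      · exact hφv.le
    · rintro x (rfl | rfl)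
      · exact le_rfl
      · exact hφv.ge
  have hav : a ≠ v := by rintro rfl; linarith
  obtain ⟨c, hc, -, -, hcall⟩ := exists_third (h.card (i + 1) (by omega)) ha1 hv1 hav
  have hφp : φ (p (i + 2)) < φ a := by
    rw [← hconst _ hp, hφz, hφz, h.level (i + 2) (by omega), h.level (i + 1) (by omega)]
    have := h.anti (i + 1) (by omega)
    nlinarith
  have hφc : φ c < φ a := by
    by_contra! hge
    have := ge_of_mem_convexHull (φ := φ) (r := φ a) (fun x hx => by
      rcases hcall x hx with rfl | rfl | rfl
      · exact le_rfl
      · exact hφv.ge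
      · exact hge) (h.west_mem (i + 1) (by omega))
    linarith
  have hle : φ z' ≤ φ a := le_of_mem_convexHull (fun x hx => by
      rcases hcall x hx with rfl | rfl | rfl
      · exact le_rfl
      · exact hφv.le
      · exact hφc.le) hz'
  rw [← hconst z (hseg ▸ ⟨hz, hz1⟩), hφz, hφz, hH] at hle
  nlinarith

/-- A triangle of the chain lies east of the portal through which it is left. -/
theorem east (h : Chain T F f M p) {i : ℕ} (hi : i < M) {z z' : Plane} (hz : z ∈ hull (f i))
    (hz1 : z ∈ hull (f (i + 1))) (hz' : z' ∈ hull (f i)) (hH : F.H z' = F.H z) :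
    F.X z ≤ F.X z' := by
  have := h.mirror.west (i := M - (i + 1)) (z := z) (z' := z') (by omega)
    (by rw [show M - (M - (i + 1)) = i + 1 by omega]; exact hz1)
    (by rw [show M - (M - (i + 1) + 1) = i by omega]; exact hz)
    (by rw [show M - (M - (i + 1) + 1) = i by omega]; exact hz') hH
  simpa using this

/-- Shared edges cross the line and so rise from it as portals, and triangles two places apart do
not meet on the line. This makes the results on shortest paths applicable. -/
theorem strip (h : Chain T F f M p) {N : ℕ} (hN : N ≤ M + 1) : Strip F (upper F f) N (p 0) where
  convex j _ := (convex_convexHull ℝ _).inter (convex_nonneg F.H)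
  nonneg j _ z hz := hz.2
  base := h.level 0 (by omega)
  portal_low j hj :=
    have h0 : F.H (p (j + 1)) = 0 := h.level (j + 1) (by omega)
    ⟨p (j + 1), ⟨⟨h.west_mem j (by omega), h0.ge⟩, ⟨h.east_mem (j + 1) (by omega), h0.ge⟩⟩, h0⟩
  portal_high j hj := by
    obtain ⟨a, v, -, hv, -, hv0, -, hv1, -⟩ := h.exists_portal (i := j) (by omega)
    exact ⟨v, ⟨⟨subset_convexHull ℝ _ hv0, hv.le⟩, ⟨subset_convexHull ℝ _ hv1, hv.le⟩⟩, hv⟩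
  west j hj z hz z' hz' hH := h.west (by omega) hz.1.1 hz.2.1 hz'.1 hH
  east j hj z hz z' hz' hH := h.east (by omega) hz.1.1 hz.2.1 hz'.1 hH
  sep j hj z hz _ hz2 := by
    refine lt_of_le_of_ne hz.2 fun h0 => ?_
    have := (h.eq_of_level (show j < j + 2 by omega) (by omega) hz.1 hz2.1 h0.symm).1
    omega

/-- Each vertex of a triangle of the chain above the line is the upper end of a spoke. -/
theorem exists_spoke (h : Chain T F f M p) {i : ℕ} (hi : i ≤ M) {v : Plane} (hv : v ∈ f i)
    (hH : 0 < F.H v) : ∃ P, IsSpoke T F P v ∧ F.X (p (i + 1)) ≤ F.X P ∧ F.X P ≤ F.X (p i) := by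
  obtain ⟨x, hx, hxH⟩ := h.below i hi
  obtain ⟨P, hP, hP0⟩ := F.exists_mem_segment (z := x) (z' := v) hxH.le hH.le
  have hPm : P ∈ hull (f i) := segment_subset_convexHull hx hv hP
  have := h.slice i hi P hPm hP0
  exact ⟨P, IsSpoke.of_mem (h.face i hi) hx hv hxH hH hP hP0, this⟩

/-- The common vertices of two triangles that are not successive lie above the line if the triangles
have a common point above the line. -/
theorem pos_of_common (h : Chain T F f M p) {i j : ℕ} (hij : i + 1 < j) (hj : j ≤ M) {c v : Plane}
    (hci : c ∈ hull (f i)) (hcj : c ∈ hull (f j)) (hc : 0 ≤ F.H c) (hvi : v ∈ f i) (hvj : v ∈ f j) :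
    0 < F.H v := by
  -- Otherwise the segment from `v` to `c` has a point on the line, common to both triangles.
  by_contra! hv
  obtain ⟨z, hz, hz0⟩ := F.exists_mem_segment hv hc
  have h1 := (convex_convexHull ℝ _).segment_subset (subset_convexHull ℝ _ hvi) hci hz
  have h2 := (convex_convexHull ℝ _).segment_subset (subset_convexHull ℝ _ hvj) hcj hz
  have := (h.eq_of_level (show i < j by omega) hj h1 h2 hz0).1
  omega

end Chain

/-- The triangle `f m` of a chain has the edge `l r` above the line and a vertex below. -/
structure ChainMiddle (T : Geometry.SimplicialComplex ℝ Plane) (F : Frame) (f : ℕ → Finset Plane)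
    (M : ℕ) (p : ℕ → Plane) (m : ℕ) (r l x : Plane) : Prop where
  chain : Chain T F f M p
  le : m ≤ M
  mem_r : r ∈ f m
  mem_l : l ∈ f m
  mem_x : x ∈ f m
  ne : r ≠ l
  eq_or : ∀ z ∈ f m, z = r ∨ z = l ∨ z = x
  below : F.H x < 0
  r_nonneg : 0 ≤ F.H r
  l_nonneg : 0 ≤ F.H l
  east_foot : p m ∈ segment ℝ x r
  west_foot : p (m + 1) ∈ segment ℝ x l

namespace ChainMiddle

variable {F : Frame} {f : ℕ → Finset Plane} {M : ℕ} {p : ℕ → Plane} {m : ℕ} {r l x : Plane}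

theorem mirror (h : ChainMiddle T F f M p m r l x) :
    ChainMiddle T F.mirror (fun i => f (M - i)) M (fun i => p (M + 1 - i)) (M - m) l r x where
  chain := h.chain.mirror
  le := by omega
  mem_r := by rw [show M - (M - m) = m by have := h.le; omega]; exact h.mem_l
  mem_l := by rw [show M - (M - m) = m by have := h.le; omega]; exact h.mem_r
  mem_x := by rw [show M - (M - m) = m by have := h.le; omega]; exact h.mem_x
  ne := h.ne.symm
  eq_or z hz := by
    rw [show M - (M - m) = m by have := h.le; omega] at hz
    have := h.eq_or z hz
    tauto
  below := h.below
  r_nonneg := h.l_nonneg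
  l_nonneg := h.r_nonneg
  east_foot := by rw [show M + 1 - (M - m) = m + 1 by have := h.le; omega]; exact h.west_foot
  west_foot := by rw [show M + 1 - (M - m + 1) = m by have := h.le; omega]; exact h.east_foot

theorem spoke_r (h : ChainMiddle T F f M p m r l x) (hr : 0 < F.H r) : IsSpoke T F (p m) r :=
  IsSpoke.of_mem (h.chain.face m h.le) h.mem_x h.mem_r h.below hr h.east_foot
    (h.chain.level m (by have := h.le; omega))

theorem spoke_l (h : ChainMiddle T F f M p m r l x) (hl : 0 < F.H l) : IsSpoke T F (p (m + 1)) l :=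
  IsSpoke.of_mem (h.chain.face m h.le) h.mem_x h.mem_l h.below hl h.west_foot
    (h.chain.level (m + 1) (by have := h.le; omega))

/-- A point `r` on the line is itself the eastern foot `p m`, and the inner dividing points are no
vertices. -/
theorem r_eq (h : ChainMiddle T F f M p m r l x) (hr : F.H r = 0) : r = p 0 ∧ m = 0 := by
  have hpr : p m = r := by
    obtain ⟨t, -, ht⟩ := (segment_eq_image_lineMap ℝ x r).subset h.east_foot
    have h0 := h.chain.level m (by have := h.le; omega)
    rw [← ht, F.H_lineMap, hr] at h0
    have hb := h.below
    have : (1 - t) * F.H x = 0 := by linarith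
    have ht1 : t = 1 := by
      rcases mul_eq_zero.1 this with h1 | h1 <;> linarith
    rw [← ht, ht1, AffineMap.lineMap_apply_one]
  have hm : m = 0 := by
    by_contra hm
    refine h.chain.not_vertex m (by omega) h.le ?_
    rw [hpr]
    exact singleton_mem_faces (h.chain.face m h.le) h.mem_r
  exact ⟨by rw [← hpr, hm], hm⟩

/-- A triangle east of the middle triangle meets it only in `r` below the height of `r`, unless the
two triangles are successive. -/
theorem eq_r (h : ChainMiddle T F f M p m r l x) {i : ℕ} (hi : i + 1 < m) {c : Plane}
    (hci : c ∈ hull (f i)) (hcm : c ∈ hull (f m)) (hc : 0 ≤ F.H c) (hcr : F.H c ≤ F.H r) :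
    c = r := by
  have hm := h.le
  have hcg := T.inter_subset_convexHull (h.chain.face i (by omega)) (h.chain.face m hm) ⟨hci, hcm⟩
  have hpos : ∀ v, v ∈ f i → v ∈ f m → 0 < F.H v := fun v h1 h2 =>
    h.chain.pos_of_common hi hm hci hcm hc h1 h2
  -- `x` is below the line and hence not shared. If `l` is shared, the spoke of `r` lies between two
  -- spokes of `l`, so `r` is lower than `l` and is the only point of the edge `r l` at its height
  -- or below.
  by_cases hl : l ∈ f i
  · have hlpos := hpos l hl h.mem_l
    have hsub : (f i ∩ f m : Set Plane) ⊆ {r, l} := by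
      rintro v ⟨h1, h2⟩
      rcases h.eq_or v h2 with rfl | rfl | rfl
      · simp
      · simp
      · have := hpos v h1 h2
        linarith [h.below]
    have hseg := convexHull_mono hsub hcg
    rw [convexHull_pair] at hseg
    have hcne : F.H c ≠ 0 := fun h0 => by
      have := (h.chain.eq_of_level (show i < m by omega) hm hci hcm h0).1
      omega
    have hcpos : 0 < F.H c := lt_of_le_of_ne hc hcne.symm
    obtain ⟨P, hP, hP1, -⟩ := h.chain.exists_spoke (by omega) hl hlpos
    have hX : F.X (p m) ≤ F.X (p (i + 1)) := h.chain.X_anti (by omega) (by omega)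
    have hX2 := (h.chain.anti m hm).le
    rcases hP.lt_of_between (h.spoke_r (by linarith)) (h.spoke_l hlpos) (by linarith) hX2 with
      he | hlt
    · exact absurd he h.ne
    · obtain ⟨t, ⟨ht0, ht1⟩, rfl⟩ := (segment_eq_image_lineMap ℝ r l).subset hseg
      rw [F.H_lineMap] at hcr
      have ht : t = 0 := by
        by_contra hne
        have : 0 < t := lt_of_le_of_ne ht0 (Ne.symm hne)
        nlinarith
      rw [ht, AffineMap.lineMap_apply_zero]
  · have hsub : (f i ∩ f m : Set Plane) ⊆ {r} := by
      rintro v ⟨h1, h2⟩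
      rcases h.eq_or v h2 with rfl | rfl | rfl
      · simp
      · exact absurd h1 hl
      · have := hpos v h1 h2
        linarith [h.below]
    have := convexHull_mono hsub hcg
    rwa [convexHull_singleton] at this

/-- Triangles on different sides of the middle triangle have no common point above the line below the
heights of both `r` and `l`. -/
theorem not_common (h : ChainMiddle T F f M p m r l x) {i k : ℕ} (hi : i < m) (hk : m < k)
    (hkM : k ≤ M) {c : Plane} (hci : c ∈ hull (f i)) (hck : c ∈ hull (f k)) (hc : 0 ≤ F.H c)
    (hcr : F.H c ≤ F.H r) (hcl : F.H c ≤ F.H l) : False := by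
  have hcg := T.inter_subset_convexHull (h.chain.face i (by omega)) (h.chain.face k hkM) ⟨hci, hck⟩
  -- The common face has a vertex `v` no higher than `c`. It has spokes on both sides of the middle
  -- triangle, so `r` and `l`, not being lower than `v`, both equal it.
  obtain ⟨v, ⟨hvi, hvk⟩, hvc⟩ : ∃ v ∈ (f i ∩ f k : Set Plane), F.H v ≤ F.H c := by
    by_contra! hcon
    have hconv : Convex ℝ {z | F.H c < F.H z} := (convex_Ioi (F.H c)).affine_preimage F.H
    exact lt_irrefl (F.H c) (convexHull_min hcon hconv hcg)
  have hv := h.chain.pos_of_common (show i + 1 < k by omega) hkM hci hck hc hvi hvk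
  obtain ⟨P, hP, hP1, -⟩ := h.chain.exists_spoke (by omega) hvi hv
  obtain ⟨P', hP', -, hP2⟩ := h.chain.exists_spoke hkM hvk hv
  have X1 : F.X (p m) ≤ F.X (p (i + 1)) := h.chain.X_anti (by omega) (by omega)
  have X2 : F.X (p k) ≤ F.X (p (m + 1)) := h.chain.X_anti (by omega) (by omega)
  have X3 := (h.chain.anti m (by omega)).le
  have e1 : r = v := (hP.lt_of_between (h.spoke_r (by linarith)) hP' (by linarith)
    (by linarith)).resolve_right (by linarith)
  have e2 : l = v := (hP.lt_of_between (h.spoke_l (by linarith)) hP' (by linarith)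
    (by linarith)).resolve_right (by linarith)
  exact h.ne (e1.trans e2.symm)

end ChainMiddle

end BorderRegion

/-! ### The boundary curve of the hourglass, cut into sheets along the chain. -/

namespace BorderRegion

variable {T : Geometry.SimplicialComplex ℝ Plane}

theorem HasLog.mono {q : Plane} {A A' : Set Plane} (h : HasLog q A) (hA : A' ⊆ A) : HasLog q A' := by
  obtain ⟨f, hf, he⟩ := h
  exact ⟨f, hf.mono hA, fun z hz => he z (hA hz)⟩

theorem trace_eq (N : ℕ) (y : ℕ → Plane) :
    trace N y = ⋃ j : Fin N, segment ℝ (y j) (y (j + 1)) := by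
  ext z
  simp only [trace, Set.mem_ofPred_eq, Set.mem_iUnion]
  exact ⟨fun ⟨j, hj, hz⟩ => ⟨⟨j, hj⟩, hz⟩, fun ⟨j, hz⟩ => ⟨j, j.2, hz⟩⟩

theorem isCompact_segment (a b : Plane) : IsCompact (segment ℝ a b) := by
  rw [segment_eq_image_lineMap]
  exact isCompact_Icc.image AffineMap.lineMap_continuous

theorem isCompact_trace (N : ℕ) (y : ℕ → Plane) : IsCompact (trace N y) := by
  rw [trace_eq]
  exact isCompact_iUnion fun j => isCompact_segment _ _

theorem isPreconnected_segment (a b : Plane) : IsPreconnected (segment ℝ a b) :=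
  (convex_segment a b).isPreconnected

theorem left_mem_trace (N : ℕ) (y : ℕ → Plane) : y 0 ∈ trace (N + 1) y :=
  ⟨0, by omega, left_mem_segment ℝ _ _⟩

theorem right_mem_trace (N : ℕ) (y : ℕ → Plane) : y (N + 1) ∈ trace (N + 1) y :=
  ⟨N, by omega, right_mem_segment ℝ _ _⟩

theorem isPreconnected_trace (N : ℕ) (y : ℕ → Plane) : IsPreconnected (trace (N + 1) y) := by
  induction N with
  | zero =>
    have : trace (0 + 1) y = segment ℝ (y 0) (y 1) := by
      ext z
      constructor
      · rintro ⟨j, hj, hz⟩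
        obtain rfl : j = 0 := by omega
        exact hz
      · exact fun hz => ⟨0, by omega, hz⟩
    rw [this]
    exact isPreconnected_segment _ _
  | succ N ih =>
    have : trace (N + 1 + 1) y = trace (N + 1) y ∪ segment ℝ (y (N + 1)) (y (N + 1 + 1)) := by
      ext z
      constructor
      · rintro ⟨j, hj, hz⟩
        rcases Nat.lt_or_ge j (N + 1) with h | h
        · exact Or.inl ⟨j, h, hz⟩
        · obtain rfl : j = N + 1 := by omega
          exact Or.inr hz
      · rintro (⟨j, hj, hz⟩ | hz)
        · exact ⟨j, by omega, hz⟩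
        · exact ⟨N + 1, by omega, hz⟩
    rw [this]
    exact IsPreconnected.union (y (N + 1)) (right_mem_trace N y) (left_mem_segment ℝ _ _) ih
      (isPreconnected_segment _ _)

namespace Frame

variable (F : Frame)

theorem eq_lineMap_of_level {a b z : Plane} {s : ℝ} (ha : F.H a = s) (hb : F.H b = s) (hz : F.H z = s)
    (hab : F.X a < F.X b) : z = AffineMap.lineMap a b ((F.X z - F.X a) / (F.X b - F.X a)) := by
  have : F.X b - F.X a ≠ 0 := by linarith
  apply F.ext_coord
  · rw [F.X_lineMap]
    field_simp
    ring
  · rw [F.H_lineMap, ha, hb, hz]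
    ring

theorem mem_segment_of_level {a b z : Plane} {s : ℝ} (ha : F.H a = s) (hb : F.H b = s) (hz : F.H z = s)
    (hab : F.X a < F.X b) (h1 : F.X a ≤ F.X z) (h2 : F.X z ≤ F.X b) : z ∈ segment ℝ a b := by
  rw [F.eq_lineMap_of_level ha hb hz hab, segment_eq_image_lineMap]
  refine ⟨_, ⟨div_nonneg (by linarith) (by linarith), ?_⟩, rfl⟩
  rw [div_le_one (by linarith)]
  linarith

theorem mem_openSegment_of_level {a b z : Plane} {s : ℝ} (ha : F.H a = s) (hb : F.H b = s)
    (hz : F.H z = s) (h1 : F.X a < F.X z) (h2 : F.X z < F.X b) : z ∈ openSegment ℝ a b := by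
  rw [F.eq_lineMap_of_level ha hb hz (h1.trans h2), openSegment_eq_image_lineMap]
  refine ⟨_, ⟨div_pos (by linarith) (by linarith), ?_⟩, rfl⟩
  rw [div_lt_one (by linarith)]
  linarith

theorem level_of_mem_segment {a b z : Plane} (ha : F.H a = 0) (hb : F.H b = 0)
    (hz : z ∈ segment ℝ a b) : F.H z = 0 := by
  obtain ⟨t, -, rfl⟩ := (segment_eq_image_lineMap ℝ a b).subset hz
  rw [F.H_lineMap, ha, hb]
  ring

theorem X_of_mem_openSegment {a b z : Plane} (hab : F.X a < F.X b) (hz : z ∈ openSegment ℝ a b) :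
    F.X a < F.X z ∧ F.X z < F.X b := by
  obtain ⟨t, ⟨h0, h1⟩, rfl⟩ := (openSegment_eq_image_lineMap ℝ a b).subset hz
  rw [F.X_lineMap]
  constructor <;> nlinarith

end Frame

namespace Chain

variable {F : Frame} {f : ℕ → Finset Plane} {M : ℕ} {p : ℕ → Plane}

/-- The triangles of the chain cover the base segment. -/
theorem exists_mem_of_mem_base (h : Chain T F f M p) {z : Plane}
    (hz : z ∈ segment ℝ (p (M + 1)) (p 0)) : ∃ i ≤ M, z ∈ hull (f i) := by
  have hX0 := h.X_lt (show 0 < M + 1 by omega) le_rfl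
  have hH := F.level_of_mem_segment (h.level _ le_rfl) (h.level 0 (by omega)) hz
  have hXz : F.X (p (M + 1)) ≤ F.X z ∧ F.X z ≤ F.X (p 0) := by
    obtain ⟨t, ⟨h0, h1⟩, rfl⟩ := (segment_eq_image_lineMap ℝ _ _).subset hz
    rw [F.X_lineMap]
    constructor <;> nlinarith
  have hex : ∃ i, i ≤ M ∧ F.X (p (i + 1)) ≤ F.X z ∧ F.X z ≤ F.X (p i) := by
    by_contra! hcon
    have : ∀ i, i ≤ M + 1 → F.X z ≤ F.X (p i) := by
      intro i
      induction i with
      | zero => exact fun _ => hXz.2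
      | succ i ih =>
        intro hi
        by_contra! hlt
        have := hcon i (by omega) hlt.le
        linarith [ih (by omega)]
    have h1 := this M (by omega)
    have h2 := hcon M le_rfl hXz.1
    linarith
  obtain ⟨i, hi, h1, h2⟩ := hex
  refine ⟨i, hi, ?_⟩
  exact (convex_convexHull ℝ _).segment_subset (h.west_mem i hi) (h.east_mem i hi)
    (F.mem_segment_of_level (h.level _ (by omega)) (h.level i (by omega)) hH (h.anti i hi) h1 h2)

open scoped Classical in
/-- The portals remain connected when a point of an edge is removed that does not cross the base. -/
theorem isPreconnected_portal_diff (h : Chain T F f M p) {i : ℕ} (hi : i < M) {e : Finset Plane}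
    (he : e ∈ T.faces) {q : Plane} (hq : q ∈ hull e)
    (hdis : Disjoint (hull e) (openSegment ℝ (p (M + 1)) (p 0))) :
    IsPreconnected ((upper F f i ∩ upper F f (i + 1)) \ {q}) := by
  have hconv : Convex ℝ (upper F f i ∩ upper F f (i + 1)) :=
    ((convex_convexHull ℝ _).inter (convex_nonneg F.H)).inter
      ((convex_convexHull ℝ _).inter (convex_nonneg F.H))
  by_cases hqE : q ∈ upper F f i ∩ upper F f (i + 1)
  swap
  · rw [Set.sdiff_singleton_eq_self hqE]
    exact hconv.isPreconnected
  obtain ⟨a, v, ha, hv, ha0, hv0, ha1, hv1, hseg, hp⟩ := h.exists_portal hi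
  have hqs : q ∈ convexHull ℝ ((({a, v} : Finset Plane)) : Set Plane) := by
    rw [convexHull_coe_pair, ← hseg]
    exact ⟨hqE.1.1, hqE.2.1⟩
  have hqi := T.inter_subset_convexHull he (pair_mem_faces (h.face i (by omega)) ha0 hv0) ⟨hq, hqs⟩
  have hqH : 0 ≤ F.H q := hqE.1.2
  -- Without `v`, the common face of `e` and the edge `a v` would consist of `a` at most, below the
  -- line.
  have hvE : v ∈ e := by
    by_contra hve
    have : F.H q ≤ F.H a := le_of_mem_convexHull (fun u hu => by
      have h2 := hu.2
      simp only [Finset.coe_insert, Finset.coe_singleton, Set.mem_insert_iff,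
        Set.mem_singleton_iff] at h2
      rcases h2 with rfl | rfl
      · exact le_rfl
      · exact absurd hu.1 hve) hqi
    linarith
  -- With both ends in `e`, the point `p (i + 1)` of the open base would be on `e`.
  have haE : a ∉ e := by
    intro hae
    refine Set.disjoint_left.1 hdis (segment_subset_convexHull hae hvE hp) ?_
    exact F.mem_openSegment_of_level (h.level _ le_rfl) (h.level 0 (by omega))
      (h.level (i + 1) (by omega)) (h.X_lt (by omega) le_rfl) (h.X_lt (by omega) (by omega))
  have hqv : q = v := by
    have hsub : (e ∩ (({a, v} : Finset Plane) : Set Plane) : Set Plane) ⊆ {v} := by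
      intro u hu
      have h2 := hu.2
      simp only [Finset.coe_insert, Finset.coe_singleton, Set.mem_insert_iff,
        Set.mem_singleton_iff] at h2
      rcases h2 with rfl | rfl
      · exact absurd hu.1 haE
      · rfl
    have := convexHull_mono hsub hqi
    rwa [convexHull_singleton] at this
  -- So only the upper end of the portal is removed, and what remains is convex.
  have heq : (upper F f i ∩ upper F f (i + 1)) \ {q} =
      (upper F f i ∩ upper F f (i + 1)) ∩ {z | F.H z < F.H v} := by
    ext z
    simp only [Set.mem_sdiff, Set.mem_singleton_iff, Set.mem_inter_iff, Set.mem_ofPred_eq, and_congr_right_iff]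
    intro hz
    have hzs : z ∈ segment ℝ a v := hseg ▸ ⟨hz.1.1, hz.2.1⟩
    obtain ⟨t, ⟨h0, h1⟩, rfl⟩ := (segment_eq_image_lineMap ℝ _ _).subset hzs
    rw [F.H_lineMap, hqv]
    constructor
    · intro hne
      have : t ≠ 1 := fun h1 => hne (by rw [h1, AffineMap.lineMap_apply_one])
      have : t < 1 := lt_of_le_of_ne h1 this
      nlinarith
    · intro hlt he
      have := congrArg F.H he
      rw [F.H_lineMap] at this
      linarith
  rw [heq]
  exact (hconv.inter ((convex_Iio (F.H v)).affine_preimage F.H)).isPreconnected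

end Chain

/-- A chain of triangles with its middle triangle, and the two shortest paths in it from the ends of
the base to the edge of the middle triangle above the base. -/
structure TautPair (T : Geometry.SimplicialComplex ℝ Plane) (F : Frame) (f : ℕ → Finset Plane) (M : ℕ)
    (p : ℕ → Plane) (m : ℕ) (r l x : Plane) (yr yl : ℕ → Plane) : Prop where
  middle : ChainMiddle T F f M p m r l x
  right : TautPath F (upper F f) (m + 1) (p 0) r yr
  left : TautPath F.mirror (upper F.mirror fun i => f (M - i)) (M - m + 1) (p (M + 1)) l yl

/-- Between two visits of `c` the path stands still at `c`, which puts `c` into all pieces between.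
In the middle triangle `c` need not be on the path again, but there `eq_r` identifies it with the
end `r`, where the path then stays. -/
theorem ChainMiddle.mem_upper_of_common {F : Frame} {f : ℕ → Finset Plane} {M : ℕ} {p : ℕ → Plane}
    {m : ℕ} {r l x : Plane} {y : ℕ → Plane} (h : ChainMiddle T F f M p m r l x)
    (hy : TautPath F (upper F f) (m + 1) (p 0) r y) {i j : ℕ} (hij : i + 1 < j) (hj : j ≤ m)
    {c : Plane} (hci : c ∈ segment ℝ (y i) (y (i + 1))) (hcj : c ∈ upper F f j)
    (hcj' : j < m → c ∈ segment ℝ (y j) (y (j + 1))) {k : ℕ} (hik : i ≤ k) (hkj : k ≤ j) :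
    c ∈ upper F f k := by
  have hseg : ∀ n ≤ m, segment ℝ (y n) (y (n + 1)) ⊆ upper F f n := fun n hn =>
    (hy.strip.convex n (by omega)).segment_subset (hy.runs.2.2 n (by omega)).1
      (hy.runs.2.2 n (by omega)).2
  rcases eq_or_lt_of_le hik with rfl | hik'
  · exact hseg _ (by omega) hci
  rcases eq_or_lt_of_le hj with rfl | hjm
  · have hcu := hseg i (by omega) hci
    have hcr := h.eq_r hij hcu.1 hcj.1 hcj.2 (hy.H_le_end (by omega) hci)
    rw [← hy.eq_of_end_mem_segment (by omega) (hcr ▸ hci) hik' (by omega)] at hcr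
    rw [hcr]
    exact (hy.runs.2.2 k (by omega)).1
  · rw [← hy.eq_of_mem_segments (by omega) (by omega) hci (hcj' hjm) hik' hkj]
    exact (hy.runs.2.2 k (by omega)).1

namespace TautPair

/-- The part of the boundary curve in the `i`-th triangle of the chain. -/
def sheet (f : ℕ → Finset Plane) (M : ℕ) (p : ℕ → Plane) (m : ℕ) (r l : Plane) (yr yl : ℕ → Plane)
    (i : ℕ) : Set Plane :=
  {c | (c ∈ segment ℝ (p (M + 1)) (p 0) ∧ c ∈ hull (f i)) ∨
    (i ≤ m ∧ c ∈ segment ℝ (yr i) (yr (i + 1))) ∨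
    (m ≤ i ∧ c ∈ segment ℝ (yl (M - i)) (yl (M - i + 1))) ∨ (i = m ∧ c ∈ segment ℝ l r)}

variable {F : Frame} {f : ℕ → Finset Plane} {M : ℕ} {p : ℕ → Plane} {m : ℕ} {r l x : Plane}
  {yr yl : ℕ → Plane}

theorem isClosed_sheet (i : ℕ) : IsClosed (sheet f M p m r l yr yl i) := by
  have e : sheet f M p m r l yr yl i = (segment ℝ (p (M + 1)) (p 0) ∩ hull (f i)) ∪
      (({_c | i ≤ m} ∩ segment ℝ (yr i) (yr (i + 1))) ∪
      (({_c | m ≤ i} ∩ segment ℝ (yl (M - i)) (yl (M - i + 1))) ∪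
        ({_c | i = m} ∩ segment ℝ l r))) := rfl
  have hs : ∀ a b : Plane, IsClosed (segment ℝ a b) := fun a b => (isCompact_segment a b).isClosed
  rw [e]
  refine ((hs _ _).inter ((f i).finite_toSet.isClosed_convexHull ℝ)).union
    ((isClosed_const.inter (hs _ _)).union ((isClosed_const.inter (hs _ _)).union
      (isClosed_const.inter (hs _ _))))

theorem right_subset (h : TautPair T F f M p m r l x yr yl) {i : ℕ} (hi : i ≤ m) :
    segment ℝ (yr i) (yr (i + 1)) ⊆ upper F f i :=
  (h.right.strip.convex i (by omega)).segment_subset (h.right.runs.2.2 i (by omega)).1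
    (h.right.runs.2.2 i (by omega)).2

theorem left_subset (h : TautPair T F f M p m r l x yr yl) {i : ℕ} (hi : m ≤ i) (hM : i ≤ M) :
    segment ℝ (yl (M - i)) (yl (M - i + 1)) ⊆ upper F f i := by
  have := (h.left.strip.convex (M - i) (by omega)).segment_subset
    (h.left.runs.2.2 (M - i) (by omega)).1 (h.left.runs.2.2 (M - i) (by omega)).2
  simp only [upper, show M - (M - i) = i by omega] at this
  exact this

theorem edge_subset (h : TautPair T F f M p m r l x yr yl) : segment ℝ l r ⊆ upper F f m :=
  ((convex_convexHull ℝ _).inter (convex_nonneg F.H)).segment_subset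
    ⟨subset_convexHull ℝ _ h.middle.mem_l, h.middle.l_nonneg⟩
    ⟨subset_convexHull ℝ _ h.middle.mem_r, h.middle.r_nonneg⟩

theorem base_level (h : TautPair T F f M p m r l x yr yl) {c : Plane}
    (hc : c ∈ segment ℝ (p (M + 1)) (p 0)) : F.H c = 0 :=
  F.level_of_mem_segment (h.middle.chain.level _ le_rfl) (h.middle.chain.level 0 (by omega)) hc

theorem sheet_subset (h : TautPair T F f M p m r l x yr yl) {i : ℕ} (hi : i ≤ M) :
    sheet f M p m r l yr yl i ⊆ upper F f i := by
  rintro c (⟨h1, h2⟩ | ⟨h1, h2⟩ | ⟨h1, h2⟩ | ⟨rfl, h2⟩)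
  · exact ⟨h2, (h.base_level h1).ge⟩
  · exact h.right_subset h1 h2
  · exact h.left_subset h1 hi h2
  · exact h.edge_subset h2

/-- A common point of two sheets belongs to all triangles between them. -/
theorem mem_between (h : TautPair T F f M p m r l x yr yl) {i j : ℕ} (hij : i < j) (hj : j ≤ M)
    {c : Plane} (hci : c ∈ sheet f M p m r l yr yl i) (hcj : c ∈ sheet f M p m r l yr yl j) {k : ℕ}
    (hik : i ≤ k) (hkj : k ≤ j) : c ∈ upper F f k := by
  have hui := h.sheet_subset (by omega : i ≤ M) hci
  have huj := h.sheet_subset hj hcj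
  have hm := h.middle.le
  rcases eq_or_lt_of_le hik with rfl | hik'
  · exact hui
  rcases eq_or_lt_of_le hkj with rfl | hkj'
  · exact huj
  -- Base points are shared by successive triangles only, while `k` is strictly between `i` and `j`.
  have hbase : c ∉ segment ℝ (p (M + 1)) (p 0) := fun hc => by
    have := (h.middle.chain.eq_of_level hij hj hui.1 huj.1 (h.base_level hc)).1
    omega
  have hright : ∀ n, n < m → c ∈ sheet f M p m r l yr yl n → c ∈ segment ℝ (yr n) (yr (n + 1)) := by
    rintro n hn (⟨h1, -⟩ | ⟨-, h2⟩ | ⟨h1, -⟩ | ⟨h1, -⟩)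
    · exact absurd h1 hbase
    · exact h2
    · omega
    · omega
  have hleft : ∀ n, m < n → c ∈ sheet f M p m r l yr yl n →
      c ∈ segment ℝ (yl (M - n)) (yl (M - n + 1)) := by
    rintro n hn (⟨h1, -⟩ | ⟨h1, -⟩ | ⟨-, h2⟩ | ⟨h1, -⟩)
    · exact absurd h1 hbase
    · omega
    · exact h2
    · omega
  -- Sheets on different sides of the middle triangle have no common point. Otherwise the path on
  -- the respective side is used, the left one after reversal.
  rcases Nat.lt_or_ge m j with hmj | hjm
  · have hcl := hleft j hmj hcj
    rcases Nat.lt_or_ge i m with him | hmi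
    · have hcr := hright i him hci
      exact (h.middle.not_common him hmj hj hui.1 huj.1 hui.2 (h.right.H_le_end (by omega) hcr)
        (h.left.H_le_end (by omega) hcl)).elim
    · have key := h.middle.mirror.mem_upper_of_common h.left (i := M - j) (j := M - i) (k := M - k)
        (c := c) (by omega) (by omega) hcl
        (by simp only [upper, show M - (M - i) = i by omega]; exact hui)
        (fun hlt => hleft i (by omega) hci) (by omega) (by omega)
      simp only [upper, show M - (M - k) = k by omega] at key
      exact key
  · exact h.middle.mem_upper_of_common h.right (by omega) hjm (hright i (by omega) hci) huj
      (fun hlt => hright j hlt hcj) hik hkj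

/-- The closed curve formed by the base, the two shortest paths and the edge between their ends. -/
def curve (M : ℕ) (p : ℕ → Plane) (m : ℕ) (r l : Plane) (yr yl : ℕ → Plane) : Set Plane :=
  segment ℝ (p (M + 1)) (p 0) ∪ segment ℝ l r ∪ trace (m + 1) yr ∪ trace (M - m + 1) yl

theorem isCompact_curve : IsCompact (curve M p m r l yr yl) :=
  (((isCompact_segment _ _).union (isCompact_segment _ _)).union (isCompact_trace _ _)).union
    (isCompact_trace _ _)

theorem curve_eq_iUnion (h : TautPair T F f M p m r l x yr yl) :
    curve M p m r l yr yl = ⋃ i : Fin (M + 1), sheet f M p m r l yr yl i := by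
  have hm := h.middle.le
  apply Set.Subset.antisymm
  · rintro c (((hc | hc) | ⟨j, hj, hc⟩) | ⟨j, hj, hc⟩)
    · obtain ⟨i, hi, hci⟩ := h.middle.chain.exists_mem_of_mem_base hc
      exact Set.mem_iUnion.2 ⟨⟨i, by omega⟩, Or.inl ⟨hc, hci⟩⟩
    · exact Set.mem_iUnion.2 ⟨⟨m, by omega⟩, Or.inr (Or.inr (Or.inr ⟨rfl, hc⟩))⟩
    · exact Set.mem_iUnion.2 ⟨⟨j, by omega⟩, Or.inr (Or.inl ⟨show j ≤ m by omega, hc⟩)⟩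
    · refine Set.mem_iUnion.2 ⟨⟨M - j, by omega⟩, Or.inr (Or.inr (Or.inl
        ⟨show m ≤ M - j by omega, ?_⟩))⟩
      simp only [show M - (M - j) = j by omega]
      exact hc
  · intro c hc
    obtain ⟨⟨i, hi⟩, hc⟩ := Set.mem_iUnion.1 hc
    rcases hc with ⟨h1, -⟩ | ⟨h1, h2⟩ | ⟨h1, h2⟩ | ⟨-, h2⟩
    · exact Or.inl (Or.inl (Or.inl h1))
    · exact Or.inl (Or.inr ⟨i, Nat.lt_succ_of_le h1, h2⟩)
    · exact Or.inr ⟨M - i, by simp only at h1; omega, h2⟩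
    · exact Or.inl (Or.inl (Or.inr h2))

/-- An edge of the triangulation that meets the region enclosed by the curve crosses the base. -/
theorem not_disjoint_of_mem_enclosed (h : TautPair T F f M p m r l x yr yl) {e : Finset Plane}
    (he : e ∈ T.faces) (he2 : e.card ≤ 2) {q : Plane} (hqe : q ∈ hull e)
    (hq : q ∈ enclosed (curve M p m r l yr yl)) :
    ¬ Disjoint (hull e) (openSegment ℝ (p (M + 1)) (p 0)) := by
  intro hdis
  -- It remains to glue a logarithm along the chain: `q` lies on an edge, hence in no interior of a
  -- triangle, and its removal disconnects no portal.
  refine HasLog.not_isBounded isCompact_curve hq.1 ?_ hq.2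
  have hqC := hq.1
  rw [h.curve_eq_iUnion] at hqC ⊢
  refine HasLog.iUnion_chain (K := upper F f) (fun i hi => ?_) (fun i _ => isClosed_sheet i)
    (fun i hi c hc => ⟨h.sheet_subset hi hc, ?_⟩) (fun i hi => ?_)
    (fun i j hij hj c hci hcj k hik hkj => h.mem_between hij hj hci hcj hik hkj)
  · refine (hasLog_of_notMem_interior (convex_convexHull ℝ _)
      (interior_face_nonempty (h.middle.chain.face i hi) (h.middle.chain.card i hi))
      (notMem_interior_of_card_le he (h.middle.chain.face i hi) (h.middle.chain.card i hi) he2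
        hqe)).mono ?_
    exact fun c hc => ⟨hc.1.1, hc.2⟩
  · rintro rfl
    exact hqC (Set.mem_iUnion.2 ⟨⟨i, by omega⟩, hc⟩)
  · exact h.middle.chain.isPreconnected_portal_diff hi he hqe hdis

end TautPair

end BorderRegion

/-! ### The winding number jumps across the base. -/

namespace BorderRegion

variable {T : Geometry.SimplicialComplex ℝ Plane}

namespace TautPair

variable {F : Frame} {f : ℕ → Finset Plane} {M : ℕ} {p : ℕ → Plane} {m : ℕ} {r l x : Plane}
  {yr yl : ℕ → Plane}

/-- The part of the curve above the base. -/
def arc (M m : ℕ) (r l : Plane) (yr yl : ℕ → Plane) : Set Plane :=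
  trace (m + 1) yr ∪ segment ℝ r l ∪ trace (M - m + 1) yl

theorem curve_eq (M : ℕ) (p : ℕ → Plane) (m : ℕ) (r l : Plane) (yr yl : ℕ → Plane) :
    curve M p m r l yr yl = segment ℝ (p (M + 1)) (p 0) ∪ arc M m r l yr yl := by
  rw [curve, arc, segment_symm ℝ r l]
  ext c
  simp only [Set.mem_union]
  tauto

theorem isCompact_arc : IsCompact (arc M m r l yr yl) :=
  ((isCompact_trace _ _).union (isCompact_segment _ _)).union (isCompact_trace _ _)

theorem isPreconnected_arc (h : TautPair T F f M p m r l x yr yl) :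
    IsPreconnected (arc M m r l yr yl) := by
  have hr : r ∈ trace (m + 1) yr := by
    have := right_mem_trace m yr
    rwa [h.right.runs.2.1] at this
  have hl : l ∈ trace (M - m + 1) yl := by
    have := right_mem_trace (M - m) yl
    rwa [h.left.runs.2.1] at this
  exact IsPreconnected.union l (Or.inr (right_mem_segment ℝ r l)) hl
    (IsPreconnected.union r hr (left_mem_segment ℝ r l) (isPreconnected_trace _ _)
      (isPreconnected_segment _ _)) (isPreconnected_trace _ _)

theorem east_mem_arc (h : TautPair T F f M p m r l x yr yl) : p 0 ∈ arc M m r l yr yl := by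
  have := left_mem_trace m yr
  rw [h.right.runs.1] at this
  exact Or.inl (Or.inl this)

theorem west_mem_arc (h : TautPair T F f M p m r l x yr yl) : p (M + 1) ∈ arc M m r l yr yl := by
  have := left_mem_trace (M - m) yl
  rw [h.left.runs.1] at this
  exact Or.inr this

theorem arc_nonneg (h : TautPair T F f M p m r l x yr yl) {c : Plane}
    (hc : c ∈ arc M m r l yr yl) : 0 ≤ F.H c := by
  have hm := h.middle.le
  rcases hc with (⟨j, hj, hc⟩ | hc) | ⟨j, hj, hc⟩
  · exact (h.right_subset (by omega) hc).2
  · rw [segment_symm] at hc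
    exact (h.edge_subset hc).2
  · have := (h.left_subset (i := M - j) (by omega) (by omega)
      (by rw [show M - (M - j) = j by omega]; exact hc)).2
    exact this

/-- The arc meets the line `H = 0` in vertices and in the ends of the base only. -/
theorem arc_level (h : TautPair T F f M p m r l x yr yl) {c : Plane}
    (hc : c ∈ arc M m r l yr yl) (hH : F.H c = 0) :
    c = p 0 ∨ c = p (M + 1) := by
  have hm := h.middle.le
  rcases hc with (⟨j, hj, hc⟩ | hc) | ⟨j, hj, hc⟩
  · exact Or.inl (h.right.eq_of_mem_segment_of_H_eq_zero hj hc hH)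
  -- The edge `r l` does not run along the line, so its point at height zero is one of its ends, and
  -- `r_eq` makes this an end of the base.
  · have hrl : 0 < F.H r ∨ 0 < F.H l := by
      obtain ⟨z, hz, hzH⟩ := h.middle.chain.above m hm
      rcases h.middle.eq_or z hz with rfl | rfl | rfl
      · exact Or.inl hzH
      · exact Or.inr hzH
      · linarith [h.middle.below]
    have hr := h.middle.r_nonneg
    have hl := h.middle.l_nonneg
    obtain ⟨t, ⟨h0, h1⟩, rfl⟩ := (segment_eq_image_lineMap ℝ _ _).subset hc
    rw [F.H_lineMap] at hH
    have e1 : (1 - t) * F.H r = 0 := by nlinarith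
    have e2 : t * F.H l = 0 := by nlinarith
    rcases mul_eq_zero.1 e1 with h3 | h3
    · obtain rfl : t = 1 := by linarith
      rw [AffineMap.lineMap_apply_one]
      exact Or.inr (h.middle.mirror.r_eq (by simpa using e2)).1
    · rcases mul_eq_zero.1 e2 with h4 | h4
      · rw [h4, AffineMap.lineMap_apply_zero]
        exact Or.inl (h.middle.r_eq h3).1
      · rcases hrl with h5 | h5 <;> linarith
  · exact Or.inr (h.left.eq_of_mem_segment_of_H_eq_zero hj hc hH)

end TautPair

/-- An edge of the triangulation that crosses the base of a chain has an end above the base. -/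
theorem Chain.exists_upper_end {F : Frame} {f : ℕ → Finset Plane} {M : ℕ} {p : ℕ → Plane}
    (h : Chain T F f M p) {e : Finset Plane} (he : e ∈ T.faces) {q : Plane} (hqe : q ∈ hull e)
    (hq : q ∈ openSegment ℝ (p (M + 1)) (p 0))
    (hv : ∀ v, {v} ∈ T.faces → v ∉ openSegment ℝ (p (M + 1)) (p 0)) : ∃ v ∈ e, 0 < F.H v := by
  classical
  by_contra! hcon
  have hH0 := F.level_of_mem_segment (h.level _ le_rfl) (h.level 0 (by omega))
    (openSegment_subset_segment ℝ _ _ hq)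
  obtain ⟨i, hi, hqi⟩ := h.exists_mem_of_mem_base (openSegment_subset_segment ℝ _ _ hq)
  -- With no vertex of `e` above the line, `q` is a convex combination of the vertices on the line.
  set g := e.filter fun v => F.H v = 0 with hg
  have hqg : q ∈ hull (g ∩ f i) := by
    have hqg' : q ∈ hull g := by
      by_contra hne
      have hsub : g ⊆ e := Finset.filter_subset _ _
      rw [hull, Finset.mem_convexHull'] at hqe
      obtain ⟨w, hw0, hw1, hwq⟩ := hqe
      apply hne
      have hsum : F.H q = ∑ v ∈ e, w v * F.H v := by
        have : F.H q = ∑ v ∈ e, w v • F.H v := by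
          rw [← hwq]
          have := Finset.map_affineCombination e (fun v => v) w hw1 F.H
          rw [Finset.affineCombination_eq_linear_combination _ _ _ hw1,
            Finset.affineCombination_eq_linear_combination _ _ _ hw1] at this
          simpa using this
        simpa using this
      rw [hH0] at hsum
      have hz : ∀ v ∈ e, w v * F.H v = 0 := by
        have hnonpos : ∀ v ∈ e, w v * F.H v ≤ 0 := fun v hve =>
          mul_nonpos_of_nonneg_of_nonpos (hw0 v hve) (hcon v hve)
        exact (Finset.sum_eq_zero_iff_of_nonpos hnonpos).1 hsum.symm
      rw [hull, Finset.mem_convexHull']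
      have hzero : ∀ v ∈ e, v ∉ g → w v = 0 := by
        intro v hve hvg
        have hne' : F.H v ≠ 0 := fun h0 => hvg (Finset.mem_filter.2 ⟨hve, h0⟩)
        exact (mul_eq_zero.1 (hz v hve)).resolve_right hne'
      refine ⟨w, fun v hvg => hw0 v (hsub hvg), ?_, ?_⟩
      · rw [← hw1]
        exact Finset.sum_subset hsub hzero
      · rw [← hwq]
        exact Finset.sum_subset hsub fun v hve hvg => by rw [hzero v hve hvg, zero_smul]
    have hgf : g ∈ T.faces := T.down_closed he (Finset.filter_subset _ _) (by
      rw [Finset.nonempty_iff_ne_empty]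
      intro h0
      rw [h0] at hqg'
      simp [hull] at hqg')
    have := T.inter_subset_convexHull hgf (h.face i hi) ⟨hqg', hqi⟩
    rwa [← Finset.coe_inter] at this
  -- A triangle of the chain has vertices on both sides and so at most one on the line; `q` would be
  -- this vertex.
  have hcard : (g ∩ f i).card ≤ 1 := by
    obtain ⟨a, ha, haH⟩ := h.above i hi
    obtain ⟨b, hb, hbH⟩ := h.below i hi
    have hsub : g ∩ f i ⊆ ((f i).erase a).erase b := by
      intro v hv
      rw [Finset.mem_inter, hg, Finset.mem_filter] at hv
      rw [Finset.mem_erase, Finset.mem_erase]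
      refine ⟨?_, ?_, hv.2⟩
      · rintro rfl; linarith [hv.1.2]
      · rintro rfl; linarith [hv.1.2]
    have hba : b ∈ (f i).erase a := Finset.mem_erase.2 ⟨by rintro rfl; linarith, hb⟩
    have := Finset.card_le_card hsub
    rw [Finset.card_erase_of_mem hba, Finset.card_erase_of_mem ha, h.card i hi] at this
    exact this
  rcases Nat.lt_or_ge (g ∩ f i).card 1 with h0 | h1
  · rw [Finset.card_eq_zero.1 (by omega : (g ∩ f i).card = 0)] at hqg
    simp [hull] at hqg
  · obtain ⟨v, hgv⟩ := Finset.card_eq_one.1 (le_antisymm hcard h1)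
    rw [hgv] at hqg
    simp only [hull, Finset.coe_singleton, convexHull_singleton, Set.mem_singleton_iff] at hqg
    have hve : v ∈ f i := Finset.inter_subset_right (by rw [hgv]; simp)
    exact hv v (singleton_mem_faces (h.face i hi) hve) (hqg ▸ hq)

theorem hasLog_of_lower {F : Frame} : (interior {z | 0 ≤ F.H z}).Nonempty → ∀ q, F.H q < 0 →
    HasLog q {z | 0 ≤ F.H z} := by
  intro hne q hq
  have hn : q ∉ {z | 0 ≤ F.H z} := not_le.2 hq
  have := hasLog_of_notMem_interior (convex_nonneg F.H) hne fun h => hn (interior_subset h)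
  rwa [Set.sdiff_singleton_eq_self hn] at this

namespace TautPair

variable {F : Frame} {f : ℕ → Finset Plane} {M : ℕ} {p : ℕ → Plane} {m : ℕ} {r l x : Plane}
  {yr yl : ℕ → Plane}

/-- An edge of the triangulation that crosses the base meets the region enclosed by the curve. -/
theorem exists_mem_enclosed (h : TautPair T F f M p m r l x yr yl) {κ : ℂ} (hκ : κ ≠ 0)
    (hζ : ∀ z z' : Plane, (⟨F.X z, F.H z⟩ : ℂ) - ⟨F.X z', F.H z'⟩ = κ * toC (z - z'))
    {e : Finset Plane} (he : e ∈ T.faces) {q : Plane} (hqe : q ∈ hull e)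
    (hq : q ∈ openSegment ℝ (p (M + 1)) (p 0))
    (hv : ∀ v, {v} ∈ T.faces → v ∉ openSegment ℝ (p (M + 1)) (p 0)) :
    (hull e ∩ enclosed (curve M p m r l yr yl)).Nonempty := by
  have hch := h.middle.chain
  obtain ⟨v, hve, hvH⟩ := hch.exists_upper_end he hqe hq hv
  have hX0 := hch.X_lt (show 0 < M + 1 by omega) le_rfl
  have hH0 := F.level_of_mem_segment (hch.level _ le_rfl) (hch.level 0 (by omega))
    (openSegment_subset_segment ℝ _ _ hq)
  have hXq := F.X_of_mem_openSegment hX0 hq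
  have hqarc : q ∉ arc M m r l yr yl := by
    intro hc
    rcases h.arc_level hc hH0 with rfl | rfl
    · linarith [hXq.2]
    · linarith [hXq.1]
  obtain ⟨δ, hδ, hball⟩ := Metric.isOpen_iff.1
    (isCompact_arc (r := r) (l := l) (yr := yr) (yl := yl)).isClosed.isOpen_compl q hqarc
  have hfar : ∀ c ∈ arc M m r l yr yl, δ ≤ dist c q := fun c hc => by
    by_contra! hlt
    exact hball (Metric.mem_ball.2 hlt) hc
  have hcont : ∀ φ : Plane → ℝ, Continuous φ → φ q > 0 → ∀ᶠ ε in nhds (0 : ℝ),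
      0 < φ (AffineMap.lineMap q v ε) := by
    intro φ hφ hpos
    have : Filter.Tendsto (fun ε : ℝ => φ (AffineMap.lineMap q v ε)) (nhds 0) (nhds (φ q)) := by
      have hc : Continuous fun ε : ℝ => φ (AffineMap.lineMap q v ε) :=
        hφ.comp AffineMap.lineMap_continuous
      simpa using hc.tendsto 0
    exact this.eventually (lt_mem_nhds hpos)
  have hXc : Continuous F.X := F.X.continuous_of_finiteDimensional
  -- For small `ε` of either sign the point is between the ends of the base and within `δ / 4` of
  -- `q`. Two such points are less than `δ / 2` apart, and farther than that from the arc.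
  have ev : ∀ᶠ ε in nhds (0 : ℝ), F.X (AffineMap.lineMap q v ε) < F.X (p 0) ∧
      F.X (p (M + 1)) < F.X (AffineMap.lineMap q v ε) ∧ dist (AffineMap.lineMap q v ε) q < δ / 4 := by
    have a1 := hcont (fun z => F.X (p 0) - F.X z) (continuous_const.sub hXc) (by simpa using hXq.2)
    have a2 := hcont (fun z => F.X z - F.X (p (M + 1))) (hXc.sub continuous_const)
      (by simpa using hXq.1)
    have a3 := hcont (fun z => δ / 4 - dist z q)
      (continuous_const.sub (continuous_id.dist continuous_const)) (by simpa using hδ)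
    filter_upwards [a1, a2, a3] with ε b1 b2 b3
    exact ⟨by linarith, by linarith, by linarith⟩
  obtain ⟨η, hη, hηb⟩ := Metric.mem_nhds_iff.1 ev
  set ε := min (η / 2) (1 / 2) with hε
  have hε0 : 0 < ε := lt_min (by positivity) (by norm_num)
  have hε1 : ε ≤ 1 / 2 := min_le_right _ _
  have hεη : ε < η := lt_of_le_of_lt (min_le_left _ _) (by linarith)
  have hz := hηb (show ε ∈ Metric.ball 0 η by simpa [abs_of_pos hε0] using hεη)
  have hz' := hηb (show -ε ∈ Metric.ball 0 η by simpa [abs_of_pos hε0] using hεη)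
  set z : Plane := AffineMap.lineMap q v ε with hzdef
  set z' : Plane := AffineMap.lineMap q v (-ε) with hzdef'
  simp only [Set.mem_ofPred_eq] at hz hz'
  have hzH : 0 < F.H z := by rw [hzdef, F.H_lineMap, hH0]; nlinarith
  have hzH' : F.H z' < 0 := by rw [hzdef', F.H_lineMap, hH0]; nlinarith
  have hzC : z ∉ curve M p m r l yr yl := by
    rw [curve_eq]
    rintro (hc | hc)
    · rw [h.base_level hc] at hzH
      exact lt_irrefl _ hzH
    · linarith [hfar z hc, hz.2.2]
  refine ⟨z, ?_, hzC, ?_⟩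
  · refine (convex_convexHull ℝ _).segment_subset hqe (subset_convexHull ℝ _ hve) ?_
    rw [segment_eq_image_lineMap]
    exact ⟨ε, ⟨hε0.le, by linarith⟩, rfl⟩
  · by_contra hb
    have hlog := HasLog.of_not_isBounded isCompact_curve hzC hb
    have hsub : curve M p m r l yr yl ⊆ {z | 0 ≤ F.H z} := by
      rw [curve_eq]
      rintro c (hc | hc)
      · exact (h.base_level hc).ge
      · exact h.arc_nonneg hc
    have hint : (interior {z | 0 ≤ F.H z}).Nonempty := by
      refine ⟨v, mem_interior_iff_mem_nhds.2 ?_⟩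
      have hc : Continuous F.H := F.H.continuous_of_finiteDimensional
      exact (hc.tendsto v).eventually (le_mem_nhds hvH)
    have hlog' := (hasLog_of_lower hint z' hzH').mono hsub
    rw [curve_eq] at hlog hlog'
    refine not_hasLog_of_crossing (ζ := fun z => ⟨F.X z, F.H z⟩) hκ hζ (isPreconnected_segment _ _)
      h.isPreconnected_arc (left_mem_segment ℝ _ _) h.west_mem_arc (right_mem_segment ℝ _ _)
      h.east_mem_arc (fun c hc => h.base_level hc) hzH hzH' hz.2.1 hz'.2.1 hz.1 hz'.1
      (fun c hc => ?_) hlog hlog'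
    have h1 := hfar c hc
    have h2 := dist_triangle c z' q
    have h3 := dist_triangle z' q z
    rw [dist_comm q z] at h3
    linarith [hz.2.2, hz'.2.2]

end TautPair

end BorderRegion

/-! ### Coordinates along a segment, and triangulated faces of a network. -/

namespace BorderRegion

/-- The function `cross u v` as an affine map. -/
noncomputable def crossMap (u v : Plane) : Plane →ᵃ[ℝ] ℝ where
  toFun := cross u v
  linear := (v 0 - u 0) • (EuclideanSpace.proj 1 : Plane →L[ℝ] ℝ).toLinearMap -
    (v 1 - u 1) • (EuclideanSpace.proj 0 : Plane →L[ℝ] ℝ).toLinearMap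
  map_vadd' z w := by
    simp [cross]
    ring

@[simp] theorem crossMap_apply (u v z : Plane) : crossMap u v z = cross u v z := rfl

/-- The scalar product with `v - u`, with value zero at `u`. -/
noncomputable def dotMap (u v : Plane) : Plane →ᵃ[ℝ] ℝ where
  toFun z := (v 0 - u 0) * (z 0 - u 0) + (v 1 - u 1) * (z 1 - u 1)
  linear := (v 0 - u 0) • (EuclideanSpace.proj 0 : Plane →L[ℝ] ℝ).toLinearMap +
    (v 1 - u 1) • (EuclideanSpace.proj 1 : Plane →L[ℝ] ℝ).toLinearMap
  map_vadd' z w := by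
    simp
    ring

theorem dotMap_apply (u v z : Plane) :
    dotMap u v z = (v 0 - u 0) * (z 0 - u 0) + (v 1 - u 1) * (z 1 - u 1) := rfl

theorem dist_sq_eq (z z' : Plane) : dist z z' ^ 2 = (z 0 - z' 0) ^ 2 + (z 1 - z' 1) ^ 2 := by
  rw [EuclideanSpace.dist_eq, Real.sq_sqrt (Finset.sum_nonneg fun i _ => sq_nonneg _)]
  simp [Fin.sum_univ_two, Real.dist_eq, sq_abs]

/-- The frame along a segment, with `X` increasing towards the second end. -/
noncomputable def segFrame (u v : Plane) (h : u ≠ v) : Frame where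
  X := dotMap u v
  H := crossMap u v
  D := dist u v
  D_pos := dist_pos.2 h
  dist_sq z z' := by
    rw [mul_pow, dist_sq_eq, dist_sq_eq, dotMap_apply, dotMap_apply, crossMap_apply, crossMap_apply,
      cross, cross]
    ring

theorem toC_eq (z : Plane) : toC z = ⟨z 0, z 1⟩ := by
  have : toC.symm ⟨z 0, z 1⟩ = z := by
    ext i
    simp only [toC, LinearIsometryEquiv.symm_symm, Complex.orthonormalBasisOneI_repr_apply]
    fin_cases i <;> rfl
  rw [← this, LinearIsometryEquiv.apply_symm_apply, this]

/-- Scalar and cross product are the real and imaginary parts of the conjugate of `v - u` times `z -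
u`. This supplies the factor `κ` of `not_hasLog_of_crossing`. -/
theorem segFrame_complex {u v : Plane} (h : u ≠ v) (z z' : Plane) :
    (⟨(segFrame u v h).X z, (segFrame u v h).H z⟩ : ℂ) -
      ⟨(segFrame u v h).X z', (segFrame u v h).H z'⟩ =
      (starRingEnd ℂ) (toC (v - u)) * toC (z - z') := by
  simp only [segFrame, dotMap_apply, crossMap_apply, cross, toC_eq]
  apply Complex.ext
  · simp
    ring
  · simp
    ring

/-- The closure of a component of an open set meets the set only in the component. -/
theorem mem_of_mem_closure_connectedComponentIn {U : Set Plane} (hU : IsOpen U) {x z : Plane}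
    (hz : z ∈ closure (connectedComponentIn U x)) (hzU : z ∈ U) : z ∈ connectedComponentIn U x := by
  obtain ⟨p, hp1, hp2⟩ := mem_closure_iff.1 hz _ hU.connectedComponentIn
    (mem_connectedComponentIn hzU)
  rw [connectedComponentIn_eq hp2, ← connectedComponentIn_eq hp1]
  exact mem_connectedComponentIn hzU

namespace Network

variable (N : Network)

theorem mem_V_of_adj {u v : Plane} (h : N.G.Adj u v) : u ∈ N.V ∧ v ∈ N.V :=
  ⟨N.mem_of_adj h, N.mem_of_adj h.symm⟩

/-- The edges of the network other than `u v`, and its vertices. -/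
def rest (u v : Plane) : Set Plane :=
  {z | z ∈ N.V ∨ ∃ x y : Plane, N.G.Adj x y ∧ s(u, v) ≠ s(x, y) ∧ z ∈ segment ℝ x y}

theorem isClosed_of_edges (P : Plane → Plane → Prop) :
    IsClosed {z | z ∈ N.V ∨ ∃ x y : Plane, (N.G.Adj x y ∧ P x y) ∧ z ∈ segment ℝ x y} := by
  have e : {z | z ∈ N.V ∨ ∃ x y : Plane, (N.G.Adj x y ∧ P x y) ∧ z ∈ segment ℝ x y} =
      (N.V : Set Plane) ∪ ⋃ e ∈ {e : Plane × Plane | e ∈ (N.V ×ˢ N.V : Finset _) ∧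
        (N.G.Adj e.1 e.2 ∧ P e.1 e.2)}, segment ℝ e.1 e.2 := by
    ext z
    simp only [Set.mem_union, Set.mem_iUnion, Set.mem_ofPred_eq, Finset.mem_product, exists_prop,
      Finset.mem_coe, Prod.exists]
    constructor
    · rintro (h | ⟨x, y, h, hz⟩)
      · exact Or.inl h
      · exact Or.inr ⟨x, y, ⟨N.mem_V_of_adj h.1, h⟩, hz⟩
    · rintro (h | ⟨x, y, ⟨-, h⟩, hz⟩)
      · exact Or.inl h
      · exact Or.inr ⟨x, y, h, hz⟩
  rw [e]
  refine N.V.finite_toSet.isClosed.union (Set.Finite.isClosed_biUnion ?_ fun e _ =>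
    (isCompact_segment _ _).isClosed)
  exact (N.V ×ˢ N.V).finite_toSet.subset fun e he => he.1

theorem isClosed_drawing : IsClosed N.drawing := by
  have := N.isClosed_of_edges fun _ _ => True
  simpa [drawing] using this

theorem isClosed_rest (u v : Plane) : IsClosed (N.rest u v) := by
  have := N.isClosed_of_edges fun x y => s(u, v) ≠ s(x, y)
  simpa [rest, and_assoc] using this

theorem drawing_subset (u v : Plane) : N.drawing ⊆ N.rest u v ∪ segment ℝ u v := by
  rintro z (hz | ⟨x, y, h, hz⟩)
  · exact Or.inl (Or.inl hz)
  · by_cases he : s(u, v) = s(x, y)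
    · rw [Sym2.eq_iff] at he
      rcases he with ⟨rfl, rfl⟩ | ⟨rfl, rfl⟩
      · exact Or.inr hz
      · rw [segment_symm] at hz
        exact Or.inr hz
    · exact Or.inl (Or.inr ⟨x, y, h, he, hz⟩)

theorem notMem_rest {u v z : Plane} (h : N.G.Adj u v) (hz : z ∈ openSegment ℝ u v) :
    z ∉ N.rest u v := by
  have hV : z ∉ N.V := fun hV => N.notMem_openSegment h hV hz
  rintro (hz' | ⟨x, y, hxy, hne, hz'⟩)
  · exact hV hz'
  · by_cases hzx : z = x
    · exact hV (hzx ▸ (N.mem_V_of_adj hxy).1)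
    by_cases hzy : z = y
    · exact hV (hzy ▸ (N.mem_V_of_adj hxy).2)
    exact Set.disjoint_left.1 (N.noncrossing h hxy hne) hz
      (mem_openSegment_of_ne_left_right (Ne.symm hzx) (Ne.symm hzy) hz')

end Network

theorem cross_eq_zero_of_mem_segment {u v z : Plane} (hz : z ∈ segment ℝ u v) : cross u v z = 0 := by
  rw [← convexHull_pair] at hz
  have h0 : ∀ x ∈ ({u, v} : Set Plane), crossMap u v x = 0 := by
    rintro x (rfl | rfl) <;> simp [cross]
    ring
  exact le_antisymm (le_of_mem_convexHull (φ := crossMap u v) (fun x hx => (h0 x hx).le) hz)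
    (ge_of_mem_convexHull (φ := crossMap u v) (fun x hx => (h0 x hx).ge) hz)

theorem exists_cross_pos {u v : Plane} (h : u ≠ v) : ∃ c, 0 < cross u v c := by
  refine ⟨u + !₂[-(v 1 - u 1), v 0 - u 0], ?_⟩
  have hd : 0 < dist u v ^ 2 := by
    have := dist_pos.2 h
    positivity
  rw [dist_sq_eq] at hd
  simp [cross]
  nlinarith

/-- In an open set there are points off a given line. -/
theorem exists_cross_ne_zero {u v : Plane} (h : u ≠ v) {O : Set Plane} (hO : IsOpen O)
    (hne : O.Nonempty) : ∃ z ∈ O, cross u v z ≠ 0 := by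
  by_contra! hcon
  obtain ⟨z, hz⟩ := hne
  obtain ⟨c, hc⟩ := exists_cross_pos h
  have hzi : z ∈ interior O := by rwa [hO.interior_eq]
  have := pos_of_mem_interior (φ := crossMap u v) (fun x hx => (hcon x hx).ge) hc hzi
  rw [crossMap_apply, hcon z hz] at this
  exact lt_irrefl _ this

namespace Network

variable (N : Network)

/-- A network edge with an inner point in the closure of a face lies in the closure of the face. -/
theorem segment_subset_closure {x : Plane} {B : Set Plane}
    (hB : B = connectedComponentIn N.drawingᶜ x) {u v z : Plane} (h : N.G.Adj u v)
    (hz : z ∈ openSegment ℝ u v) (hzB : z ∈ closure B) : segment ℝ u v ⊆ closure B := by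
  have huv : u ≠ v := h.ne
  have hBo : IsOpen B := hB ▸ N.isClosed_drawing.isOpen_compl.connectedComponentIn
  -- Membership in the closure of `B` is locally constant along the open edge: near an inner point
  -- the network consists of this edge only, so a face that comes near contains a whole half-disc
  -- beside it.
  have hloc : ∀ a ∈ openSegment ℝ u v, ∀ᶠ c in nhdsWithin a (openSegment ℝ u v),
      (a ∈ closure B ↔ c ∈ closure B) := by
    intro a ha
    obtain ⟨δ, hδ, hball⟩ := Metric.isOpen_iff.1 (N.isClosed_rest u v).isOpen_compl a
      (N.notMem_rest h ha)
    set D := Metric.ball a δ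
    have hD0 : ∀ c ∈ D, c ∈ N.drawing → cross u v c = 0 := by
      intro c hc hcd
      rcases N.drawing_subset u v hcd with h1 | h1
      · exact absurd h1 (hball hc)
      · exact cross_eq_zero_of_mem_segment h1
    have key : ∀ c ∈ D, c ∈ closure B → ∀ d ∈ D, cross u v d = 0 → d ∈ closure B := by
      intro c hc hcB d hd hd0
      have hne : (D ∩ B).Nonempty := mem_closure_iff.1 hcB D Metric.isOpen_ball hc
      obtain ⟨b, ⟨hbD, hbB⟩, hb0⟩ := exists_cross_ne_zero huv (Metric.isOpen_ball.inter hBo) hne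
      set S := D ∩ {c | 0 < cross u v b * cross u v c} with hS
      have hSconv : Convex ℝ S := by
        refine (convex_ball a δ).inter ?_
        exact (convex_Ioi (0 : ℝ)).affine_preimage (cross u v b • crossMap u v)
      have hbS : b ∈ S := ⟨hbD, mul_self_pos.2 hb0⟩
      have hSB : S ⊆ B := by
        have : connectedComponentIn N.drawingᶜ b = B := by
          rw [hB] at hbB ⊢
          exact (connectedComponentIn_eq hbB).symm
        rw [← this]
        refine hSconv.isPreconnected.subset_connectedComponentIn hbS fun c hc hcd => ?_
        have := hc.2
        rw [Set.mem_ofPred_eq, hD0 c hc.1 hcd, mul_zero] at this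
        exact lt_irrefl _ this
      have hcl : d ∈ closure S := by
        have hlim : Filter.Tendsto (fun ε : ℝ => (AffineMap.lineMap d b ε : Plane))
            (nhdsWithin 0 (Set.Ioi 0)) (nhds d) := by
          have hc : Continuous fun ε : ℝ => (AffineMap.lineMap d b ε : Plane) :=
            AffineMap.lineMap_continuous
          have := (hc.tendsto 0).mono_left (nhdsWithin_le_nhds (s := Set.Ioi 0))
          simpa using this
        refine mem_closure_of_tendsto hlim ?_
        filter_upwards [Ioo_mem_nhdsGT (show (0 : ℝ) < 1 by norm_num)] with ε hε
        refine ⟨(convex_ball a δ).segment_subset hd hbD ?_, ?_⟩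
        · rw [segment_eq_image_lineMap]
          exact ⟨ε, ⟨hε.1.le, hε.2.le⟩, rfl⟩
        · have e : cross u v (AffineMap.lineMap d b ε) = ε * cross u v b := by
            have := AffineMap.apply_lineMap (crossMap u v) d b ε
            rw [crossMap_apply, crossMap_apply, crossMap_apply, hd0] at this
            rw [this, AffineMap.lineMap_apply_module]
            simp
          rw [Set.mem_ofPred_eq, e]
          have := mul_self_pos.2 hb0
          nlinarith [hε.1, mul_pos hε.1 this]
      exact closure_mono hSB hcl
    have hDn : D ∈ nhdsWithin a (openSegment ℝ u v) :=
      mem_nhdsWithin_of_mem_nhds (Metric.ball_mem_nhds a hδ)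
    filter_upwards [hDn, self_mem_nhdsWithin] with c hc hcs
    have h1 := cross_eq_zero_of_mem_segment (openSegment_subset_segment ℝ _ _ ha)
    have h2 := cross_eq_zero_of_mem_segment (openSegment_subset_segment ℝ _ _ hcs)
    exact ⟨fun hA => key a (Metric.mem_ball_self hδ) hA c hc h2,
      fun hC => key c hc hC a (Metric.mem_ball_self hδ) h1⟩
  have hall : ∀ c ∈ openSegment ℝ u v, c ∈ closure B := by
    intro c hc
    have := (convex_openSegment u v).isPreconnected.induction₂
      (P := fun a b => (a ∈ closure B ↔ b ∈ closure B)) hloc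
      (fun _ _ _ _ _ _ => Iff.trans) (fun _ _ _ _ => Iff.symm) hz hc
    exact this.1 hzB
  have := closure_minimal hall isClosed_closure
  rwa [closure_openSegment] at this

end Network

/-- The facts about a triangulated face used in the sequel. -/
structure TriangulatedFace (N : Network) (B : Set Plane) (T : Geometry.SimplicialComplex ℝ Plane) :
    Prop where
  isOpen : IsOpen B
  notMem_of_vertex : ∀ v, {v} ∈ T.faces → v ∉ B
  interior_subset : ∀ t ∈ T.faces, t.card = 3 → interior (hull t) ⊆ B
  finite : T.faces.Finite
  cover : ∀ z ∈ closure B, ∃ t ∈ T.faces, t.card = 3 ∧ z ∈ hull t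

/-- The vertices are affinely independent and span the plane only if there are three of them. -/
theorem volume_face_eq_zero {T : Geometry.SimplicialComplex ℝ Plane} {s : Finset Plane}
    (hs : s ∈ T.faces) (h2 : s.card ≠ 3) : MeasureTheory.volume (hull s) = 0 := by
  refine MeasureTheory.measure_mono_null (convexHull_subset_affineSpan _)
    (MeasureTheory.Measure.addHaar_affineSubspace _ _ ?_)
  intro h
  apply h2
  have := (T.indep hs).affineSpan_eq_top_iff_card_eq_finrank_add_one.1 (by simpa using h)
  simpa using this

/-- Two points need an argument. A network edge through the interior of a triangle would lie in the
closure of `B` and hence be a face of `T`. And the triangles alone cover the closure, since all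
other faces are null sets. -/
theorem IsTriangulation.triangulatedFace {N : Network} {B : Set Plane}
    {T : Geometry.SimplicialComplex ℝ Plane} (hT : IsTriangulation N B T)
    (hB : N.IsBorderRegion B) : TriangulatedFace N B T := by
  obtain ⟨⟨x, -, hBx⟩, -⟩ := hB
  have hBo : IsOpen B := hBx ▸ N.isClosed_drawing.isOpen_compl.connectedComponentIn
  have hBd : ∀ z ∈ B, z ∉ N.drawing := by
    intro z hz
    rw [hBx] at hz
    exact connectedComponentIn_subset _ _ hz
  have hfin : T.faces.Finite := by
    refine (N.V.powerset.finite_toSet).subset fun s hs => ?_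
    rw [Finset.mem_coe, Finset.mem_powerset]
    exact fun v hv => ((hT.vertex_iff v).1 (singleton_mem_faces hs hv)).1
  refine ⟨hBo, fun v hv hvB => hBd v hvB (Or.inl ((hT.vertex_iff v).1 hv).1), ?_, hfin, ?_⟩
  · intro t ht h3 z hz
    have hzc : z ∈ closure B := by
      rw [← hT.space_eq]
      exact T.convexHull_subset_space ht (interior_subset hz)
    by_contra hzB
    have hzd : z ∈ N.drawing := by
      by_contra hzd
      rw [hBx] at hzc hzB
      exact hzB (mem_of_mem_closure_connectedComponentIn N.isClosed_drawing.isOpen_compl hzc hzd)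
    have hnV : z ∉ N.V := fun hV =>
      notMem_interior_of_card_le ((hT.vertex_iff z).2 ⟨hV, hzc⟩) ht h3 (by simp) (by simp) hz
    rcases hzd with hV | ⟨u, v, huv, hzs⟩
    · exact hnV hV
    · have hzo : z ∈ openSegment ℝ u v := by
        refine mem_openSegment_of_ne_left_right ?_ ?_ hzs
        · rintro rfl; exact hnV (N.mem_V_of_adj huv).1
        · rintro rfl; exact hnV (N.mem_V_of_adj huv).2
      have hsub := N.segment_subset_closure hBx huv hzo hzc
      refine notMem_interior_of_card_le (hT.edge_mem u v huv hsub) ht h3 Finset.card_le_two ?_ hz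
      rw [convexHull_coe_pair]
      exact hzs
  -- The part of `B` off the triangles is open and of measure zero, hence empty.
  · set U : Set Plane := ⋃ t ∈ {t | t ∈ T.faces ∧ t.card = 3}, hull t with hU
    have hUc : IsClosed U := (hfin.subset fun t ht => ht.1).isClosed_biUnion fun t _ =>
      t.finite_toSet.isClosed_convexHull ℝ
    have hBU : B ⊆ U := by
      by_contra hnot
      obtain ⟨z, hz, hzU⟩ := Set.not_subset.1 hnot
      have hO : IsOpen (B ∩ Uᶜ) := hBo.inter hUc.isOpen_compl
      have hpos := hO.measure_pos MeasureTheory.volume ⟨z, hz, hzU⟩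
      have hsub : B ∩ Uᶜ ⊆ ⋃ s ∈ {s | s ∈ T.faces ∧ s.card ≠ 3}, hull s := by
        rintro c ⟨hc, hcU⟩
        have : c ∈ T.space := by rw [hT.space_eq]; exact subset_closure hc
        obtain ⟨s, hs, hcs⟩ := Geometry.SimplicialComplex.mem_space_iff.1 this
        refine Set.mem_biUnion (x := s) ⟨hs, fun h3 => hcU ?_⟩ hcs
        exact Set.mem_biUnion (x := s) ⟨hs, h3⟩ hcs
      have h0 : MeasureTheory.volume (⋃ s ∈ {s | s ∈ T.faces ∧ s.card ≠ 3}, hull s) = 0 := by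
        rw [MeasureTheory.measure_biUnion_null_iff (hfin.subset fun s hs => hs.1).countable]
        exact fun s hs => volume_face_eq_zero hs.1 hs.2
      exact hpos.ne' (MeasureTheory.measure_mono_null hsub h0)
    intro z hz
    obtain ⟨t, ht, hzt⟩ := Set.mem_iUnion₂.1 (closure_minimal hBU hUc hz)
    exact ⟨t, ht.1, ht.2, hzt⟩

end BorderRegion

/-! ### Successive edges of the important sequence bound a triangle. -/

namespace BorderRegion

variable {T : Geometry.SimplicialComplex ℝ Plane}

theorem cross_rotate (u v w : Plane) : cross v w u = cross u v w := by
  simp only [cross]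
  ring

/-- There is only one triangle on either side of an edge. -/
theorem apex_unique [DecidableEq Plane] {u v x x' : Plane} (h : {u, v, x} ∈ T.faces)
    (h' : {u, v, x'} ∈ T.faces) (hx : 0 < cross u v x) (hx' : 0 < cross u v x') : x = x' := by
  by_contra hne
  -- `α`, `β`, `γ` are the barycentric coordinates of `x` with respect to `u`, `v`, `x'`; `γ` is
  -- positive as both apexes are on the same side.
  set D := cross u v x' with hD
  set α := cross v x' x / D with hα
  set β := cross x' u x / D with hβ
  set γ := cross u v x / D with hγ
  have hγ0 : 0 < γ := by positivity
  have hx0 : x = α • u + β • v + γ • x' := by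
    ext i
    simp only [PiLp.add_apply, PiLp.smul_apply, smul_eq_mul, hα, hβ, hγ]
    have hD0 : D ≠ 0 := hx'.ne'
    field_simp
    rw [hD]
    fin_cases i <;> simp [cross] <;> ring
  have hsum : α + β + γ = 1 := by
    have hD0 : D ≠ 0 := hx'.ne'
    rw [hα, hβ, hγ]
    field_simp
    rw [hD]
    simp only [cross]
    ring
  -- The point `z` below is taken so close to the midpoint of the edge that its coordinates in both
  -- triangles are nonnegative.
  set ε : ℝ := 1 / (2 * (1 + |α| + |β|)) with hε
  have hden : 0 < 1 + |α| + |β| := by positivity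
  have hε0 : 0 < ε := by positivity
  have hεm : ε * (1 + |α| + |β|) = 1 / 2 := by rw [hε]; field_simp
  have ha : 0 ≤ (1 - ε) / 2 + ε * α := by
    nlinarith [neg_abs_le α, abs_nonneg β, abs_nonneg α, mul_nonneg hε0.le (abs_nonneg β),
      mul_le_mul_of_nonneg_left (neg_abs_le α) hε0.le, mul_nonneg hε0.le (abs_nonneg α)]
  have hb : 0 ≤ (1 - ε) / 2 + ε * β := by
    nlinarith [neg_abs_le β, abs_nonneg β, abs_nonneg α, mul_nonneg hε0.le (abs_nonneg β),
      mul_le_mul_of_nonneg_left (neg_abs_le β) hε0.le, mul_nonneg hε0.le (abs_nonneg α)]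
  have hε1 : ε ≤ 1 := by
    nlinarith [mul_nonneg hε0.le (abs_nonneg β), mul_nonneg hε0.le (abs_nonneg α)]
  have hcomb : ∀ (y : Plane) (c₁ c₂ c₃ : ℝ), 0 ≤ c₁ → 0 ≤ c₂ → 0 ≤ c₃ → c₁ + c₂ + c₃ = 1 →
      c₁ • u + c₂ • v + c₃ • y ∈ hull {u, v, y} := by
    intro y c₁ c₂ c₃ h1 h2 h3 h4
    have hc := convex_convexHull ℝ ((({u, v, y} : Finset Plane)) : Set Plane)
    have m : ∀ z ∈ ({u, v, y} : Finset Plane), z ∈ hull {u, v, y} := fun z hz =>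
      subset_convexHull ℝ _ hz
    have := hc.sum_mem (t := Finset.univ) (w := ![c₁, c₂, c₃]) (z := ![u, v, y])
      (by intro i _; fin_cases i <;> assumption)
      (by simpa [Fin.sum_univ_three] using h4)
      (by intro i _; fin_cases i <;> exact m _ (by simp))
    simpa [Fin.sum_univ_three, hull] using this
  set z := ((1 - ε) / 2) • u + ((1 - ε) / 2) • v + ε • x with hz
  have hz1 : z ∈ hull {u, v, x} :=
    hcomb x _ _ _ (by linarith) (by linarith) hε0.le (by ring)
  have hz2 : z ∈ hull {u, v, x'} := by
    have e : z = ((1 - ε) / 2 + ε * α) • u + ((1 - ε) / 2 + ε * β) • v + (ε * γ) • x' := by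
      rw [hz]
      conv_lhs => rw [hx0]
      module
    rw [e]
    refine hcomb x' _ _ _ ha hb (by positivity) ?_
    linear_combination ε * hsum
  -- Triangles with different apexes share no point off the edge, but `z` is strictly to its left.
  have hzi := T.inter_subset_convexHull h h' ⟨hz1, hz2⟩
  have hle : crossMap u v z ≤ 0 := le_of_mem_convexHull (fun y hy => by
    have h1 := hy.1
    have h2 := hy.2
    simp only [Finset.coe_insert, Finset.coe_singleton, Set.mem_insert_iff,
      Set.mem_singleton_iff] at h1 h2
    rw [crossMap_apply]
    rcases h1 with rfl | rfl | rfl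
    · simp [cross]
    · simp [cross]; ring_nf; rfl
    · rcases h2 with rfl | rfl | rfl
      · simp [cross]
      · simp [cross]; ring_nf; rfl
      · exact absurd rfl hne) hzi
  have heq : crossMap u v z = ε * cross u v x := by
    rw [hz]
    simp [cross]
    ring
  rw [heq] at hle
  nlinarith

open scoped Classical in
/-- The edge `d'` is met next after `d` on the passage through a triangle. -/
def Passes (T : Geometry.SimplicialComplex ℝ Plane) (d d' : Seg) : Prop :=
  ∃ w : Plane, {d.1, d.2, w} ∈ T.faces ∧ 0 < cross d.1 d.2 w ∧ (d' = (d.1, w) ∨ d' = (w, d.2))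

/-- The edge `d'` is met next after `d` on a passage through a triangle or on a return. -/
def PassesOrReturns (T : Geometry.SimplicialComplex ℝ Plane) (d d' : Seg) : Prop :=
  Passes T d d' ∨ d' = d.swap

theorem TraversalStep.passesOrReturns {N : Network} {d d' : Seg} (h : TraversalStep N T d d') :
    PassesOrReturns T d d' := by
  obtain ⟨w, hw, hc, h⟩ := h
  rcases h with ⟨-, h⟩ | ⟨-, -, h⟩ | ⟨-, -, h⟩
  · exact Or.inl ⟨w, hw, hc, Or.inl h⟩
  · exact Or.inl ⟨w, hw, hc, Or.inr h⟩
  · exact Or.inr h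

-- By `apex_unique`, crossing back over `d` leads into the triangle just passed. The way on reaches
-- its third edge or returns over `a`, so the relation survives the cancelling of detours.
open scoped Classical in
theorem PassesOrReturns.cancel {a d c : Seg} (h₁ : PassesOrReturns T a d)
    (h₂ : PassesOrReturns T d.swap c) : PassesOrReturns T a c := by
  rcases h₁ with ⟨w, hw, hcw, hd⟩ | rfl
  swap
  · rwa [Prod.swap_swap] at h₂
  rcases h₂ with ⟨x, hx, hcx, hc⟩ | rfl
  swap
  · rw [Prod.swap_swap]
    exact Or.inl ⟨w, hw, hcw, hd⟩
  rcases hd with rfl | rfl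
  · simp only [Prod.swap_prod_mk] at hx hcx hc
    have hx2 : x = a.2 := apex_unique hx (by
      have : ({w, a.1, a.2} : Finset Plane) = {a.1, a.2, w} := by ext; simp; tauto
      rwa [this]) hcx (by rwa [← cross_rotate, ← cross_rotate] at hcw)
    subst hx2
    rcases hc with rfl | rfl
    · exact Or.inl ⟨w, hw, hcw, Or.inr rfl⟩
    · exact Or.inr rfl
  · simp only [Prod.swap_prod_mk] at hx hcx hc
    have hx2 : x = a.1 := apex_unique hx (by
      have : ({a.2, w, a.1} : Finset Plane) = {a.1, a.2, w} := by ext; simp; tauto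
      rwa [this]) hcx (by rwa [← cross_rotate] at hcw)
    subst hx2
    rcases hc with rfl | rfl
    · exact Or.inr rfl
    · exact Or.inl ⟨w, hw, hcw, Or.inl rfl⟩

theorem Cancel.isChain {l l' : List Seg} (h : Cancel l l') (hl : l.IsChain (PassesOrReturns T)) :
    l'.IsChain (PassesOrReturns T) := by
  obtain ⟨A, C, d⟩ := h
  rw [List.isChain_append] at hl ⊢
  obtain ⟨hA, hC, hAC⟩ := hl
  rw [List.isChain_cons_cons] at hC
  refine ⟨hA, hC.2.tail, fun a ha c hc => ?_⟩
  refine (hAC a ha d (by simp)).cancel ?_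
  have := hC.2
  rw [List.isChain_cons] at this
  exact this.1 c hc

/-- Successive edges of the important sequence bound a triangle. -/
theorem IsImportantSequence.passes {N : Network} {b : ℕ → Seg} {n : ℕ}
    (h : IsImportantSequence N T b n) {k : ℕ} (hk : k < n) : Passes T (b k) (b (k + 1)) := by
  obtain ⟨d, M, -, -, -, -, hstep, hred⟩ := h.reduces
  have hstart : ((List.range (M + 1)).map d).IsChain (PassesOrReturns T) := by
    rw [List.isChain_iff_getElem]
    intro i hi
    simp only [List.length_map, List.length_range] at hi
    simp only [List.getElem_map, List.getElem_range]
    exact (hstep i (by omega)).passesOrReturns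
  have hgen : ∀ l l' : List Seg, Relation.ReflTransGen Cancel l l' →
      l.IsChain (PassesOrReturns T) → l'.IsChain (PassesOrReturns T) := by
    intro l l' hll' hl
    induction hll' with
    | refl => exact hl
    | tail _ hc ih => exact hc.isChain ih
  -- Returns are admitted during the reduction and excluded at its end by `reduced`.
  have hend := hgen _ _ hred hstart
  rw [List.isChain_iff_getElem] at hend
  have := hend k (by simpa using hk)
  simp only [List.getElem_map, List.getElem_range] at this
  exact this.resolve_right (h.reduced k hk)

end BorderRegion

/-! ### A segment through the face and its slices in triangles. -/

namespace BorderRegion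

variable {T : Geometry.SimplicialComplex ℝ Plane}

open scoped Classical in
/-- A boundary point of a triangle lies on one of its edges. -/
theorem exists_erase_of_notMem_interior {t : Finset Plane} (ht : t ∈ T.faces) (h3 : t.card = 3)
    {z : Plane} (hz : z ∈ hull t) (hzi : z ∉ interior (hull t)) : ∃ c ∈ t, z ∈ hull (t.erase c) := by
  obtain ⟨β, hβ⟩ : ∃ β : AffineBasis t ℝ Plane, ∀ x, β x = (x : Plane) :=
    ⟨⟨(↑), T.indep ht, affineSpan_face ht h3⟩, fun _ => rfl⟩
  have hrange : Set.range β = (t : Set Plane) := by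
    ext x
    simp [hβ]
  rw [hull, ← hrange] at hz hzi
  rw [AffineBasis.interior_convexHull] at hzi
  rw [β.convexHull_eq_nonneg_coord] at hz
  simp only [Set.mem_ofPred_eq, not_forall, not_lt] at hz hzi
  obtain ⟨c, hc⟩ := hzi
  refine ⟨c, c.2, ?_⟩
  have hsum := β.sum_coord_apply_eq_one z
  have hlin := β.linear_combination_coord_eq_self z
  rw [← Finset.sum_erase_add _ _ (Finset.mem_univ c), le_antisymm hc (hz c)] at hsum hlin
  rw [add_zero] at hsum
  rw [zero_smul, add_zero] at hlin
  rw [← hlin]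
  refine (convex_convexHull ℝ _).sum_mem (fun i _ => hz i) hsum fun i hi => ?_
  refine subset_convexHull ℝ _ ?_
  rw [hβ, Finset.mem_coe, Finset.mem_erase]
  exact ⟨fun h => (Finset.mem_erase.1 hi).1 (Subtype.ext h), i.2⟩

/-- A triangle determines its vertices. -/
theorem eq_of_hull_eq {s t : Finset Plane} (hs : s ∈ T.faces) (ht : t ∈ T.faces) (hs3 : s.card = 3)
    (ht3 : t.card = 3) (h : hull s = hull t) : s = t := by
  obtain ⟨z, hz⟩ := interior_face_nonempty ht ht3
  refine (Finset.eq_of_subset_of_card_le (subset_of_mem_interior hs ht ht3 ?_ hz) (by omega)).symm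
  have hzt : z ∈ hull t := interior_subset hz
  rwa [← h] at hzt

/-- The segment `u v` runs through the face on the base line of the frame, with both ends on the
boundary, and crosses a triangle. -/
structure Crossing (N : Network) (B : Set Plane) (T : Geometry.SimplicialComplex ℝ Plane) (F : Frame)
    (u v : Plane) : Prop extends TriangulatedFace N B T where
  left_level : F.H u = 0
  right_level : F.H v = 0
  lt : F.X u < F.X v
  open_subset : openSegment ℝ u v ⊆ B
  left_notMem : u ∉ B
  right_notMem : v ∉ B
  meets : ∃ t ∈ T.faces, t.card = 3 ∧ (openSegment ℝ u v ∩ interior (hull t)).Nonempty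

namespace Crossing

variable {N : Network} {B : Set Plane} {F : Frame} {u v : Plane}

theorem mem_open (h : Crossing N B T F u v) {z : Plane} (hz : F.H z = 0) (h1 : F.X u < F.X z)
    (h2 : F.X z < F.X v) : z ∈ openSegment ℝ u v :=
  F.mem_openSegment_of_level h.left_level h.right_level hz h1 h2

theorem level (h : Crossing N B T F u v) {z : Plane} (hz : z ∈ openSegment ℝ u v) : F.H z = 0 :=
  F.level_of_mem_segment h.left_level h.right_level (openSegment_subset_segment ℝ _ _ hz)

theorem vertex_notMem (h : Crossing N B T F u v) {c : Plane} (hc : {c} ∈ T.faces) :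
    c ∉ openSegment ℝ u v := fun hcu => h.notMem_of_vertex c hc (h.open_subset hcu)

open scoped Classical in
/-- An edge of the triangulation contains at most one inner point of the segment. -/
theorem eq_of_mem_edge (h : Crossing N B T F u v) {e : Finset Plane} (he : e ∈ T.faces)
    (h2 : e.card ≤ 2) {z z' : Plane} (hz : z ∈ hull e) (hz' : z' ∈ hull e)
    (hzu : z ∈ openSegment ℝ u v) (hzu' : z' ∈ openSegment ℝ u v) : z = z' := by
  have hX := F.X_of_mem_openSegment h.lt hzu
  have hX' := F.X_of_mem_openSegment h.lt hzu'
  have hH := h.level hzu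
  have hH' := h.level hzu'
  by_contra hne
  have hXne : F.X z ≠ F.X z' := fun hx => hne (F.ext_coord hx (by rw [hH, hH']))
  obtain ⟨a, c, rfl⟩ : ∃ a c, e = {a, c} := by
    have h0 : e.Nonempty := T.nonempty_of_mem_faces he
    have h0' := h0.card_pos
    rcases (show e.card = 1 ∨ e.card = 2 by omega) with h1 | h1
    · obtain ⟨a, rfl⟩ := Finset.card_eq_one.1 h1
      exact ⟨a, a, by simp⟩
    · obtain ⟨a, c, -, rfl⟩ := Finset.card_eq_two.1 h1
      exact ⟨a, c, rfl⟩
  have hva := h.vertex_notMem (singleton_mem_faces he (show a ∈ _ by simp))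
  have hvc := h.vertex_notMem (singleton_mem_faces he (show c ∈ _ by simp))
  -- An edge within the base line that contains `z` covers the whole open segment, because its ends
  -- are vertices and not inside the segment.
  have hcov : ∀ a c : Plane, hull {a, c} = segment ℝ a c → a ∉ openSegment ℝ u v →
      c ∉ openSegment ℝ u v → F.H a = 0 → F.H c = 0 → F.X a < F.X c →
      z ∈ hull {a, c} → openSegment ℝ u v ⊆ hull {a, c} := by
    intro a c hseg hva hvc ha hc hac hz
    have hza : F.X a ≤ F.X z := ge_of_mem_convexHull (fun x hx => by
      simp only [Finset.coe_insert, Finset.coe_singleton, Set.mem_insert_iff,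
        Set.mem_singleton_iff] at hx
      rcases hx with rfl | rfl <;> linarith) hz
    have hzc : F.X z ≤ F.X c := le_of_mem_convexHull (fun x hx => by
      simp only [Finset.coe_insert, Finset.coe_singleton, Set.mem_insert_iff,
        Set.mem_singleton_iff] at hx
      rcases hx with rfl | rfl <;> linarith) hz
    have ha1 : F.X a ≤ F.X u := by
      by_contra! hcon
      exact hva (h.mem_open ha hcon (by linarith))
    have hc1 : F.X v ≤ F.X c := by
      by_contra! hcon
      exact hvc (h.mem_open hc (by linarith) hcon)
    intro q hq
    have hqX := F.X_of_mem_openSegment h.lt hq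
    rw [hseg]
    exact F.mem_segment_of_level ha hc (h.level hq) hac (by linarith) (by linarith)
  have hflat : F.H a = 0 ∧ F.H c = 0 ∧ F.X a ≠ F.X c := by
    rw [hull, convexHull_coe_pair, segment_eq_image_lineMap] at hz hz'
    obtain ⟨s, -, rfl⟩ := hz
    obtain ⟨s', -, rfl⟩ := hz'
    rw [F.H_lineMap] at hH hH'
    rw [F.X_lineMap, F.X_lineMap] at hXne
    have hss : s ≠ s' := fun hs => hXne (by rw [hs])
    have hd : (s - s') * (F.H c - F.H a) = 0 := by linear_combination hH - hH'
    rcases mul_eq_zero.1 hd with h1 | h1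
    · exact absurd (sub_eq_zero.1 h1) hss
    · refine ⟨by linear_combination hH - s * h1, by linear_combination hH + (1 - s) * h1,
        fun hx => hXne ?_⟩
      rw [hx]
      ring
  obtain ⟨ha, hc, hac⟩ := hflat
  have hsub : openSegment ℝ u v ⊆ hull {a, c} := by
    rcases lt_or_gt_of_ne hac with hlt | hlt
    · exact hcov a c (convexHull_coe_pair a c) hva hvc ha hc hlt hz
    · have := hcov c a (convexHull_coe_pair c a) hvc hva hc ha hlt (by rwa [Finset.pair_comm])
      rwa [Finset.pair_comm] at this
  -- The segment passes through the interior of a triangle, where no edge runs.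
  obtain ⟨t, ht, h3, q, hq, hqt⟩ := h.meets
  exact notMem_interior_of_card_le he ht h3 h2 (hsub hq) hqt

/-- Every part of the segment crosses a triangle. -/
theorem exists_crossed_between (h : Crossing N B T F u v) {a b : ℝ} (hab : a < b) (ha : F.X u ≤ a)
    (hb : b ≤ F.X v) : ∃ t ∈ T.faces, t.card = 3 ∧ ∃ z ∈ openSegment ℝ u v ∩ interior (hull t),
      a < F.X z ∧ F.X z < b := by
  classical
  -- Otherwise infinitely many points of the segment lie on finitely many edges, and two of them on
  -- the same edge.
  by_contra! hcon
  have hpt : ∀ x ∈ Set.Ioo a b, ∃ z ∈ openSegment ℝ u v, F.X z = x := by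
    intro x hx
    have hX : F.X v - F.X u ≠ 0 := by have := h.lt; linarith
    have e : F.X (AffineMap.lineMap u v ((x - F.X u) / (F.X v - F.X u)) : Plane) = x := by
      rw [F.X_lineMap]
      field_simp
      ring
    refine ⟨_, h.mem_open ?_ (by rw [e]; linarith [hx.1]) (by rw [e]; linarith [hx.2]), e⟩
    rw [F.H_lineMap, h.left_level, h.right_level]
    ring
  choose! g hg hgX using hpt
  have hedge : ∀ x ∈ Set.Ioo a b, ∃ e ∈ {e | e ∈ T.faces ∧ e.card ≤ 2}, g x ∈ hull e := by
    intro x hx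
    obtain ⟨t, ht, h3, hzt⟩ := h.cover (g x) (subset_closure (h.open_subset (hg x hx)))
    have hni : g x ∉ interior (hull t) := by
      intro hzi
      have := hcon t ht h3 (g x) ⟨hg x hx, hzi⟩ (by rw [hgX x hx]; exact hx.1)
      rw [hgX x hx] at this
      exact absurd hx.2 (not_lt.2 this)
    obtain ⟨c, hc, hze⟩ := exists_erase_of_notMem_interior ht h3 hzt hni
    refine ⟨t.erase c, ⟨T.down_closed ht (Finset.erase_subset _ _) ?_, ?_⟩, hze⟩
    · rw [← Finset.card_pos, Finset.card_erase_of_mem hc]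
      omega
    · rw [Finset.card_erase_of_mem hc]
      omega
  choose! k hk hgk using hedge
  obtain ⟨x, hx, x', hx', hne, he⟩ := (Set.Ioo_infinite hab).exists_ne_map_eq_of_mapsTo
    (fun x hx => hk x hx) (h.finite.subset fun e he => he.1)
  apply hne
  rw [← hgX x hx, ← hgX x' hx', h.eq_of_mem_edge (hk x hx).1 (hk x hx).2 (hgk x hx)
    (he ▸ hgk x' hx') (hg x hx) (hg x' hx')]

/-- The triangle `t` contains the part of the base line between its points `E` and `W`. -/
structure Slice (F : Frame) (u v : Plane) (t : Finset Plane) (E W : Plane) : Prop where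
  east_mem : E ∈ hull t
  west_mem : W ∈ hull t
  east_level : F.H E = 0
  west_level : F.H W = 0
  lt : F.X W < F.X E
  east_le : F.X E ≤ F.X v
  le_west : F.X u ≤ F.X W
  between : ∀ z ∈ hull t, F.H z = 0 → F.X W ≤ F.X z ∧ F.X z ≤ F.X E
  mem_interior : ∀ z, F.H z = 0 → F.X W < F.X z → F.X z < F.X E → z ∈ interior (hull t)
  inner : ∀ z ∈ openSegment ℝ u v, z ∈ interior (hull t) → F.X W < F.X z ∧ F.X z < F.X E

/-- `E` and `W` are the extreme points of the triangle on the line. By convexity the points strictly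
between them are interior, and since `u` and `v` are not in `B`, which contains the interior, the
slice does not extend beyond the segment. -/
theorem exists_slice (h : Crossing N B T F u v) {t : Finset Plane} (ht : t ∈ T.faces)
    (h3 : t.card = 3) {q : Plane} (hq : q ∈ openSegment ℝ u v) (hqt : q ∈ interior (hull t)) :
    ∃ E W, Slice F u v t E W := by
  have hcont : Continuous F.X := F.X.continuous_of_finiteDimensional
  have hcontH : Continuous F.H := F.H.continuous_of_finiteDimensional
  have hcpt : IsCompact (hull t ∩ {z | F.H z = 0}) :=
    (t.finite_toSet.isCompact_convexHull ℝ).inter_right (isClosed_eq hcontH continuous_const)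
  have hne : (hull t ∩ {z | F.H z = 0}).Nonempty := ⟨q, interior_subset hqt, h.level hq⟩
  obtain ⟨E, hE, hEmax⟩ := hcpt.exists_isMaxOn hne hcont.continuousOn
  obtain ⟨W, hW, hWmin⟩ := hcpt.exists_isMinOn hne hcont.continuousOn
  have hEmax' : ∀ z ∈ hull t, F.H z = 0 → F.X z ≤ F.X E := fun z hz hz0 => hEmax ⟨hz, hz0⟩
  have hWmin' : ∀ z ∈ hull t, F.H z = 0 → F.X W ≤ F.X z := fun z hz hz0 => hWmin ⟨hz, hz0⟩
  have hconv : Convex ℝ (hull t) := convex_convexHull ℝ _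
  have hside : ∀ d : Plane, F.H d = 0 → ∀ z, F.H z = 0 → z ∈ interior (hull t) →
      ∃ z' ∈ hull t, F.H z' = 0 ∧ ∃ ε > 0, F.X z' = F.X z + ε * (F.X d - F.X z) := by
    intro d hd z hz hzt
    have hlim : Filter.Tendsto (fun ε : ℝ => (AffineMap.lineMap z d ε : Plane))
        (nhdsWithin 0 (Set.Ioi 0)) (nhds z) := by
      have hc : Continuous fun ε : ℝ => (AffineMap.lineMap z d ε : Plane) :=
        AffineMap.lineMap_continuous
      have := (hc.tendsto 0).mono_left (nhdsWithin_le_nhds (s := Set.Ioi 0))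
      simpa using this
    obtain ⟨ε, hε, hε0⟩ := ((hlim.eventually (mem_interior_iff_mem_nhds.1 hzt)).and
      self_mem_nhdsWithin).exists
    refine ⟨_, hε, ?_, ε, hε0, ?_⟩
    · rw [F.H_lineMap, hz, hd]
      ring
    · rw [F.X_lineMap]
      ring
  have hinner : ∀ z ∈ openSegment ℝ u v, z ∈ interior (hull t) →
      F.X W < F.X z ∧ F.X z < F.X E := by
    intro z hz hzt
    have hzX := F.X_of_mem_openSegment h.lt hz
    constructor
    · obtain ⟨z', hz', hz0', ε, hε, hX⟩ := hside u h.left_level z (h.level hz) hzt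
      have := hWmin' z' hz' hz0'
      nlinarith [mul_pos hε (sub_pos.2 hzX.1)]
    · obtain ⟨z', hz', hz0', ε, hε, hX⟩ := hside v h.right_level z (h.level hz) hzt
      have := hEmax' z' hz' hz0'
      nlinarith [mul_pos hε (sub_pos.2 hzX.2)]
  obtain ⟨hWq, hqE⟩ := hinner q hq hqt
  have hqH := h.level hq
  have hqX := F.X_of_mem_openSegment h.lt hq
  have hint : ∀ z, F.H z = 0 → F.X W < F.X z → F.X z < F.X E → z ∈ interior (hull t) := by
    intro z hz h1 h2
    rcases lt_trichotomy (F.X z) (F.X q) with hlt | heq | hlt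
    · exact hconv.openSegment_self_interior_subset_interior hW.1 hqt
        (F.mem_openSegment_of_level hW.2 hqH hz h1 hlt)
    · rwa [F.ext_coord heq (by rw [hz, hqH])]
    · exact hconv.openSegment_interior_self_subset_interior hqt hE.1
        (F.mem_openSegment_of_level hqH hE.2 hz hlt h2)
  refine ⟨E, W, hE.1, hW.1, hE.2, hW.2, by linarith, ?_, ?_,
    fun z hz hz0 => ⟨hWmin' z hz hz0, hEmax' z hz hz0⟩, hint, hinner⟩
  · by_contra! hcon
    exact h.right_notMem (h.interior_subset t ht h3 (hint v h.right_level (by linarith) hcon))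
  · by_contra! hcon
    exact h.left_notMem (h.interior_subset t ht h3 (hint u h.left_level hcon (by linarith)))

/-- A crossed triangle has vertices on both sides of the base line. -/
theorem exists_vertices (h : Crossing N B T F u v) {t : Finset Plane} {q : Plane}
    (hq : q ∈ openSegment ℝ u v) (hqt : q ∈ interior (hull t)) :
    (∃ x ∈ t, F.H x < 0) ∧ ∃ x ∈ t, 0 < F.H x := by
  have hqH := h.level hq
  -- If `H` vanished everywhere, `X` would be an injective affine map from the plane to the real
  -- line.
  obtain ⟨c, hc⟩ : ∃ c, F.H c ≠ 0 := by
    by_contra! hcon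
    obtain ⟨a, b, hab⟩ : ∃ a b : Plane, F.D * dist a b ≠ |F.X a - F.X b| := by
      by_contra! hX
      have hinj : Function.Injective F.X := fun a b he => F.ext_coord he (by rw [hcon, hcon])
      have hlin : Function.Injective F.X.linear := F.X.linear_injective_iff.2 hinj
      have := LinearMap.finrank_le_finrank_of_injective hlin
      simp at this
    apply hab
    have h1 := F.dist_sq a b
    rw [hcon, hcon, sub_self, zero_pow two_ne_zero, add_zero] at h1
    rw [← abs_of_nonneg (mul_nonneg F.D_pos.le dist_nonneg : 0 ≤ F.D * dist a b)]
    exact (sq_eq_sq_iff_abs_eq_abs _ _).1 h1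
  obtain ⟨c₁, hc₁⟩ : ∃ c₁, 0 < F.H c₁ := by
    rcases lt_or_gt_of_ne hc with h1 | h1
    · refine ⟨AffineMap.lineMap c q (2 : ℝ), ?_⟩
      rw [F.H_lineMap, hqH]
      linarith
    · exact ⟨c, h1⟩
  have hc₂ : 0 < -F.H (AffineMap.lineMap c₁ q (2 : ℝ) : Plane) := by
    rw [F.H_lineMap, hqH]
    linarith
  constructor
  · by_contra! hcon
    have := pos_of_mem_interior (φ := F.H) (fun x hx => ge_of_mem_convexHull hcon hx) hc₁ hqt
    linarith
  · by_contra! hcon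
    have := pos_of_mem_interior (φ := -F.H) (S := hull t)
      (fun x hx => neg_nonneg.2 (le_of_mem_convexHull hcon hx)) hc₂ hqt
    have h2 : (-F.H) q = -F.H q := rfl
    linarith

end Crossing

end BorderRegion

/-! ### The crossed triangles form a chain. -/

namespace BorderRegion

variable {T : Geometry.SimplicialComplex ℝ Plane}

namespace Crossing

variable {N : Network} {B : Set Plane} {F : Frame} {u v : Plane}

/-- The triangles crossed by the segment form a chain. -/
theorem exists_chain (h : Crossing N B T F u v) {L : List (Set Plane)} (hL : ListsCrossed T (u, v) L)
    {M : ℕ} (hM : L.length = M + 1) : ∃ f p, Chain T F f M p ∧ p 0 = v ∧ p (M + 1) = u ∧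
      ∀ (i : ℕ) (hi : i < L.length), L[i] = hull (f i) := by
  obtain ⟨hmem, hsort⟩ := hL
  rw [List.pairwise_iff_getElem] at hsort
  have hf : ∀ i, ∃ t : Finset Plane, ∀ hi : i < L.length, t ∈ T.faces ∧ t.card = 3 ∧
      L[i] = hull t := by
    intro i
    by_cases hi : i < L.length
    · obtain ⟨t, ht⟩ := ((hmem _).1 (L.getElem_mem hi)).1
      exact ⟨t, fun _ => ht⟩
    · exact ⟨∅, fun hi' => absurd hi' hi⟩
  choose f hf using hf
  have hface : ∀ i ≤ M, f i ∈ T.faces := fun i hi => (hf i (by omega)).1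
  have hcard : ∀ i ≤ M, (f i).card = 3 := fun i hi => (hf i (by omega)).2.1
  have hq : ∀ i ≤ M, ∃ q ∈ openSegment ℝ u v, q ∈ interior (hull (f i)) := by
    intro i hi
    have hi' : i < L.length := by omega
    have := ((hmem _).1 (L.getElem_mem hi')).2
    rwa [(hf i hi').2.2] at this
  have hsl : ∀ i, ∃ E W : Plane, i ≤ M → Slice F u v (f i) E W := fun i => by
    by_cases hi : i ≤ M
    · obtain ⟨q, hqo, hqi⟩ := hq i hi
      obtain ⟨E, W, hEW⟩ := h.exists_slice (hface i hi) (hcard i hi) hqo hqi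
      exact ⟨E, W, fun _ => hEW⟩
    · exact ⟨u, u, fun hi' => absurd hi' hi⟩
  choose E W hEW using hsl
  have hlt : ∀ i j, i < j → j ≤ M → ∀ x ∈ openSegment ℝ u v, x ∈ interior (hull (f i)) →
      ∀ y ∈ openSegment ℝ u v, y ∈ interior (hull (f j)) → F.X y < F.X x := by
    intro i j hij hj x hx hxi y hy hyj
    have := hsort i j (by omega) (by omega) hij x (by
      rw [(hf i (by omega)).2.2]; exact ⟨hx, hxi⟩) y (by
      rw [(hf j (by omega)).2.2]; exact ⟨hy, hyj⟩)
    have hd : ∀ z ∈ openSegment ℝ u v, F.D * dist v z = F.X v - F.X z := fun z hz =>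
      F.D_mul_dist (by rw [h.right_level, h.level hz]) (F.X_of_mem_openSegment h.lt hz).2.le
    have h2 := mul_lt_mul_of_pos_left this F.D_pos
    rw [hd x hx, hd y hy] at h2
    linarith
  -- Overlapping slices would have a common inner point, and this point would be strictly west of
  -- itself.
  have hsep : ∀ i j, i < j → j ≤ M → F.X (E j) ≤ F.X (W i) := by
    intro i j hij hj
    have hi : i ≤ M := by omega
    by_contra! hcon
    obtain ⟨x, hx, hxi⟩ := hq i hi
    obtain ⟨y, hy, hyj⟩ := hq j hj
    have hxy := hlt i j hij hj x hx hxi y hy hyj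
    have hxE := ((hEW i hi).inner x hx hxi).2
    have hyW := ((hEW j hj).inner y hy hyj).1
    have hab : max (F.X (W i)) (F.X (W j)) < min (F.X (E i)) (F.X (E j)) := by
      rw [max_lt_iff, lt_min_iff, lt_min_iff]
      exact ⟨⟨(hEW i hi).lt, hcon⟩, by linarith, (hEW j hj).lt⟩
    obtain ⟨t, -, -, z, ⟨hz, -⟩, hz1, hz2⟩ := h.exists_crossed_between hab
      ((hEW i hi).le_west.trans (le_max_left _ _)) ((min_le_left _ _).trans (hEW i hi).east_le)
    rw [max_lt_iff] at hz1
    rw [lt_min_iff] at hz2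
    exact lt_irrefl _ (hlt i j hij hj z hz ((hEW i hi).mem_interior z (h.level hz) hz1.1 hz2.1) z hz
      ((hEW j hj).mem_interior z (h.level hz) hz1.2 hz2.2))
  -- No part of the segment is free of slices. Hence they leave no gaps: the first begins at `v`,
  -- successive ones join, and the last ends at `u`.
  have hmeet : ∀ a b : ℝ, a < b → F.X u ≤ a → b ≤ F.X v →
      ∃ k ≤ M, F.X (W k) < b ∧ a < F.X (E k) := by
    intro a b hab ha hb
    obtain ⟨t, ht, h3, z, hz, hz1, hz2⟩ := h.exists_crossed_between hab ha hb
    have htL : hull t ∈ L := (hmem _).2 ⟨⟨t, ht, h3, rfl⟩, z, hz⟩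
    obtain ⟨k, hk, hkt⟩ := List.getElem_of_mem htL
    have hzk : z ∈ interior (hull (f k)) := by rw [← (hf k hk).2.2, hkt]; exact hz.2
    have := (hEW k (by omega)).inner z hz.1 hzk
    exact ⟨k, by omega, by linarith, by linarith⟩
  have heast : E 0 = v := by
    refine F.ext_coord (le_antisymm (hEW 0 (by omega)).east_le ?_)
      (by rw [(hEW 0 (by omega)).east_level, h.right_level])
    by_contra! hcon
    obtain ⟨k, hk, -, hkE⟩ := hmeet _ _ hcon
      ((hEW 0 (by omega)).le_west.trans (hEW 0 (by omega)).lt.le) le_rfl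
    rcases Nat.eq_zero_or_pos k with rfl | hk0
    · exact lt_irrefl _ hkE
    · have := hsep 0 k hk0 hk
      have := (hEW 0 (by omega)).lt
      linarith
  have hwest : W M = u := by
    refine F.ext_coord (le_antisymm ?_ (hEW M le_rfl).le_west)
      (by rw [(hEW M le_rfl).west_level, h.left_level])
    by_contra! hcon
    obtain ⟨k, hk, hkW, -⟩ := hmeet _ _ hcon le_rfl
      ((hEW M le_rfl).lt.le.trans (hEW M le_rfl).east_le)
    rcases Nat.eq_or_lt_of_le hk with rfl | hk0
    · exact lt_irrefl _ hkW
    · have := hsep k M hk0 le_rfl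
      have := (hEW M le_rfl).lt
      linarith
  have hjoin : ∀ i < M, W i = E (i + 1) := by
    intro i hi
    have hs := hEW i hi.le
    have hs' := hEW (i + 1) hi
    refine F.ext_coord (le_antisymm ?_ (hsep i (i + 1) (by omega) hi))
      (by rw [hs.west_level, hs'.east_level])
    by_contra! hcon
    obtain ⟨k, hk, hkW, hkE⟩ := hmeet _ _ hcon (hs'.le_west.trans hs'.lt.le)
      (hs.lt.le.trans hs.east_le)
    have hsk := hEW k hk
    rcases lt_trichotomy k i with hki | rfl | hki
    · have := hsep k i hki hi.le
      have := hs.lt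
      linarith
    · exact lt_irrefl _ hkW
    · rcases Nat.eq_or_lt_of_le (show i + 1 ≤ k from hki) with rfl | hki'
      · exact lt_irrefl _ hkE
      · have := hsep (i + 1) k hki' hk
        have := hs'.lt
        linarith
  set p : ℕ → Plane := fun i => Nat.casesOn i v W with hp
  have hpE : ∀ i ≤ M, p i = E i := by
    intro i hi
    cases i with
    | zero => exact heast.symm
    | succ i => exact hjoin i (by omega)
  have hpW : ∀ i, p (i + 1) = W i := fun i => rfl
  refine ⟨f, p, ?_, rfl, hwest, fun i hi => (hf i hi).2.2⟩
  refine ⟨hface, hcard, ?_, ?_, ?_, ?_, ?_, ?_, ?_, ?_⟩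
  · intro i hi
    cases i with
    | zero => exact h.right_level
    | succ i => exact (hEW i (by omega)).west_level
  · intro i hi
    rw [hpE i hi, hpW]
    exact (hEW i hi).lt
  · intro i hi
    rw [hpE i hi]
    exact (hEW i hi).east_mem
  · intro i hi
    exact (hEW i hi).west_mem
  · intro i hi
    rw [hpE i hi, hpW]
    exact (hEW i hi).between
  · intro i h1 hi hv
    obtain ⟨k, rfl⟩ : ∃ k, i = k + 1 := ⟨i - 1, by omega⟩
    have hs := hEW k (by omega)
    have hs' := hEW (k + 1) hi
    have he := hjoin k (by omega)
    refine h.vertex_notMem hv (h.mem_open hs.west_level ?_ ?_)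
    · have h1 := hs'.le_west
      have h2 := hs'.lt
      rw [← he] at h2
      exact h1.trans_lt h2
    · exact hs.lt.trans_le hs.east_le
  · intro i hi
    obtain ⟨q, hqo, hqi⟩ := hq i hi
    exact (h.exists_vertices hqo hqi).1
  · intro i hi
    obtain ⟨q, hqo, hqi⟩ := hq i hi
    exact (h.exists_vertices hqo hqi).2

end Crossing

/-- The middle triangle of a chain, with two vertices above the base line. -/
theorem Chain.middle {F : Frame} {f : ℕ → Finset Plane} {M m : ℕ} {p : ℕ → Plane} {r l x : Plane}
    (h : Chain T F f M p) (hm : m ≤ M) (hr : r ∈ f m) (hl : l ∈ f m) (hx : x ∈ f m)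
    (hor : ∀ z ∈ f m, z = r ∨ z = l ∨ z = x) (hr0 : 0 ≤ F.H r) (hl0 : 0 ≤ F.H l)
    (ho : 0 < (F.X r - F.X x) * (F.H l - F.H x) - (F.H r - F.H x) * (F.X l - F.X x)) :
    ChainMiddle T F f M p m r l x := by
  have hxH : F.H x < 0 := by
    obtain ⟨z, hz, hzH⟩ := h.below m hm
    rcases hor z hz with rfl | rfl | rfl <;> linarith
  have hconv : Convex ℝ (hull (f m)) := convex_convexHull ℝ _
  have hpt : ∀ z ∈ f m, z ∈ hull (f m) := fun z hz => subset_convexHull ℝ _ hz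
  have hle : ∀ (φ : Plane →ᵃ[ℝ] ℝ), 0 ≤ φ r → 0 ≤ φ l → 0 ≤ φ x → ∀ z ∈ hull (f m), 0 ≤ φ z := by
    intro φ h1 h2 h3 z hz
    refine ge_of_mem_convexHull (fun y hy => ?_) hz
    rcases hor y hy with rfl | rfl | rfl <;> assumption
  have hpm := h.level m (by omega)
  have hpm' := h.level (m + 1) (by omega)
  have hfoot : ∀ y : Plane, 0 ≤ F.H y → ∃ P ∈ segment ℝ x y, F.H P = 0 ∧
      (F.H y - F.H x) * F.X P = F.X x * F.H y - F.X y * F.H x := by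
    intro y hy
    obtain ⟨P, hP, hP0⟩ := F.exists_mem_segment hxH.le hy
    refine ⟨P, hP, hP0, ?_⟩
    obtain ⟨t, -, rfl⟩ := (segment_eq_image_lineMap ℝ x y).subset hP
    rw [F.H_lineMap] at hP0
    rw [F.X_lineMap]
    linear_combination (F.X y - F.X x) * hP0
  -- `φ` vanishes on the line through `x` and `y`, and `σ` makes it nonnegative on the triangle. So
  -- the foot of this edge is extreme in the slice: the eastern end for `σ = 1`, the western one for
  -- `σ = -1`.
  have key : ∀ y y' : Plane, ∀ σ : ℝ,
      0 ≤ σ * ((F.X y - F.X x) * (F.H y' - F.H x) - (F.H y - F.H x) * (F.X y' - F.X x)) →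
      (y = r ∧ y' = l ∨ y = l ∧ y' = r) → ∀ P,
      (F.H y - F.H x) * F.X P = F.X x * F.H y - F.X y * F.H x → 0 ≤ F.H y → ∀ z ∈ hull (f m), F.H z = 0 → 0 ≤ σ * (F.X P - F.X z) := by
    intro y y' σ hσ hyy P hP hy z hz hz0
    set φ : Plane →ᵃ[ℝ] ℝ := σ • ((F.X y - F.X x) • (F.H - AffineMap.const ℝ Plane (F.H x)) -
      (F.H y - F.H x) • (F.X - AffineMap.const ℝ Plane (F.X x))) with hφ
    have hφa : ∀ c, φ c = σ * ((F.X y - F.X x) * (F.H c - F.H x) -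
      (F.H y - F.H x) * (F.X c - F.X x)) := fun c => rfl
    have hφx : 0 ≤ φ x := by rw [hφa]; apply le_of_eq; ring
    have hφy : 0 ≤ φ y := by rw [hφa]; apply le_of_eq; ring
    have hφy' : 0 ≤ φ y' := by rw [hφa]; exact hσ
    have hφz : 0 ≤ φ z := by
      rcases hyy with ⟨rfl, rfl⟩ | ⟨rfl, rfl⟩
      · exact hle φ hφy hφy' hφx z hz
      · exact hle φ hφy' hφy hφx z hz
    rw [hφa, hz0] at hφz
    have e : σ * ((F.X y - F.X x) * (0 - F.H x) - (F.H y - F.H x) * (F.X z - F.X x)) =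
        (F.H y - F.H x) * (σ * (F.X P - F.X z)) := by linear_combination (-σ) * hP
    rw [e] at hφz
    exact nonneg_of_mul_nonneg_right hφz (by linarith)
  refine ⟨h, hm, hr, hl, hx, ?_, hor, hxH, hr0, hl0, ?_, ?_⟩
  · rintro rfl
    linarith
  · obtain ⟨P, hP, hP0, hPX⟩ := hfoot r hr0
    have h1 := key r l 1 (by linarith) (Or.inl ⟨rfl, rfl⟩) P hPX hr0 (p m)
      (h.east_mem m hm) hpm
    have h2 := (h.slice m hm P (hconv.segment_subset (hpt x hx) (hpt r hr) hP) hP0).2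
    rwa [F.ext_coord (show F.X (p m) = F.X P by linarith) (by rw [hpm, hP0])]
  · obtain ⟨P, hP, hP0, hPX⟩ := hfoot l hl0
    have h1 := key l r (-1) (by linarith) (Or.inr ⟨rfl, rfl⟩) P hPX hl0
      (p (m + 1)) (h.west_mem m hm) hpm'
    have h2 := (h.slice m hm P (hconv.segment_subset (hpt x hx) (hpt l hl) hP) hP0).1
    rwa [F.ext_coord (show F.X (p (m + 1)) = F.X P by linarith) (by rw [hpm', hP0])]

end BorderRegion

/-! ### From the window to a chain with two shortest paths. -/

namespace BorderRegion

variable {T : Geometry.SimplicialComplex ℝ Plane}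

theorem IsShortestPath.runsThrough {L : List (Set Plane)} {K : ℕ → Set Plane} {N : ℕ} {p q : Plane}
    {y : ℕ → Plane} (h : IsShortestPath L p q y) (hN : L.length = N)
    (hK : ∀ (j : ℕ) (hj : j < L.length), L[j] = K j) :
    RunsThrough K N p q y ∧ ∀ y', RunsThrough K N p q y' → pathLength N y ≤ pathLength N y' := by
  subst hN
  have e : ∀ y, IsPathThrough L p q y ↔ RunsThrough K L.length p q y := by
    intro y
    refine and_congr_right fun _ => and_congr_right fun _ => forall_congr' fun j =>
      forall_congr' fun hj => ?_
    rw [hK j hj]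
  exact ⟨(e y).1 h.1, fun y' hy' => h.2 y' ((e y').2 hy')⟩

theorem clip_hull {u v : Plane} (huv : u ≠ v) (f : ℕ → Finset Plane) (i : ℕ) :
    clip (u, v) (hull (f i)) = upper (segFrame u v huv) f i := rfl

/-- The frame is a similarity with factor `dist u v`, so orientations can be read off in its
coordinates. -/
theorem segFrame_cross {u v : Plane} (huv : u ≠ v) (a c d : Plane) :
    ((segFrame u v huv).X c - (segFrame u v huv).X a) * ((segFrame u v huv).H d -
      (segFrame u v huv).H a) - ((segFrame u v huv).H c - (segFrame u v huv).H a) *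
      ((segFrame u v huv).X d - (segFrame u v huv).X a) = dist u v ^ 2 * cross a c d := by
  simp only [segFrame, dotMap_apply, crossMap_apply, cross, dist_sq_eq]
  ring

open scoped Classical in
/-- The triangle passed between two edges has one vertex besides the ends of the second edge. -/
theorem Passes.exists_vertex {d d' : Seg} (h : Passes T d d') : ∃ x, {d'.1, d'.2, x} ∈ T.faces ∧
    0 < cross x d'.2 d'.1 ∧ tri d d' = hull {d'.1, d'.2, x} := by
  obtain ⟨w, hw, hc, rfl | rfl⟩ := h
  · refine ⟨d.2, ?_, ?_, ?_⟩
    · have e : ({d.1, w, d.2} : Finset Plane) = {d.1, d.2, w} := by ext; simp; tauto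
      rwa [e]
    · simpa only [cross_rotate] using hc
    · rw [tri, hull]
      congr 1
      ext
      simp
      tauto
  · refine ⟨d.1, ?_, ?_, ?_⟩
    · have e : ({w, d.2, d.1} : Finset Plane) = {d.1, d.2, w} := by ext; simp; tauto
      rwa [e]
    · exact hc
    · rw [tri, hull]
      congr 1
      ext
      simp
      tauto

open scoped Classical in
/-- The right ends of two edges with the same left end, passed in succession, span an edge. -/
theorem Passes.right_edge {d d' : Seg} (h : Passes T d d') (he : d'.1 = d.1) :
    {d.2, d'.2} ∈ T.faces := by
  obtain ⟨w, hw, hc, rfl | rfl⟩ := h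
  · exact pair_mem_faces hw (by simp) (by simp)
  -- Here the left end moves to `w`, so `he` would make the triangle degenerate.
  · simp only at he
    subst he
    simp [cross] at hc

/-- Only triangles beyond the previous initial edge count as visible. Hence the subtraction in
`ω.idx - 1` is not truncated. -/
theorem NextStage.one_le {B : Set Plane} {b : ℕ → Seg} {n : ℕ} {σ ω : Stage}
    (h : NextStage B T b n σ ω) : 1 ≤ ω.idx := by
  obtain ⟨z, hz⟩ := h.1.visible
  have := hz.1
  omega

/-- The only point of a degenerate window would lie both in the open set `B` and on its frontier. -/
theorem NextStage.ne {B : Set Plane} {b : ℕ → Seg} {n : ℕ} {σ ω : Stage} (h : NextStage B T b n σ ω)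
    (hB : IsOpen B) : ω.seg.1 ≠ ω.seg.2 := by
  intro he
  have h1 : ω.seg.1 ∈ B := h.1.open_subset (by rw [← he, openSegment_same]; rfl)
  have h2 := h.1.left_mem
  rw [hB.frontier_eq] at h2
  exact h2.2 h1

/-- The initial shortest paths at a window run through the chain of the triangles crossed by it. -/
theorem NextStage.exists_tautPair {N : Network} {B : Set Plane} (hF : TriangulatedFace N B T)
    {b : ℕ → Seg} {n : ℕ} (hb : IsImportantSequence N T b n) {σ ω : Stage}
    (hω : NextStage B T b n σ ω) {yr yl : ℕ → Plane} (hyr : IsRightPath b ω ω.idx yr)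
    (hyl : IsLeftPath b ω ω.idx yl) (hne : ω.seg.1 ≠ ω.seg.2) :
    ∃ f M p m x, TautPair T (segFrame ω.seg.1 ω.seg.2 hne) f M p m (b ω.idx).2 (b ω.idx).1 x yr yl ∧
      p 0 = ω.seg.2 ∧ p (M + 1) = ω.seg.1 ∧
      hourglassInterior b ω yr yl = enclosed (TautPair.curve M p m (b ω.idx).2 (b ω.idx).1 yr yl) := by
  classical
  have hidx := hω.one_le
  obtain ⟨hw, UR, UL, hL, hright, hleft⟩ := hω
  have hpass := hb.passes (k := ω.idx - 1) (by have := hw.le_length; omega)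
  rw [Nat.sub_add_cancel hidx] at hpass
  obtain ⟨x, hface, hcross, htri⟩ := hpass.exists_vertex
  set F := segFrame ω.seg.1 ω.seg.2 hne with hFdef
  have hcard : ({(b ω.idx).1, (b ω.idx).2, x} : Finset Plane).card = 3 := by
    rw [Finset.card_eq_three]
    refine ⟨_, _, _, ?_, ?_, ?_, rfl⟩
    · intro h
      rw [h] at hcross
      simp [cross] at hcross
      ring_nf at hcross
      exact lt_irrefl _ hcross
    · intro h
      rw [h] at hcross
      simp [cross] at hcross
    · intro h
      rw [h] at hcross
      simp [cross] at hcross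
  have hcr : Crossing N B T F ω.seg.1 ω.seg.2 :=
    { hF with
      left_level := by simp [hFdef, segFrame, cross]
      right_level := by simp [hFdef, segFrame, cross]; ring
      lt := by
        have h1 : F.X ω.seg.1 = 0 := by simp [hFdef, segFrame, dotMap_apply]
        have h2 : F.X ω.seg.2 = dist ω.seg.1 ω.seg.2 ^ 2 := by
          simp only [hFdef, segFrame, dotMap_apply, dist_sq_eq]
          ring
        have := dist_pos.2 hne
        rw [h1, h2]
        positivity
      open_subset := hw.open_subset
      left_notMem := fun h => (hF.isOpen.frontier_eq ▸ hw.left_mem).2 h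
      right_notMem := fun h => (hF.isOpen.frontier_eq ▸ hw.right_mem).2 h
      meets := ⟨_, hface, hcard, htri ▸ hw.meets⟩ }
  set L := UR ++ tri (b (ω.idx - 1)) (b ω.idx) :: UL with hLdef
  -- `UR` precedes the last visible triangle in the list, which therefore has the index `m`.
  set m := UR.length with hm
  set M := UR.length + UL.length with hM
  have hlen : L.length = M + 1 := by
    rw [hLdef, List.length_append, List.length_cons, hM]
    omega
  obtain ⟨f, p, hch, hp0, hpM, hf⟩ := hcr.exists_chain hL hlen
  have hmid : f m = {(b ω.idx).1, (b ω.idx).2, x} := by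
    refine eq_of_hull_eq (hch.face m (by omega)) hface (hch.card m (by omega)) hcard ?_
    rw [← htri, ← hf m (by omega)]
    simp [hLdef, hm]
  have hmiddle : ChainMiddle T F f M p m (b ω.idx).2 (b ω.idx).1 x := by
    refine hch.middle (by omega) (by simp [hmid]) (by simp [hmid]) (by simp [hmid]) ?_ hw.edge_right
      hw.edge_left ?_
    · intro z hz
      rw [hmid] at hz
      simp only [Finset.mem_insert, Finset.mem_singleton] at hz
      tauto
    · rw [hFdef, segFrame_cross]
      have := dist_pos.2 hne
      positivity
  have hbetween : trianglesBetween b ω.idx ω.idx = [] := by simp [trianglesBetween]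
  have hlr : (ω.right ++ trianglesBetween b ω.idx ω.idx).length = m + 1 := by
    rw [hbetween, hright]
    simp [hm]
  have hll : (ω.left ++ trianglesBetween b ω.idx ω.idx).length = M - m + 1 := by
    rw [hbetween, hleft]
    simp [hm, hM]
  have hr := IsShortestPath.runsThrough (K := upper F f) hyr hlr (by
    intro j hj
    have hjm : j < m + 1 := by omega
    have hjL : j < L.length := by omega
    have e : (ω.right ++ trianglesBetween b ω.idx ω.idx)[j] = clip ω.seg L[j] := by
      have hL' : L = (UR ++ [tri (b (ω.idx - 1)) (b ω.idx)]) ++ UL := by simp [hLdef]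
      simp only [hbetween, hright, List.append_nil, List.getElem_map, hL']
      exact congrArg _ (List.getElem_append_left _).symm
    rw [e, hf j hjL]
    exact clip_hull hne f j)
  -- The left pieces are listed from the left end of the window, hence in reverse order.
  have hl := IsShortestPath.runsThrough (K := upper F.mirror fun i => f (M - i)) hyl hll (by
    intro j hj
    have hjm : j < M - m + 1 := by omega
    have hjL : M - j < L.length := by omega
    have e : (ω.left ++ trianglesBetween b ω.idx ω.idx)[j] = clip ω.seg L[M - j] := by
      have hL' : UL.reverse ++ [tri (b (ω.idx - 1)) (b ω.idx)] =
        (tri (b (ω.idx - 1)) (b ω.idx) :: UL).reverse := by simp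
      simp only [hbetween, hleft, List.append_nil, List.getElem_map, hL', hLdef,
        List.getElem_reverse]
      rw [List.getElem_append_right (by omega)]
      congr 2
      simp only [List.length_cons]
      omega
    rw [e, hf (M - j) hjL]
    exact clip_hull hne f (M - j))
  refine ⟨f, M, p, m, x, ⟨hmiddle, ⟨hch.strip (by omega), ?_, ?_, ?_⟩, ⟨?_, ?_, ?_, ?_⟩⟩, hp0, hpM,
    ?_⟩
  · rw [hp0]; exact hr.1
  · rw [hp0]; exact hr.2
  · exact fun h => (hmiddle.r_eq h).1
  · exact hch.mirror.strip (by omega)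
  · rw [hpM]; exact hl.1
  · rw [hpM]; exact hl.2
  · exact fun h => (hmiddle.mirror.r_eq h).1
  · rw [hourglassInterior, rightTrace, leftTrace, hlr, hll, TautPair.curve, hp0, hpM]

end BorderRegion

/-! ### The lemma. -/

theorem lemma6
    (N : Network) (B : Set Plane) (hB : N.IsBorderRegion B)
    (T : Geometry.SimplicialComplex ℝ Plane) (hT : IsTriangulation N B T)
    -- the important triangles, through the edges that they share
    (b : ℕ → Seg) (n : ℕ) (hb : IsImportantSequence N T b n)
    -- `ω` starts at the previous window `w(a)`, where `a` is the segment of the stage `σ`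
    (σ ω : Stage) (hσ : IsStage B T b n σ) (hω : NextStage B T b n σ ω)
    -- the initial shortest paths, which bound the hourglass together with `w(a)` and `b ω.idx`
    (yr yl : ℕ → Plane) (hyr : IsRightPath b ω ω.idx yr) (hyl : IsLeftPath b ω ω.idx yl)
    -- the `i`-th important triangle behind the initial edge adds a new right endpoint
    (i : ℕ) (hi : 1 ≤ i) (hin : ω.idx + i ≤ n)
    (hnew : (b (ω.idx + i)).1 = (b (ω.idx + i - 1)).1)
    -- the right shortest path up to the previous edge has no visibility-intersecting segment
    (y : ℕ → Plane) (hy : IsRightPath b ω (ω.idx + i - 1) y)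
    (hdisj : Disjoint (rightTrace b ω (ω.idx + i - 1) y) (hourglassInterior b ω yr yl))
    -- the next edge is partially visible from the window
    (hvis : ∃ q ∈ segment ℝ (b (ω.idx + i)).1 (b (ω.idx + i)).2, Visible b ω (ω.idx + i) q) :
    (segment ℝ (b (ω.idx + i - 1)).2 (b (ω.idx + i)).2 ∩ hourglassInterior b ω yr yl).Nonempty ↔
      (segment ℝ (b (ω.idx + i - 1)).2 (b (ω.idx + i)).2 ∩
        openSegment ℝ ω.seg.1 ω.seg.2).Nonempty := by
  classical
  have hF := hT.triangulatedFace hB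
  have hne := hω.ne hF.isOpen
  obtain ⟨f, M, p, m, x, h, hp0, hpM, hH⟩ := hω.exists_tautPair hF hb hyr hyl hne
  have hpass := hb.passes (k := ω.idx + i - 1) (by omega)
  rw [show ω.idx + i - 1 + 1 = ω.idx + i by omega] at hpass
  -- As the left endpoint is kept, the appended segment is an edge of `T`, to which both directions
  -- of the general statement apply.
  have he := hpass.right_edge hnew
  rw [hH, ← convexHull_coe_pair, ← hp0, ← hpM]
  constructor
  · rintro ⟨q, hqe, hq⟩
    exact Set.not_disjoint_iff_nonempty_inter.1
      (h.not_disjoint_of_mem_enclosed he Finset.card_le_two hqe hq)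
  · rintro ⟨q, hqe, hq⟩
    refine h.exists_mem_enclosed ?_ (segFrame_complex hne) he hqe hq fun v hv hvo => ?_
    · rw [Ne, map_eq_zero]
      exact toC_sub_ne_zero hne.symm
    · rw [hp0, hpM] at hvo
      exact hF.notMem_of_vertex v hv (hω.1.open_subset hvo)
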